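/- Let $n>2$ and let $(N,\varphi,\xi,\eta,g)$ be a $(2n-1)$-dimensional quasi-Sasakian manifold, that is, an almost contact metric manifold ($\varphi^2=-\mathrm{Id}+\eta\otimes\xi$, $\eta(\xi)=1$, $g(\varphi X,\varphi Y)=g(X,Y)-\eta(X)\eta(Y)$) which is normal ($[\varphi,\varphi]+d\eta\otimes\xi=0$, where $d\eta(X,Y)=X\eta(Y)-Y\eta(X)-\eta([X,Y])$) and whose fundamental form $\Phi=g(\varphi\,\cdot,\cdot)$ is closed. Let $F$ be a closed $2$-form on $N$ which represents an integral cohomology class, and let $\pi:P\to N$ be a principal circle bundle with a connection $1$-form $\theta$ whose curvature is $d\theta=\pi^*F$ (here $S^1=\mathbb R/\mathbb Z$, and $\theta$ takes the value $1$ on the generator of its action). Define on $P$ an almost complex structure $J$ and a metric $h$ by $$\theta(JX)=-\eta(\pi_*X),\qquad \pi_*(JX)=\varphi(\pi_*X)+\theta(X)\,\xi,\qquad h(X,Y)=g(\pi_*X,\pi_*Y)+\theta(X)\theta(Y),$$ and assume that $d\theta$ is $J$-invariant, that is, $d\theta(JX,JY)=d\theta(X,Y)$ for all $X,Y$. Then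 the almost Hermitian structure $(J,h)$ is $1$-st Gauduchon, that is, $\partial\overline\partial\,\Omega\wedge\Omega^{n-2}=0$ for its fundamental form $\Omega=h(J\,\cdot,\cdot)$ (where $\partial$ and $\overline\partial$ take a form of type $(p,q)$ to the components of its exterior derivative of types $(p+1,q)$ and $(p,q+1)$), if and only if $$(d\eta\wedge d\eta+F\wedge F)\wedge\Phi^{n-3}=0 .$$ -/

import Mathlib

open scoped Manifold ContDiff Bundle

noncomputable section

namespace CircleBundleGauduchon

/-! ### Multilinear algebra -/

section Algebra

variable {V A : Type*} [AddCommGroup V] [Module ℝ V] [TopologicalSpace V]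
  [NormedCommRing A] [NormedAlgebra ℝ A]

/-- The wedge product of two alternating forms,
`(α ∧ β)(v₁, …, v_{k+l}) = ∑ sign(σ) α(v_{σ(1)}, …, v_{σ(k)}) β(v_{σ(k+1)}, …, v_{σ(k+l)})`,
the sum being over all `(k, l)`-shuffles `σ`. -/
def wedge {k l : ℕ} (α : V [⋀^Fin k]→L[ℝ] A) (β : V [⋀^Fin l]→L[ℝ] A) :
    V [⋀^Fin (k + l)]→L[ℝ] A :=
  { ((LinearMap.mul' ℝ A).compAlternatingMap
      (α.toAlternatingMap.domCoprod β.toAlternatingMap)).domDomCongr finSumFinEquiv with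
    cont := by
      have key : ∀ σ : Equiv.Perm.ModSumCongr (Fin k) (Fin l),
          Continuous fun v : Fin (k + l) → V => LinearMap.mul' ℝ A
            (AlternatingMap.domCoprod.summand α.toAlternatingMap β.toAlternatingMap σ
              (fun i => v (finSumFinEquiv i))) := by
        intro σ
        induction σ using Quotient.inductionOn' with
        | h σ =>
          have h : Continuous fun v : Fin (k + l) → V =>
              (Equiv.Perm.sign σ : ℤˣ) •
                (α (fun i => v (finSumFinEquiv (σ (Sum.inl i)))) *
                  β (fun i => v (finSumFinEquiv (σ (Sum.inr i))))) := by
            refine Continuous.const_smul (Continuous.mul ?_ ?_) _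
            · exact α.cont.comp (continuous_pi fun i => continuous_apply _)
            · exact β.cont.comp (continuous_pi fun i => continuous_apply _)
          refine h.congr fun v => ?_
          rw [AlternatingMap.domCoprod.summand_mk'']
          rw [smul_apply, map_zsmul_unit]
          rfl
      have h2 : Continuous fun v : Fin (k + l) → V =>
          ∑ σ : Equiv.Perm.ModSumCongr (Fin k) (Fin l), LinearMap.mul' ℝ A
            (AlternatingMap.domCoprod.summand α.toAlternatingMap β.toAlternatingMap σ
              (fun i => v (finSumFinEquiv i))) :=
        continuous_finsetSum _ fun σ _ => key σ
      refine h2.congr fun v => ?_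
      rw [← map_sum, ← sum_apply]
      rfl }

/-- The wedge power `α ∧ ⋯ ∧ α` (`j` factors); the zeroth power is the constant `1`. -/
def wedgePow {k : ℕ} (α : V [⋀^Fin k]→L[ℝ] A) : (j : ℕ) → V [⋀^Fin (k * j)]→L[ℝ] A
  | 0 => ContinuousAlternatingMap.constOfIsEmpty ℝ V (Fin 0) (1 : A)
  | j + 1 => wedge (wedgePow α j) α

end Algebra

section ComplexStructure

variable {V : Type*} [AddCommGroup V] [Module ℝ V] [TopologicalSpace V]
  [IsTopologicalAddGroup V] [ContinuousSMul ℝ V]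

/-- A form is of type `(p, q)` with respect to the complex structure `J` on `V` if
`ψ((a + bJ)v₁, …, (a + bJ)v_k) = (a + ib)^p (a - ib)^q ψ(v₁, …, v_k)` for all real `a`, `b`. -/
def IsOfType (J : V →L[ℝ] V) (p q : ℕ) {k : ℕ} (ψ : V [⋀^Fin k]→L[ℝ] ℂ) : Prop :=
  ∀ (a b : ℝ) (v : Fin k → V), ψ (fun i => a • v i + b • J (v i)) =
    ((a : ℂ) + b * Complex.I) ^ p * ((a : ℂ) - b * Complex.I) ^ q * ψ v

/-- The component of type `(p, k - p)` of a complex-valued `k`-form. A form of type `(r, k - r)` is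
multiplied by `exp(i(2r - k)t)` when all its arguments are rotated by `cos t + (sin t) J`, so that
the components are the Fourier coefficients of the rotated form; the average over the `k + 1`
angles `t = πj / (k + 1)` computes them exactly. -/
def typePart (J : V →L[ℝ] V) (p : ℕ) {k : ℕ} (ψ : V [⋀^Fin k]→L[ℝ] ℂ) : V [⋀^Fin k]→L[ℝ] ℂ :=
  ((k : ℂ) + 1)⁻¹ • ∑ j ∈ Finset.range (k + 1),
    Complex.exp (-(((2 * p - k : ℝ) * (Real.pi * j / (k + 1)) : ℝ) * Complex.I)) •
      ψ.compContinuousLinearMap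
        (Real.cos (Real.pi * j / (k + 1)) • ContinuousLinearMap.id ℝ V +
          Real.sin (Real.pi * j / (k + 1)) • J)

theorem IsOfType.rotate {J : V →L[ℝ] V} {r k : ℕ} (hr : r ≤ k) {ψ : V [⋀^Fin k]→L[ℝ] ℂ}
    (h : IsOfType J r (k - r) ψ) (t : ℝ) :
    ψ.compContinuousLinearMap (Real.cos t • ContinuousLinearMap.id ℝ V + Real.sin t • J) =
      Complex.exp (((2 * r - k : ℝ) * t : ℝ) * Complex.I) • ψ := by
  ext v
  have h1 := h (Real.cos t) (Real.sin t) v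
  have e1 : ((Real.cos t : ℝ) : ℂ) + (Real.sin t : ℝ) * Complex.I =
      Complex.exp (t * Complex.I) := by
    rw [Complex.exp_mul_I, Complex.ofReal_cos, Complex.ofReal_sin]
  have e2 : ((Real.cos t : ℝ) : ℂ) - (Real.sin t : ℝ) * Complex.I =
      Complex.exp (-(t * Complex.I)) := by
    rw [← neg_mul, Complex.exp_mul_I, Complex.ofReal_cos, Complex.ofReal_sin, Complex.cos_neg,
      Complex.sin_neg]
    ring
  rw [e1, e2, ← Complex.exp_nat_mul, ← Complex.exp_nat_mul, ← Complex.exp_add] at h1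
  have e3 : (r : ℂ) * (t * Complex.I) + ((k - r : ℕ) : ℂ) * -(t * Complex.I) =
      (((2 * r - k : ℝ) * t : ℝ) : ℂ) * Complex.I := by
    push_cast [Nat.cast_sub hr]
    ring
  rw [e3] at h1
  exact h1

/-- The component of type `(r, k - r)` of a form of that type is the form itself. -/
theorem IsOfType.typePart_self {J : V →L[ℝ] V} {r k : ℕ} (hr : r ≤ k) {ψ : V [⋀^Fin k]→L[ℝ] ℂ}
    (h : IsOfType J r (k - r) ψ) : typePart J r ψ = ψ := by
  have hk : (k : ℂ) + 1 ≠ 0 := by exact_mod_cast Nat.succ_ne_zero k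
  simp only [typePart, h.rotate hr, smul_smul, ← Complex.exp_add, neg_add_cancel, Complex.exp_zero,
    one_smul, Finset.sum_const, Finset.card_range, ← Nat.cast_smul_eq_nsmul ℂ]
  push_cast
  rw [inv_mul_cancel₀ hk, one_smul]

/-- The other components of a form of type `(r, k - r)` vanish. -/
theorem IsOfType.typePart_of_ne {J : V →L[ℝ] V} {p r k : ℕ} (hr : r ≤ k) (hp : p ≤ k) (hpr : p ≠ r)
    {ψ : V [⋀^Fin k]→L[ℝ] ℂ} (h : IsOfType J r (k - r) ψ) : typePart J p ψ = 0 := by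
  have hk : (k : ℂ) + 1 ≠ 0 := by exact_mod_cast Nat.succ_ne_zero k
  simp only [typePart, h.rotate hr, smul_smul, ← Complex.exp_add, ← Finset.sum_smul]
  set z : ℂ := Complex.exp (2 * Real.pi * Complex.I * (((r : ℤ) - p : ℤ) / ((k : ℂ) + 1))) with hz
  have h1 : ∀ j ∈ Finset.range (k + 1),
      Complex.exp (-(((2 * p - k : ℝ) * (Real.pi * j / (k + 1)) : ℝ) * Complex.I) +
        (((2 * r - k : ℝ) * (Real.pi * j / (k + 1)) : ℝ) : ℂ) * Complex.I) = z ^ j := by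
    intro j _
    rw [hz, ← Complex.exp_nat_mul]
    congr 1
    push_cast
    field_simp
    ring
  rw [Finset.sum_congr rfl h1]
  have hz1 : z ≠ 1 := by
    intro hc
    rw [hz, Complex.exp_eq_one_iff] at hc
    obtain ⟨m, hm⟩ := hc
    have hpi : (2 * Real.pi * Complex.I : ℂ) ≠ 0 := Complex.two_pi_I_ne_zero
    rw [mul_comm (m : ℂ)] at hm
    have h2 := mul_left_cancel₀ hpi hm
    rw [div_eq_iff hk] at h2
    have h3 : (r : ℤ) - p = m * (k + 1) := by exact_mod_cast h2
    rcases lt_trichotomy m 0 with hm0 | hm0 | hm0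
    · nlinarith
    · subst hm0
      omega
    · nlinarith
  have hzk : z ^ (k + 1) = 1 := by
    rw [hz, ← Complex.exp_nat_mul, Complex.exp_eq_one_iff]
    refine ⟨(r : ℤ) - p, ?_⟩
    push_cast
    field_simp
  rw [geom_sum_eq hz1, hzk, sub_self, zero_div, mul_zero]
  ext v
  simp

end ComplexStructure

section SkewForm

variable {E : Type*} [NormedAddCommGroup E] [NormedSpace ℝ E]

/-- The `2`-form `(X, Y) ↦ ½ (b(AX, Y) - b(AY, X))`. If `b(A·, ·)` is skew-symmetric, for instance
if `b` is a metric and `A` is skew-adjoint, this is `b(AX, Y)`; see `skewForm_apply_of_skew`. -/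
def skewForm (b : E →L[ℝ] E →L[ℝ] ℝ) (A : E →L[ℝ] E) : E [⋀^Fin 2]→L[ℝ] ℝ where
  toFun v := (1 / 2 : ℝ) * (b (A (v 0)) (v 1) - b (A (v 1)) (v 0))
  map_update_add' := by
    intro _ v i x y
    fin_cases i <;> simp [Function.update] <;> ring
  map_update_smul' := by
    intro _ v i c x
    fin_cases i <;> simp [Function.update] <;> ring
  map_eq_zero_of_eq' := by
    intro v i j h hij
    have h01 : v 0 = v 1 := by
      fin_cases i <;> fin_cases j <;> simp_all
    simp [h01]
  cont := by
    have h (i j : Fin 2) : Continuous fun v : Fin 2 → E => b (A (v i)) (v j) :=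
      ((b.comp A).continuous.comp (continuous_apply i)).clm_apply (continuous_apply j)
    exact continuous_const.mul ((h 0 1).sub (h 1 0))

theorem skewForm_apply_of_skew {b : E →L[ℝ] E →L[ℝ] ℝ} {A : E →L[ℝ] E}
    (h : ∀ X Y, b (A X) Y = -b (A Y) X) (X Y : E) : skewForm b A ![X, Y] = b (A X) Y := by
  have h1 : skewForm b A ![X, Y] = (1 / 2 : ℝ) * (b (A X) Y - b (A Y) X) := rfl
  rw [h1, h X Y]
  ring

end SkewForm

/-! ### Differential forms on manifolds -/

section Forms

/-- `A`-valued differential `k`-forms (not necessarily smooth) on an `m`-dimensional manifold. -/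
abbrev DForm (m : ℕ) (M : Type*) [TopologicalSpace M] [ChartedSpace (EuclideanSpace ℝ (Fin m)) M]
    (A : Type*) [NormedAddCommGroup A] [NormedSpace ℝ A] (k : ℕ) : Type _ :=
  (x : M) → (TangentSpace (𝓡 m) x) [⋀^Fin k]→L[ℝ] A

variable {m : ℕ} {M : Type*} [TopologicalSpace M] [ChartedSpace (EuclideanSpace ℝ (Fin m)) M]
  {m' : ℕ} {M' : Type*} [TopologicalSpace M'] [ChartedSpace (EuclideanSpace ℝ (Fin m')) M']

section Calculus

variable {A : Type*} [NormedAddCommGroup A] [NormedSpace ℝ A] {k : ℕ}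

/-- The expression of a form in the preferred chart at `x₀`: its pullback under the inverse of the
chart (meaningful on the target of the chart, which is open). -/
def inChart (α : DForm m M A k) (x₀ : M) :
    EuclideanSpace ℝ (Fin m) → (EuclideanSpace ℝ (Fin m)) [⋀^Fin k]→L[ℝ] A := fun y =>
  (α ((extChartAt (𝓡 m) x₀).symm y)).compContinuousLinearMap
    (mfderiv 𝓘(ℝ, EuclideanSpace ℝ (Fin m)) (𝓡 m) (extChartAt (𝓡 m) x₀).symm y)

/-- A form is smooth if its expressions in the charts are. -/
def IsSmoothForm (α : DForm m M A k) : Prop :=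
  ∀ x₀ : M, ContDiffOn ℝ ∞ (inChart α x₀) (extChartAt (𝓡 m) x₀).target

/-- The exterior derivative, computed in the chart at each point. -/
def extD (α : DForm m M A k) : DForm m M A (k + 1) := fun x =>
  (extDeriv (inChart α x) (extChartAt (𝓡 m) x x)).compContinuousLinearMap
    (mfderiv (𝓡 m) 𝓘(ℝ, EuclideanSpace ℝ (Fin m)) (extChartAt (𝓡 m) x) x)

/-- The pullback of a form under a map. -/
def pullback (f : M → M') (α : DForm m' M' A k) : DForm m M A k := fun x =>
  (α (f x)).compContinuousLinearMap (mfderiv (𝓡 m) (𝓡 m') f x)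

end Calculus

variable {A : Type*} [NormedCommRing A] [NormedAlgebra ℝ A]

/-- The wedge product of differential forms. -/
def wedgeForm {k l : ℕ} (α : DForm m M A k) (β : DForm m M A l) : DForm m M A (k + l) :=
  fun x => wedge (α x) (β x)

/-- The wedge power of a differential form. -/
def powForm {k : ℕ} (α : DForm m M A k) (j : ℕ) : DForm m M A (k * j) :=
  fun x => wedgePow (α x) j

/-- A real form, viewed as a complex-valued form. -/
def complexify {k : ℕ} (α : DForm m M ℝ k) : DForm m M ℂ k :=
  fun x => Complex.ofRealCLM.compContinuousAlternatingMap (α x)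

/-- Smoothness of a field of endomorphisms of the tangent spaces. -/
def IsSmoothEnd (T : (x : M) → TangentSpace (𝓡 m) x →L[ℝ] TangentSpace (𝓡 m) x)
    [IsManifold (𝓡 m) ∞ M] : Prop :=
  ContMDiff (𝓡 m)
    ((𝓡 m).prod 𝓘(ℝ, EuclideanSpace ℝ (Fin m) →L[ℝ] EuclideanSpace ℝ (Fin m))) ∞
    (fun x => Bundle.TotalSpace.mk' (EuclideanSpace ℝ (Fin m) →L[ℝ] EuclideanSpace ℝ (Fin m))
      (E := fun x : M => TangentSpace (𝓡 m) x →L[ℝ] TangentSpace (𝓡 m) x) x (T x))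

/-- Smoothness of a vector field. -/
def IsSmoothField [IsManifold (𝓡 m) ∞ M] (X : (x : M) → TangentSpace (𝓡 m) x) : Prop :=
  ContMDiff (𝓡 m) (𝓡 m).tangent ∞ (fun x => (⟨x, X x⟩ : TangentBundle (𝓡 m) M))

end Forms

/-! ### Almost Hermitian structures and the first Gauduchon condition -/

section Hermitian

variable {m : ℕ} {M : Type*} [TopologicalSpace M] [ChartedSpace (EuclideanSpace ℝ (Fin m)) M]

/-- `∂`: the sum over `p + q = k` of the `(p + 1, q)`-parts of `d` of the `(p, q)`-parts. -/
def del (J : (x : M) → TangentSpace (𝓡 m) x →L[ℝ] TangentSpace (𝓡 m) x) {k : ℕ}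
    (α : DForm m M ℂ k) : DForm m M ℂ (k + 1) := fun x =>
  ∑ p ∈ Finset.range (k + 1), typePart (J x) (p + 1) (extD (fun y => typePart (J y) p (α y)) x)

/-- `∂̄`: the sum over `p + q = k` of the `(p, q + 1)`-parts of `d` of the `(p, q)`-parts. -/
def delBar (J : (x : M) → TangentSpace (𝓡 m) x →L[ℝ] TangentSpace (𝓡 m) x) {k : ℕ}
    (α : DForm m M ℂ k) : DForm m M ℂ (k + 1) := fun x =>
  ∑ p ∈ Finset.range (k + 1), typePart (J x) p (extD (fun y => typePart (J y) p (α y)) x)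

/-- The form `(X, Y) ↦ b(TX, Y)` of a metric `b` and a `b`-skew-adjoint endomorphism field `T`. -/
def fundamentalForm (T : (x : M) → TangentSpace (𝓡 m) x →L[ℝ] TangentSpace (𝓡 m) x)
    (b : (x : M) → TangentSpace (𝓡 m) x →L[ℝ] TangentSpace (𝓡 m) x →L[ℝ] ℝ) : DForm m M ℝ 2 :=
  fun x => skewForm (E := EuclideanSpace ℝ (Fin m)) (b x) (T x)

/-- The first Gauduchon condition for the almost Hermitian structure `(J, h)` in complex dimension
`n`: `∂∂̄Ω ∧ Ω^{n-2} = 0`, where `Ω = h(J·, ·)` is the fundamental form. -/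
def IsFirstGauduchon (n : ℕ) {M : Type*} [TopologicalSpace M]
    [ChartedSpace (EuclideanSpace ℝ (Fin (2 * n))) M]
    (J : (x : M) → TangentSpace (𝓡 (2 * n)) x →L[ℝ] TangentSpace (𝓡 (2 * n)) x)
    (h : (x : M) → TangentSpace (𝓡 (2 * n)) x →L[ℝ] TangentSpace (𝓡 (2 * n)) x →L[ℝ] ℝ) : Prop :=
  wedgeForm (del J (delBar J (complexify (fundamentalForm J h))))
    (powForm (complexify (fundamentalForm J h)) (n - 2)) = 0

end Hermitian

/-! ### Quasi-Sasakian manifolds -/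

section QuasiSasakian

/-- An almost contact metric structure `(φ, ξ, η, g)`. -/
structure AlmostContactMetric (m : ℕ) (N : Type*) [TopologicalSpace N]
    [ChartedSpace (EuclideanSpace ℝ (Fin m)) N] [IsManifold (𝓡 m) ∞ N] where
  φ : (x : N) → TangentSpace (𝓡 m) x →L[ℝ] TangentSpace (𝓡 m) x
  ξ : (x : N) → TangentSpace (𝓡 m) x
  η : DForm m N ℝ 1
  g : Bundle.ContMDiffRiemannianMetric (𝓡 m) ∞ (EuclideanSpace ℝ (Fin m))
    (fun x : N => TangentSpace (𝓡 m) x)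
  smooth_φ : IsSmoothEnd φ
  smooth_ξ : IsSmoothField ξ
  smooth_η : IsSmoothForm η
  η_ξ : ∀ x, η x ![ξ x] = 1
  φ_φ : ∀ x X, φ x (φ x X) = -X + η x ![X] • ξ x
  g_φ_φ : ∀ x X Y, g.inner x (φ x X) (φ x Y) = g.inner x X Y - η x ![X] * η x ![Y]

variable {m : ℕ} {N : Type*} [TopologicalSpace N] [ChartedSpace (EuclideanSpace ℝ (Fin m)) N]
  [IsManifold (𝓡 m) ∞ N]

/-- The fundamental form `Φ = g(φ·, ·)`. -/
def AlmostContactMetric.Φ (S : AlmostContactMetric m N) : DForm m N ℝ 2 :=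
  fundamentalForm S.φ S.g.inner

/-- Normality: `[φ, φ] + dη ⊗ ξ = 0`, where
`[φ, φ](X, Y) = [φX, φY] + φ²[X, Y] - φ[φX, Y] - φ[X, φY]` and
`dη(X, Y) = X η(Y) - Y η(X) - η([X, Y])`. -/
def AlmostContactMetric.IsNormal (S : AlmostContactMetric m N) : Prop :=
  ∀ X Y : (x : N) → TangentSpace (𝓡 m) x, IsSmoothField X → IsSmoothField Y → ∀ x : N,
    VectorField.mlieBracket (𝓡 m) (fun y => S.φ y (X y)) (fun y => S.φ y (Y y)) x +
      S.φ x (S.φ x (VectorField.mlieBracket (𝓡 m) X Y x)) -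
      S.φ x (VectorField.mlieBracket (𝓡 m) (fun y => S.φ y (X y)) Y x) -
      S.φ x (VectorField.mlieBracket (𝓡 m) X (fun y => S.φ y (Y y)) x) +
      extD S.η x ![X x, Y x] • S.ξ x = 0

/-- A normal almost contact metric structure with closed fundamental form. -/
structure AlmostContactMetric.IsQuasiSasakian (S : AlmostContactMetric m N) : Prop where
  normal : S.IsNormal
  closed : extD S.Φ = 0

end QuasiSasakian

/-! ### Integral cohomology classes -/

section Integral

variable {m : ℕ} {N : Type*} [TopologicalSpace N] [ChartedSpace (EuclideanSpace ℝ (Fin m)) N]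

variable (m N) in
/-- Smooth singular `2`-simplices, parametrized by the triangle `s ≥ 0, t ≥ 0, s + t ≤ 1` in the
`(s, t)`-plane; smoothness on the triangle means that there is a smooth extension, which is chosen
on the whole plane. -/
def SmoothSimplex : Type _ :=
  {σ : ℝ × ℝ → N // ContMDiff 𝓘(ℝ, ℝ × ℝ) (𝓡 m) ∞ σ}

/-- The boundary of an integral combination of singular `2`-simplices, as an integral combination
of paths. -/
def chainBoundary (c : SmoothSimplex m N →₀ ℤ) : (unitInterval → N) →₀ ℤ :=
  c.sum fun σ a =>
    Finsupp.single (fun t : unitInterval => σ.1 (1 - (t : ℝ), (t : ℝ))) a -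
      Finsupp.single (fun t : unitInterval => σ.1 (0, (t : ℝ))) a +
      Finsupp.single (fun t : unitInterval => σ.1 ((t : ℝ), 0)) a

/-- The integral of a `2`-form over a smooth singular `2`-simplex. -/
def integralSimplex (F : DForm m N ℝ 2) (σ : SmoothSimplex m N) : ℝ :=
  ∫ u in {u : ℝ × ℝ | 0 ≤ u.1 ∧ 0 ≤ u.2 ∧ u.1 + u.2 ≤ 1},
    F (σ.1 u) ![mfderiv 𝓘(ℝ, ℝ × ℝ) (𝓡 m) σ.1 u ((1, 0) : ℝ × ℝ),
      mfderiv 𝓘(ℝ, ℝ × ℝ) (𝓡 m) σ.1 u ((0, 1) : ℝ × ℝ)]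

/-- The class of the closed form `F` is integral: the integral of `F` over every smooth singular
`2`-cycle with integer coefficients is an integer. -/
def IsIntegralClass (F : DForm m N ℝ 2) : Prop :=
  ∀ c : SmoothSimplex m N →₀ ℤ, chainBoundary c = 0 →
    ∃ a : ℤ, (c.sum fun σ b => (b : ℝ) * integralSimplex F σ) = a

end Integral

/-! ### Principal circle bundles and connections -/

section CircleBundle

/-- `proj : P → N` is a smooth principal circle bundle for the given action of the circle on `P`
(the group is commutative, so that there is no difference between left and right actions). -/
structure IsPrincipalCircleBundle {m m' : ℕ} {P N : Type*}
    [TopologicalSpace P] [ChartedSpace (EuclideanSpace ℝ (Fin m)) P]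
    [TopologicalSpace N] [ChartedSpace (EuclideanSpace ℝ (Fin m')) N]
    [MulAction Circle P] (proj : P → N) : Prop where
  smooth_action : ContMDiffSMul (𝓡 1) (𝓡 m) ∞ Circle P
  smooth_proj : ContMDiff (𝓡 m) (𝓡 m') ∞ proj
  proj_smul : ∀ (z : Circle) (p : P), proj (z • p) = proj p
  exists_trivialization : ∀ x : N, ∃ e : Bundle.Trivialization Circle proj,
    x ∈ e.baseSet ∧
    ContMDiffOn (𝓡 m) ((𝓡 m').prod (𝓡 1)) ∞ e e.source ∧
    ContMDiffOn ((𝓡 m').prod (𝓡 1)) (𝓡 m) ∞ e.toOpenPartialHomeomorph.symm e.target ∧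
    ∀ (z : Circle), ∀ p ∈ e.source, (e (z • p)).2 = z * (e p).2

variable {m : ℕ} {P : Type*} [TopologicalSpace P] [ChartedSpace (EuclideanSpace ℝ (Fin m)) P]
  [MulAction Circle P]

/-- The generator `d/dt (e^{2πit} p)` at `t = 0` of the action of the circle `ℝ/ℤ`. -/
def circleField (p : P) : TangentSpace (𝓡 m) p :=
  mfderiv 𝓘(ℝ, ℝ) (𝓡 m) (fun t : ℝ => Circle.exp (2 * Real.pi * t) • p) 0 (1 : ℝ)

/-- Connection `1`-forms: smooth invariant `1`-forms taking the value `1` on the generator of the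
action of `ℝ/ℤ` (whose Lie algebra is identified with `ℝ` in the obvious way). -/
structure IsConnectionForm (θ : DForm m P ℝ 1) : Prop where
  smooth : IsSmoothForm θ
  invariant : ∀ z : Circle, pullback (fun p : P => z • p) θ = θ
  generator : ∀ p : P, θ p ![circleField p] = 1

end CircleBundle

/-! ### The almost Hermitian structure on the total space -/

section Ogawa

variable {m m' : ℕ} {P N : Type*}
  [TopologicalSpace P] [ChartedSpace (EuclideanSpace ℝ (Fin m)) P]
  [TopologicalSpace N] [ChartedSpace (EuclideanSpace ℝ (Fin m')) N]

/-- A `1`-form at a point, as a linear functional. -/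
def toCLM (θ : DForm m P ℝ 1) (p : P) : TangentSpace (𝓡 m) p →L[ℝ] ℝ :=
  (ContinuousAlternatingMap.ofSubsingleton ℝ (TangentSpace (𝓡 m) p) ℝ (0 : Fin 1)).symm (θ p)

theorem toCLM_apply (θ : DForm m P ℝ 1) (p : P) (X : TangentSpace (𝓡 m) p) :
    toCLM θ p X = θ p ![X] := by
  have h : (![X] : Fin 1 → TangentSpace (𝓡 m) p) = fun _ => X := by
    funext i
    fin_cases i
    rfl
  rw [h]
  rfl

/-- The map `X ↦ (proj_* X, θ(X))`, which is an isomorphism `T_p P ≃ T_{proj(p)} N × ℝ` if `θ` is a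
connection form; see `isInvertible_splitting`. -/
def splitting (proj : P → N) (θ : DForm m P ℝ 1) (p : P) :
    TangentSpace (𝓡 m) p →L[ℝ] TangentSpace (𝓡 m') (proj p) × ℝ :=
  (mfderiv (𝓡 m) (𝓡 m') proj p).prod (toCLM θ p)


section Splitting

theorem isInvertible_of_bijective {E F : Type*} [NormedAddCommGroup E] [NormedSpace ℝ E]
    [FiniteDimensional ℝ E] [NormedAddCommGroup F] [NormedSpace ℝ F] (f : E →L[ℝ] F)
    (hf : Function.Bijective f) : f.IsInvertible := by
  refine ⟨(LinearEquiv.ofBijective f.toLinearMap hf).toContinuousLinearEquiv, ?_⟩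
  ext x
  rfl

theorem bijective_of_kernel {E F G : Type*} [AddCommGroup E] [Module ℝ E] [AddCommGroup F]
    [Module ℝ F] [AddCommGroup G] [Module ℝ G] (hG : Module.finrank ℝ G = 1)
    (D : E →ₗ[ℝ] F × G) (D' : F × G →ₗ[ℝ] E) (h1 : ∀ w, D' (D w) = w) (h2 : ∀ w, D (D' w) = w)
    (t : E →ₗ[ℝ] ℝ) (v : E) (hv : (D v).1 = 0) (ht : t v = 1) :
    Function.Bijective fun w => ((D w).1, t w) := by
  have hv2 : (D v).2 ≠ 0 := by
    intro h
    have h0 : D v = 0 := Prod.ext hv h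
    have h3 : v = 0 := by rw [← h1 v, h0, map_zero]
    rw [h3, map_zero] at ht
    exact zero_ne_one ht
  constructor
  · intro a b hab
    have e1 : (D (a - b)).1 = 0 := by
      have := congrArg Prod.fst hab
      simpa [sub_eq_zero] using this
    have e2 : t (a - b) = 0 := by
      have := congrArg Prod.snd hab
      simpa [sub_eq_zero] using this
    obtain ⟨c, hc⟩ := (finrank_eq_one_iff_of_nonzero' _ hv2).1 hG (D (a - b)).2
    have e3 : D (c • v) = D (a - b) := by
      rw [map_smul]
      exact Prod.ext (by rw [e1, Prod.smul_fst, hv, smul_zero]) hc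
    have e4 : c • v = a - b := by rw [← h1 (c • v), e3, h1]
    rw [← e4, map_smul, ht, smul_eq_mul, mul_one] at e2
    rw [e2, zero_smul] at e4
    exact sub_eq_zero.1 e4.symm
  · rintro ⟨u, a⟩
    refine ⟨D' (u, 0) + (a - t (D' (u, 0))) • v, ?_⟩
    simp [h2, hv, ht]

/-- A connection form on a principal circle bundle splits the tangent spaces. -/
theorem isInvertible_splitting [IsManifold (𝓡 m) ∞ P] [MulAction Circle P] {proj : P → N}
    (hP : IsPrincipalCircleBundle (m := m) (m' := m') proj) {θ : DForm m P ℝ 1}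
    (hθ : IsConnectionForm θ) (p : P) : (splitting (m' := m') proj θ p).IsInvertible := by
  obtain ⟨e, hx, he, he', -⟩ := hP.exists_trivialization (proj p)
  have hp : p ∈ e.source := e.mem_source.2 hx
  have hpt : e p ∈ e.target := e.map_source hp
  have d1 : MDifferentiableAt (𝓡 m) ((𝓡 m').prod (𝓡 1)) e p :=
    (he.contMDiffAt (e.open_source.mem_nhds hp)).mdifferentiableAt (by simp)
  have d2 : MDifferentiableAt ((𝓡 m').prod (𝓡 1)) (𝓡 m) e.toOpenPartialHomeomorph.symm (e p) :=
    (he'.contMDiffAt (e.open_target.mem_nhds hpt)).mdifferentiableAt (by simp)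
  have hsymm : e.toOpenPartialHomeomorph.symm (e p) = p := e.left_inv hp
  have d1' : MDifferentiableAt (𝓡 m) ((𝓡 m').prod (𝓡 1)) e
      (e.toOpenPartialHomeomorph.symm (e p)) := by rw [hsymm]; exact d1
  have c1 := mfderiv_comp p d2 d1
  have c2 := mfderiv_comp (e p) d1' d2
  have i1 : (e.toOpenPartialHomeomorph.symm ∘ e) =ᶠ[nhds p] id := by
    filter_upwards [e.open_source.mem_nhds hp] with q hq using e.left_inv hq
  have i2 : (e ∘ e.toOpenPartialHomeomorph.symm) =ᶠ[nhds (e p)] id := by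
    filter_upwards [e.open_target.mem_nhds hpt] with q hq using e.right_inv hq
  have i3 : proj =ᶠ[nhds p] Prod.fst ∘ e := by
    filter_upwards [e.open_source.mem_nhds hp] with q hq using (e.proj_toFun q hq).symm
  have c3 : mfderiv (𝓡 m) (𝓡 m') proj p =
      (ContinuousLinearMap.fst ℝ (EuclideanSpace ℝ (Fin m')) (EuclideanSpace ℝ (Fin 1))).comp
        (mfderiv (𝓡 m) ((𝓡 m').prod (𝓡 1)) e p) := by
    rw [i3.mfderiv_eq, mfderiv_comp p mdifferentiableAt_fst d1, mfderiv_fst]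
    rfl
  rw [i1.mfderiv_eq, mfderiv_id] at c1
  rw [i2.mfderiv_eq, mfderiv_id, hsymm] at c2
  have hv : mfderiv (𝓡 m) (𝓡 m') proj p (circleField p) = 0 := by
    have hcurve : MDifferentiableAt 𝓘(ℝ, ℝ) (𝓡 m)
        (fun t : ℝ => Circle.exp (2 * Real.pi * t) • p) 0 := by
      have := hP.smooth_action
      have h1 : ContMDiff 𝓘(ℝ, ℝ) (𝓡 1) ∞ fun t : ℝ => Circle.exp (2 * Real.pi * t) :=
        (contMDiff_circleExp (m := ∞)).comp
          (ContDiff.contMDiff (contDiff_const.mul contDiff_id))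
      have h2 : ContMDiff 𝓘(ℝ, ℝ) (𝓡 m) ∞ fun t : ℝ => Circle.exp (2 * Real.pi * t) • p :=
        h1.smul contMDiff_const
      exact h2.mdifferentiableAt (by simp)
    have h0 : Circle.exp (2 * Real.pi * 0) • p = p := by simp
    have hpr : MDifferentiableAt (𝓡 m) (𝓡 m') proj (Circle.exp (2 * Real.pi * 0) • p) :=
      hP.smooth_proj.mdifferentiableAt (by simp)
    have h3 := mfderiv_comp (0 : ℝ) hpr hcurve
    have h4 : proj ∘ (fun t : ℝ => Circle.exp (2 * Real.pi * t) • p) = fun _ => proj p := by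
      funext t
      exact hP.proj_smul _ _
    rw [h4, mfderiv_const, h0] at h3
    exact (DFunLike.congr_fun h3 (1 : ℝ)).symm
  refine isInvertible_of_bijective (E := EuclideanSpace ℝ (Fin m))
    (F := EuclideanSpace ℝ (Fin m') × ℝ) (splitting (m' := m') proj θ p) ?_
  have hb := bijective_of_kernel (E := EuclideanSpace ℝ (Fin m))
    (F := EuclideanSpace ℝ (Fin m')) (G := EuclideanSpace ℝ (Fin 1)) (by simp)
    (mfderiv (𝓡 m) ((𝓡 m').prod (𝓡 1)) e p).toLinearMap
    (mfderiv ((𝓡 m').prod (𝓡 1)) (𝓡 m) e.toOpenPartialHomeomorph.symm (e p)).toLinearMap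
    (fun w => (DFunLike.congr_fun c1 w).symm) (fun w => (DFunLike.congr_fun c2 w).symm)
    (toCLM θ p).toLinearMap (circleField p)
    (by rw [c3] at hv; exact hv) ((toCLM_apply θ p _).trans (hθ.generator p))
  have hfun : (splitting (m' := m') proj θ p : EuclideanSpace ℝ (Fin m) → _) =
      fun w => ((mfderiv (𝓡 m) ((𝓡 m').prod (𝓡 1)) e p w).1, toCLM θ p w) := by
    funext w
    have := DFunLike.congr_fun c3 w
    exact Prod.ext this rfl
  exact hfun ▸ hb

end Splitting

variable [IsManifold (𝓡 m') ∞ N]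

/-- The endomorphism `J` with `θ(JX) = -η(proj_* X)` and `proj_*(JX) = φ(proj_* X) + θ(X) ξ`: it is
`(u, a) ↦ (φ u + a ξ, -η(u))` in terms of the isomorphism `X ↦ (proj_* X, θ(X))`. -/
def ogawaJ (S : AlmostContactMetric m' N) (proj : P → N) (θ : DForm m P ℝ 1) (p : P) :
    TangentSpace (𝓡 m) p →L[ℝ] TangentSpace (𝓡 m) p :=
  (splitting proj θ p).inverse ∘L
    ((((S.φ (proj p)) ∘L ContinuousLinearMap.fst ℝ (TangentSpace (𝓡 m') (proj p)) ℝ) +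
        (ContinuousLinearMap.snd ℝ (TangentSpace (𝓡 m') (proj p)) ℝ).smulRight (S.ξ (proj p))).prod
      (-((toCLM S.η (proj p)) ∘L ContinuousLinearMap.fst ℝ (TangentSpace (𝓡 m') (proj p)) ℝ))) ∘L
    splitting proj θ p

/-- The metric `h(X, Y) = g(proj_* X, proj_* Y) + θ(X) θ(Y)`. -/
def ogawaMetric (S : AlmostContactMetric m' N) (proj : P → N) (θ : DForm m P ℝ 1) (p : P) :
    TangentSpace (𝓡 m) p →L[ℝ] TangentSpace (𝓡 m) p →L[ℝ] ℝ :=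
  (ContinuousLinearMap.precomp ℝ (mfderiv (𝓡 m) (𝓡 m') proj p) ∘L S.g.inner (proj p)) ∘L
      mfderiv (𝓡 m) (𝓡 m') proj p +
    (toCLM θ p).smulRight (toCLM θ p)

theorem ogawaMetric_apply (S : AlmostContactMetric m' N) (proj : P → N) (θ : DForm m P ℝ 1) (p : P)
    (X Y : TangentSpace (𝓡 m) p) :
    ogawaMetric S proj θ p X Y =
      S.g.inner (proj p) (mfderiv (𝓡 m) (𝓡 m') proj p X) (mfderiv (𝓡 m) (𝓡 m') proj p Y) +
        θ p ![X] * θ p ![Y] := by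
  rw [← toCLM_apply, ← toCLM_apply]
  rfl

/-- The defining equations of `J`. -/
theorem ogawaJ_spec [IsManifold (𝓡 m) ∞ P] [MulAction Circle P] (S : AlmostContactMetric m' N)
    {proj : P → N} (hP : IsPrincipalCircleBundle (m := m) (m' := m') proj) {θ : DForm m P ℝ 1}
    (hθ : IsConnectionForm θ) (p : P) (X : TangentSpace (𝓡 m) p) :
    θ p ![ogawaJ S proj θ p X] = -S.η (proj p) ![mfderiv (𝓡 m) (𝓡 m') proj p X] ∧
      mfderiv (𝓡 m) (𝓡 m') proj p (ogawaJ S proj θ p X) =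
        S.φ (proj p) (mfderiv (𝓡 m) (𝓡 m') proj p X) + θ p ![X] • S.ξ (proj p) := by
  have h : splitting (m' := m') proj θ p (ogawaJ S proj θ p X) =
      (S.φ (proj p) (mfderiv (𝓡 m) (𝓡 m') proj p X) + toCLM θ p X • S.ξ (proj p),
        -toCLM S.η (proj p) (mfderiv (𝓡 m) (𝓡 m') proj p X)) := by
    obtain ⟨e, he⟩ := isInvertible_splitting hP hθ p
    unfold ogawaJ
    rw [← he, ContinuousLinearMap.inverse_equiv]
    refine (e.apply_symm_apply _).trans ?_
    rw [he]
    rfl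
  rw [← toCLM_apply, ← toCLM_apply, ← toCLM_apply]
  exact ⟨congrArg Prod.snd h, congrArg Prod.fst h⟩

theorem AlmostContactMetric.φ_ξ (S : AlmostContactMetric m' N) (x : N) : S.φ x (S.ξ x) = 0 := by
  have h1 : S.φ x (S.φ x (S.ξ x)) = 0 := by rw [S.φ_φ, S.η_ξ, one_smul, neg_add_cancel]
  have h2 := S.φ_φ x (S.φ x (S.ξ x))
  rw [h1, map_zero] at h2
  have h3 : S.φ x (S.ξ x) = S.η x ![S.φ x (S.ξ x)] • S.ξ x := by
    rw [eq_comm, neg_add_eq_zero] at h2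
    exact h2
  set c := S.η x ![S.φ x (S.ξ x)] with hc
  have h4 : (c * c) • S.ξ x = 0 := by
    rw [← smul_smul, ← h3, ← map_smul, ← h3, h1]
  have h5 : S.η x ![(c * c) • S.ξ x] = 0 := by
    rw [h4, ← toCLM_apply, map_zero]
  rw [← toCLM_apply, map_smul, toCLM_apply, S.η_ξ, smul_eq_mul, mul_one, mul_self_eq_zero] at h5
  rw [h3, h5, zero_smul]

theorem AlmostContactMetric.η_φ (S : AlmostContactMetric m' N) (x : N)
    (X : TangentSpace (𝓡 m') x) : S.η x ![S.φ x X] = 0 := by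
  have h := S.φ_φ x (S.φ x X)
  rw [S.φ_φ x X, map_add, map_neg, map_smul, S.φ_ξ, smul_zero, add_zero, left_eq_add] at h
  have h5 : S.η x ![S.η x ![S.φ x X] • S.ξ x] = 0 := by
    rw [h, ← toCLM_apply, map_zero]
  rwa [← toCLM_apply, map_smul, toCLM_apply, S.η_ξ, smul_eq_mul, mul_one] at h5

theorem AlmostContactMetric.g_ξ (S : AlmostContactMetric m' N) (x : N)
    (X : TangentSpace (𝓡 m') x) : S.g.inner x X (S.ξ x) = S.η x ![X] := by
  have h := S.g_φ_φ x X (S.ξ x)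
  rw [S.φ_ξ, map_zero, S.η_ξ, mul_one] at h
  linarith

theorem AlmostContactMetric.g_φ (S : AlmostContactMetric m' N) (x : N)
    (X Y : TangentSpace (𝓡 m') x) : S.g.inner x (S.φ x X) Y = -S.g.inner x (S.φ x Y) X := by
  have h := S.g_φ_φ x X (S.φ x Y)
  rw [S.η_φ, mul_zero, sub_zero, S.φ_φ, map_add, map_neg, map_smul, S.g_ξ, S.η_φ, smul_zero,
    add_zero, S.g.symm x X] at h
  linarith

theorem AlmostContactMetric.Φ_apply (S : AlmostContactMetric m' N) (x : N)
    (X Y : TangentSpace (𝓡 m') x) : S.Φ x ![X, Y] = S.g.inner x (S.φ x X) Y :=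
  skewForm_apply_of_skew (E := EuclideanSpace ℝ (Fin m')) (b := S.g.inner x) (A := S.φ x)
    (S.g_φ x) X Y

/-- `J` is an almost complex structure. -/
theorem ogawaJ_ogawaJ [IsManifold (𝓡 m) ∞ P] [MulAction Circle P] (S : AlmostContactMetric m' N)
    {proj : P → N} (hP : IsPrincipalCircleBundle (m := m) (m' := m') proj) {θ : DForm m P ℝ 1}
    (hθ : IsConnectionForm θ) (p : P) (X : TangentSpace (𝓡 m) p) :
    ogawaJ S proj θ p (ogawaJ S proj θ p X) = -X := by
  obtain ⟨e, he⟩ := isInvertible_splitting hP hθ p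
  have hinj : Function.Injective (splitting (m' := m') proj θ p) := by
    rw [← he]
    exact e.injective
  apply hinj
  obtain ⟨a1, a2⟩ := ogawaJ_spec S hP hθ p X
  obtain ⟨b1, b2⟩ := ogawaJ_spec S hP hθ p (ogawaJ S proj θ p X)
  rw [map_neg]
  refine Prod.ext ?_ ?_
  · refine b2.trans ?_
    rw [a1, a2, map_add, S.φ_φ, map_smul, S.φ_ξ, smul_zero, add_zero, neg_smul,
      add_neg_cancel_right]
    rfl
  · refine (toCLM_apply _ _ _).trans (b1.trans ?_)
    rw [a2, ← toCLM_apply, map_add, map_smul, toCLM_apply, S.η_φ, toCLM_apply, S.η_ξ, smul_eq_mul,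
      mul_one, zero_add, ← toCLM_apply]
    rfl

theorem ogawaMetric_skew [IsManifold (𝓡 m) ∞ P] [MulAction Circle P] (S : AlmostContactMetric m' N)
    {proj : P → N} (hP : IsPrincipalCircleBundle (m := m) (m' := m') proj) {θ : DForm m P ℝ 1}
    (hθ : IsConnectionForm θ) (p : P) (X Y : TangentSpace (𝓡 m) p) :
    ogawaMetric S proj θ p (ogawaJ S proj θ p X) Y =
      -ogawaMetric S proj θ p (ogawaJ S proj θ p Y) X := by
  obtain ⟨a1, a2⟩ := ogawaJ_spec S hP hθ p X
  obtain ⟨b1, b2⟩ := ogawaJ_spec S hP hθ p Y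
  rw [ogawaMetric_apply, ogawaMetric_apply, a1, a2, b1, b2, map_add, map_add, map_smul, map_smul,
    add_apply, add_apply, smul_apply, smul_apply, S.g_φ, S.g.symm _ (S.ξ _),
    S.g.symm _ (S.ξ _), S.g_ξ, S.g_ξ, smul_eq_mul, smul_eq_mul]
  ring

/-- The metric `h` is `J`-Hermitian. -/
theorem ogawaMetric_compatible [IsManifold (𝓡 m) ∞ P] [MulAction Circle P]
    (S : AlmostContactMetric m' N) {proj : P → N}
    (hP : IsPrincipalCircleBundle (m := m) (m' := m') proj) {θ : DForm m P ℝ 1}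
    (hθ : IsConnectionForm θ) (p : P) (X Y : TangentSpace (𝓡 m) p) :
    ogawaMetric S proj θ p (ogawaJ S proj θ p X) (ogawaJ S proj θ p Y) =
      ogawaMetric S proj θ p X Y := by
  rw [ogawaMetric_skew S hP hθ, ogawaJ_ogawaJ S hP hθ, map_neg, neg_apply, neg_neg,
    ogawaMetric_apply, ogawaMetric_apply, S.g.symm, mul_comm]

/-- The fundamental form of `(J, h)` is `h(J·, ·)`. -/
theorem fundamentalForm_ogawa [IsManifold (𝓡 m) ∞ P] [MulAction Circle P]
    (S : AlmostContactMetric m' N) {proj : P → N}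
    (hP : IsPrincipalCircleBundle (m := m) (m' := m') proj) {θ : DForm m P ℝ 1}
    (hθ : IsConnectionForm θ) (p : P) (X Y : TangentSpace (𝓡 m) p) :
    fundamentalForm (ogawaJ S proj θ) (ogawaMetric S proj θ) p ![X, Y] =
      ogawaMetric S proj θ p (ogawaJ S proj θ p X) Y :=
  skewForm_apply_of_skew (E := EuclideanSpace ℝ (Fin m)) (b := ogawaMetric S proj θ p)
    (A := ogawaJ S proj θ p) (ogawaMetric_skew S hP hθ p) X Y

end Ogawa

end CircleBundleGauduchon

open CircleBundleGauduchon

/-!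
Put `ζ = θ + i π*η`. By the definition of `J` and `h`, the form `ζ` is of type `(1, 0)` and
`Ω = π*Φ + θ ∧ π*η` (`fundamentalForm_ogawa_eq`). As `Φ` is closed,
`dΩ = dθ ∧ π*η - π*dη ∧ θ`. Here `dθ` is of type `(1, 1)` by hypothesis. So is `π*dη`: applying `η`
to the normality condition and using Cartan's formula, one finds that `dη` is `φ`-invariant, hence
annihilated by `ξ` (`AlmostContactMetric.IsNormal.extD_η_φ_φ`). Writing `θ` and `π*η` in terms of
`ζ` and its conjugate, one reads off the `(1, 2)`-part of `dΩ`,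
`∂̄Ω = (i/2) (dθ + i π*dη) ∧ (θ - i π*η)`, whose first factor is closed. Its differential
`(i/2) (dθ ∧ dθ + π*dη ∧ π*dη)` is of type `(2, 2)`, so that
`∂∂̄Ω = (i/2) π*(dη ∧ dη + F ∧ F)` (`del_delBar_of_extD_eq`, `del_delBar_fundamentalForm_ogawa`).
This needs that `d` squares to zero and commutes with pullbacks (`extD_extD`, `extD_pullback`) and
the Leibniz rule in low degrees.

The condition is thus `π*G ∧ Ω^(n-2) = 0` with `G = dη ∧ dη + F ∧ F`, an equation between forms of
top degree `2n` on `P`. The generator of the circle action and the horizontal lift of `ξ` span a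
hyperbolic plane for `Ω`, whose `Ω`-orthogonal complement consists of the horizontal lifts of
`ker η`, on which `Ω` is `π*Φ`. Both vectors annihilate `π*G`: `ξ` is in the kernel of `dη`, and of
`F` because the lift of `ξ` is `J` of a vertical vector and `dθ` is `J`-invariant
(`curvature_apply_ξ`). Contracting with the two vectors therefore turns `π*G ∧ Ω^(n-2)` into
`(n - 2) G ∧ Φ^(n-3)` on `ker η`. As `ξ` annihilates `G` and `Φ`, that form is zero on `ker η` if
and only if it is zero on the whole tangent space (`wedge_wedgePow_eq_zero_iff`).
-/

namespace CircleBundleGauduchon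

/-! ### The wedge product as a sum over permutations -/

section WedgeAlgebra

variable {V A : Type*} [NormedCommRing A] [NormedAlgebra ℝ A]

/-- The normalized sum over all permutations which computes the wedge product. It is defined for
arbitrary functions of `k` and `l` vectors, and the number of arguments is only required to be
propositionally equal to `k + l`, so that contractions can be written without casts. -/
def altProd {N k l : ℕ} (h : k + l = N) (f : (Fin k → V) → A) (g : (Fin l → V) → A)
    (u : Fin N → V) : A :=
  ((k.factorial * l.factorial : ℝ))⁻¹ • ∑ σ : Equiv.Perm (Fin N), (Equiv.Perm.sign σ : ℤ) •
    (f (fun i => u (σ (Fin.cast h (Fin.castAdd l i)))) *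
      g (fun j => u (σ (Fin.cast h (Fin.natAdd k j)))))

/-- Only the values of the factors on arguments from a set `H` containing all the `u i` matter. -/
theorem altProd_congr {N k l : ℕ} (h : k + l = N) {f f' : (Fin k → V) → A}
    {g g' : (Fin l → V) → A} {u : Fin N → V} {H : Set V} (hu : ∀ i, u i ∈ H)
    (hf : ∀ w : Fin k → V, (∀ i, w i ∈ H) → f w = f' w)
    (hg : ∀ w : Fin l → V, (∀ i, w i ∈ H) → g w = g' w) :
    altProd h f g u = altProd h f' g' u := by
  unfold altProd
  congr 1
  refine Finset.sum_congr rfl fun σ _ => ?_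
  rw [hf _ fun i => hu _, hg _ fun i => hu _]

theorem altProd_eq_zero_right {N k l : ℕ} (h : k + l = N) {f : (Fin k → V) → A}
    {g : (Fin l → V) → A} {u : Fin N → V} {H : Set V} (hu : ∀ i, u i ∈ H)
    (hg : ∀ w : Fin l → V, (∀ i, w i ∈ H) → g w = 0) : altProd h f g u = 0 := by
  unfold altProd
  rw [Finset.sum_eq_zero, smul_zero]
  intro σ _
  rw [hg _ fun i => hu _, mul_zero, smul_zero]

theorem altProd_smul_left {N k l : ℕ} (h : k + l = N) (c : A) (f : (Fin k → V) → A)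
    (g : (Fin l → V) → A) (u : Fin N → V) :
    altProd h (fun w => c * f w) g u = c * altProd h f g u := by
  unfold altProd
  rw [mul_smul_comm, Finset.mul_sum]
  congr 1
  refine Finset.sum_congr rfl fun σ _ => ?_
  rw [mul_smul_comm, mul_assoc]

theorem altProd_smul_right {N k l : ℕ} (h : k + l = N) (c : A) (f : (Fin k → V) → A)
    (g : (Fin l → V) → A) (u : Fin N → V) :
    altProd h f (fun w => c * g w) u = c * altProd h f g u := by
  unfold altProd
  rw [mul_smul_comm, Finset.mul_sum]
  congr 1
  refine Finset.sum_congr rfl fun σ _ => ?_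
  rw [mul_smul_comm, mul_left_comm]

/-- A permutation of `Fin (N + 1)` is determined by the preimage `p` of `0` and a permutation of
the other values. -/
theorem bijective_extend_mul_cycleRange (N : ℕ) :
    Function.Bijective fun q : Fin (N + 1) × Equiv.Perm (Fin N) =>
      Equiv.Perm.decomposeFin.symm (0, q.2) * Fin.cycleRange q.1 := by
  rw [Fintype.bijective_iff_injective_and_card]
  constructor
  · rintro ⟨p, e⟩ ⟨p', e'⟩ h
    have key : ∀ (p : Fin (N + 1)) (e : Equiv.Perm (Fin N)),
        (Equiv.Perm.decomposeFin.symm (0, e) * Fin.cycleRange p) p = 0 := by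
      intro p e
      simp
    have h1 := key p e
    have hp : p = p' := by
      apply (Equiv.Perm.decomposeFin.symm (0, e') * Fin.cycleRange p').injective
      exact ((DFunLike.congr_fun h p).symm.trans (key p e)).trans (key p' e').symm
    subst hp
    have h2 := mul_right_cancel h
    have h3 := Equiv.Perm.decomposeFin.symm.injective h2
    exact Prod.ext rfl (Prod.ext_iff.1 h3).2
  · simp [Fintype.card_perm, Nat.factorial_succ]

theorem cons_comp_extend_mul_cycleRange {N : ℕ} (x : V) (u : Fin N → V) (p : Fin (N + 1))
    (e : Equiv.Perm (Fin N)) :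
    (fun i => (Fin.cons x u : Fin (N + 1) → V)
      ((Equiv.Perm.decomposeFin.symm (0, e) * Fin.cycleRange p) i)) =
      p.insertNth x (fun i => u (e i)) := by
  have h : (fun i => (Fin.cons x u : Fin (N + 1) → V) (Equiv.Perm.decomposeFin.symm (0, e) i)) =
      Fin.cons x (fun i => u (e i)) := by
    funext i
    refine Fin.cases ?_ (fun j => ?_) i
    · simp
    · simp
  rw [← Fin.cons_comp_cycleRange, ← h]
  rfl

theorem sign_extend_mul_cycleRange {N : ℕ} (p : Fin (N + 1)) (e : Equiv.Perm (Fin N)) :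
    (Equiv.Perm.sign (Equiv.Perm.decomposeFin.symm (0, e) * Fin.cycleRange p) : ℤ) =
      (-1) ^ (p : ℕ) * Equiv.Perm.sign e := by
  rw [Equiv.Perm.sign_mul, Fin.sign_cycleRange, Equiv.Perm.decomposeFin.symm_sign, if_pos rfl,
    one_mul, mul_comm]
  push_cast
  rfl

/-- The expansion of `altProd` along its first argument `x`, according to the place to which `x`
is moved. -/
theorem altProd_cons_expand {N k l : ℕ} (h : k + l = N + 1) (f : (Fin k → V) → A)
    (g : (Fin l → V) → A) (x : V) (u : Fin N → V) :
    altProd h f g (Fin.cons x u) =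
      ((k.factorial * l.factorial : ℝ))⁻¹ •
        (∑ q : Fin k, ∑ e : Equiv.Perm (Fin N), ((-1) ^ (q : ℕ) * (Equiv.Perm.sign e : ℤ)) •
          (f (fun i => Fin.insertNth (α := fun _ => V) (Fin.cast h (Fin.castAdd l q)) x
              (fun i => u (e i))
            (Fin.cast h (Fin.castAdd l i))) *
            g (fun j => Fin.insertNth (α := fun _ => V) (Fin.cast h (Fin.castAdd l q)) x
                (fun i => u (e i))
              (Fin.cast h (Fin.natAdd k j)))) +
        ∑ q : Fin l, ∑ e : Equiv.Perm (Fin N), ((-1) ^ (k + q : ℕ) * (Equiv.Perm.sign e : ℤ)) •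
          (f (fun i => Fin.insertNth (α := fun _ => V) (Fin.cast h (Fin.natAdd k q)) x
              (fun i => u (e i))
            (Fin.cast h (Fin.castAdd l i))) *
            g (fun j => Fin.insertNth (α := fun _ => V) (Fin.cast h (Fin.natAdd k q)) x
                (fun i => u (e i))
              (Fin.cast h (Fin.natAdd k j))))) := by
  unfold altProd
  congr 1
  rw [← Fintype.sum_equiv (Equiv.ofBijective _ (bijective_extend_mul_cycleRange N)) _ _
    (fun q => rfl), Fintype.sum_prod_type, ← Fintype.sum_equiv (finCongr h) _ _ (fun q => rfl),
    Fin.sum_univ_add]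
  simp only [finCongr_apply, Equiv.ofBijective_apply, sign_extend_mul_cycleRange]
  have key : ∀ (p : Fin (N + 1)) (e : Equiv.Perm (Fin N)) (i : Fin (N + 1)),
      (Fin.cons x u : Fin (N + 1) → V)
        ((Equiv.Perm.decomposeFin.symm (0, e) * Fin.cycleRange p) i) =
      (p.insertNth x (fun i => u (e i)) : Fin (N + 1) → V) i := fun p e i =>
    congrFun (cons_comp_extend_mul_cycleRange x u p e) i
  simp only [key, Fin.val_cast, Fin.val_castAdd, Fin.val_natAdd]

theorem insertNth_castAdd_castAdd {N k l : ℕ} (h : k + 1 + l = N + 1) (h' : k + l = N) (x : V)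
    (w : Fin N → V) (q : Fin (k + 1)) :
    (fun i => ((Fin.cast h (Fin.castAdd l q)).insertNth x w : Fin (N + 1) → V)
      (Fin.cast h (Fin.castAdd l i))) =
      q.insertNth x (fun i => w (Fin.cast h' (Fin.castAdd l i))) := by
  funext i
  rcases Fin.eq_self_or_eq_succAbove q i with rfl | ⟨j, rfl⟩
  · simp
  · have e : Fin.cast h (Fin.castAdd l (q.succAbove j)) =
        (Fin.cast h (Fin.castAdd l q)).succAbove (Fin.cast h' (Fin.castAdd l j)) := by
      ext
      simp only [Fin.succAbove, Fin.lt_def, Fin.val_cast, Fin.val_castAdd, Fin.val_castSucc]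
      split_ifs <;> simp
    rw [e, Fin.insertNth_apply_succAbove, Fin.insertNth_apply_succAbove]

theorem insertNth_castAdd_natAdd {N k l : ℕ} (h : k + 1 + l = N + 1) (h' : k + l = N) (x : V)
    (w : Fin N → V) (q : Fin (k + 1)) (j : Fin l) :
    ((Fin.cast h (Fin.castAdd l q)).insertNth x w : Fin (N + 1) → V)
      (Fin.cast h (Fin.natAdd (k + 1) j)) = w (Fin.cast h' (Fin.natAdd k j)) := by
  have e : Fin.cast h (Fin.natAdd (k + 1) j) =
      (Fin.cast h (Fin.castAdd l q)).succAbove (Fin.cast h' (Fin.natAdd k j)) := by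
    ext
    have := q.2
    simp only [Fin.succAbove, Fin.lt_def, Fin.val_cast, Fin.val_castAdd, Fin.val_castSucc,
      Fin.val_natAdd]
    rw [if_neg (by omega)]
    simp only [Fin.val_succ, Fin.val_cast, Fin.val_natAdd]
    omega
  rw [e, Fin.insertNth_apply_succAbove]

theorem insertNth_natAdd_natAdd {N k l : ℕ} (h : k + (l + 1) = N + 1) (h' : k + l = N) (x : V)
    (w : Fin N → V) (q : Fin (l + 1)) :
    (fun j => ((Fin.cast h (Fin.natAdd k q)).insertNth x w : Fin (N + 1) → V)
      (Fin.cast h (Fin.natAdd k j))) =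
      q.insertNth x (fun j => w (Fin.cast h' (Fin.natAdd k j))) := by
  funext i
  rcases Fin.eq_self_or_eq_succAbove q i with rfl | ⟨j, rfl⟩
  · simp
  · have e : Fin.cast h (Fin.natAdd k (q.succAbove j)) =
        (Fin.cast h (Fin.natAdd k q)).succAbove (Fin.cast h' (Fin.natAdd k j)) := by
      ext
      simp only [Fin.succAbove, Fin.lt_def, Fin.val_cast, Fin.val_natAdd, Fin.val_castSucc]
      split_ifs with h1 h2 h2
      · simp
      · omega
      · omega
      · simp [add_assoc]
    rw [e, Fin.insertNth_apply_succAbove, Fin.insertNth_apply_succAbove]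

theorem insertNth_natAdd_castAdd {N k l : ℕ} (h : k + (l + 1) = N + 1) (h' : k + l = N) (x : V)
    (w : Fin N → V) (q : Fin (l + 1)) (i : Fin k) :
    ((Fin.cast h (Fin.natAdd k q)).insertNth x w : Fin (N + 1) → V)
      (Fin.cast h (Fin.castAdd (l + 1) i)) = w (Fin.cast h' (Fin.castAdd l i)) := by
  have e : Fin.cast h (Fin.castAdd (l + 1) i) =
      (Fin.cast h (Fin.natAdd k q)).succAbove (Fin.cast h' (Fin.castAdd l i)) := by
    ext
    have := i.2
    simp only [Fin.succAbove, Fin.lt_def, Fin.val_cast, Fin.val_castAdd, Fin.val_castSucc,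
      Fin.val_natAdd]
    rw [if_pos (by omega)]
    simp
  rw [e, Fin.insertNth_apply_succAbove]

variable [AddCommGroup V] [Module ℝ V]

/-- The wedge product, defined by a sum over shuffles, is the normalized sum over all permutations:
each shuffle stands for a coset of `k! l!` permutations with equal summands. -/
theorem wedge_apply [TopologicalSpace V] {k l : ℕ} (α : V [⋀^Fin k]→L[ℝ] A)
    (β : V [⋀^Fin l]→L[ℝ] A) (u : Fin (k + l) → V) : wedge α β u = altProd rfl α β u := by
  have h := congrArg (fun ψ => LinearMap.mul' ℝ A (ψ fun i => u (finSumFinEquiv i)))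
    (MultilinearMap.domCoprod_alternization_eq α.toAlternatingMap β.toAlternatingMap)
  have e : wedge α β u = LinearMap.mul' ℝ A
      (α.toAlternatingMap.domCoprod β.toAlternatingMap fun i => u (finSumFinEquiv i)) := rfl
  have e1 : LinearMap.mul' ℝ A (((Fintype.card (Fin k)).factorial *
      (Fintype.card (Fin l)).factorial) •
        α.toAlternatingMap.domCoprod β.toAlternatingMap <| fun i => u (finSumFinEquiv i)) =
      (k.factorial * l.factorial) • wedge α β u := by
    rw [e, ← map_nsmul, Fintype.card_fin, Fintype.card_fin]
    rfl
  replace h := h.trans e1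
  rw [MultilinearMap.alternatization_apply, map_sum] at h
  have hne : ((k.factorial * l.factorial : ℝ)) ≠ 0 := by positivity
  rw [altProd, eq_inv_smul_iff₀ hne]
  have e2 : ((k.factorial * l.factorial : ℝ)) • wedge α β u =
      (k.factorial * l.factorial) • wedge α β u := by
    rw [← Nat.cast_smul_eq_nsmul ℝ, Nat.cast_mul]
  rw [e2, ← h]
  refine Fintype.sum_equiv finSumFinEquiv.permCongr _ _ fun σ => ?_
  rw [Equiv.Perm.sign_permCongr]
  simp only [MultilinearMap.domDomCongr_apply, MultilinearMap.domCoprod_apply, map_zsmul_unit,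
    LinearMap.mul'_apply, Equiv.permCongr_apply, Fin.cast_eq_self,
    finSumFinEquiv_symm_apply_castAdd,
    finSumFinEquiv_symm_apply_natAdd]
  rfl

/-- The part of the expansion along `x` in which `x` becomes an argument of `f`. -/
theorem expand_left_eq {N k l : ℕ} (h : k + 1 + l = N + 1) (h' : k + l = N)
    (f : V [⋀^Fin (k + 1)]→ₗ[ℝ] A) (g : (Fin l → V) → A) (x : V) (u : Fin N → V) :
    (((k + 1).factorial * l.factorial : ℝ))⁻¹ •
      (∑ q : Fin (k + 1), ∑ e : Equiv.Perm (Fin N), ((-1) ^ (q : ℕ) * (Equiv.Perm.sign e : ℤ)) •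
        (f (fun i => Fin.insertNth (α := fun _ => V) (Fin.cast h (Fin.castAdd l q)) x
            (fun i => u (e i))
          (Fin.cast h (Fin.castAdd l i))) *
          g (fun j => Fin.insertNth (α := fun _ => V) (Fin.cast h (Fin.castAdd l q)) x
              (fun i => u (e i))
            (Fin.cast h (Fin.natAdd (k + 1) j))))) =
      altProd h' (fun w => f (Fin.cons x w)) g u := by
  have step : ∀ (q : Fin (k + 1)) (e : Equiv.Perm (Fin N)),
      ((-1) ^ (q : ℕ) * (Equiv.Perm.sign e : ℤ)) •
        (f (fun i => Fin.insertNth (α := fun _ => V) (Fin.cast h (Fin.castAdd l q)) x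
            (fun i => u (e i))
          (Fin.cast h (Fin.castAdd l i))) *
          g (fun j => Fin.insertNth (α := fun _ => V) (Fin.cast h (Fin.castAdd l q)) x
              (fun i => u (e i))
            (Fin.cast h (Fin.natAdd (k + 1) j)))) =
      (Equiv.Perm.sign e : ℤ) •
        (f (Fin.cons x (fun i => u (e (Fin.cast h' (Fin.castAdd l i))))) *
          g (fun j => u (e (Fin.cast h' (Fin.natAdd k j))))) := by
    intro q e
    -- moving `x` to the front of `f` gives the same sign again
    rw [insertNth_castAdd_castAdd h h', AlternatingMap.map_insertNth]
    simp only [insertNth_castAdd_natAdd h h']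
    rw [smul_mul_assoc, smul_smul, mul_right_comm, ← mul_pow, neg_one_mul, neg_neg, one_pow,
      one_mul]
    rfl
  simp only [step, Finset.sum_const, Finset.card_univ, Fintype.card_fin]
  unfold altProd
  rw [← Nat.cast_smul_eq_nsmul ℝ, smul_smul]
  congr 1
  rw [Nat.factorial_succ]
  push_cast
  field_simp

/-- The part of the expansion along `x` in which `x` becomes an argument of `g`. -/
theorem expand_right_eq {N k l : ℕ} (h : k + (l + 1) = N + 1) (h' : k + l = N)
    (f : (Fin k → V) → A) (g : V [⋀^Fin (l + 1)]→ₗ[ℝ] A) (x : V) (u : Fin N → V) :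
    ((k.factorial * (l + 1).factorial : ℝ))⁻¹ •
      (∑ q : Fin (l + 1), ∑ e : Equiv.Perm (Fin N),
        ((-1) ^ (k + q : ℕ) * (Equiv.Perm.sign e : ℤ)) •
        (f (fun i => Fin.insertNth (α := fun _ => V) (Fin.cast h (Fin.natAdd k q)) x
            (fun i => u (e i))
          (Fin.cast h (Fin.castAdd (l + 1) i))) *
          g (fun j => Fin.insertNth (α := fun _ => V) (Fin.cast h (Fin.natAdd k q)) x
              (fun i => u (e i))
            (Fin.cast h (Fin.natAdd k j))))) =
      (-1) ^ k * altProd h' f (fun w => g (Fin.cons x w)) u := by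
  have step : ∀ (q : Fin (l + 1)) (e : Equiv.Perm (Fin N)),
      ((-1) ^ (k + q : ℕ) * (Equiv.Perm.sign e : ℤ)) •
        (f (fun i => Fin.insertNth (α := fun _ => V) (Fin.cast h (Fin.natAdd k q)) x
            (fun i => u (e i))
          (Fin.cast h (Fin.castAdd (l + 1) i))) *
          g (fun j => Fin.insertNth (α := fun _ => V) (Fin.cast h (Fin.natAdd k q)) x
              (fun i => u (e i))
            (Fin.cast h (Fin.natAdd k j)))) =
      (-1) ^ k * ((Equiv.Perm.sign e : ℤ) •
        (f (fun i => u (e (Fin.cast h' (Fin.castAdd l i)))) *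
          g (Fin.cons x (fun j => u (e (Fin.cast h' (Fin.natAdd k j))))))) := by
    intro q e
    -- moving `x` to the front of `g` leaves the sign for passing the `k` arguments of `f`
    rw [insertNth_natAdd_natAdd h h', AlternatingMap.map_insertNth]
    simp only [insertNth_natAdd_castAdd h h']
    rw [mul_smul_comm, smul_smul, mul_right_comm, pow_add, mul_assoc ((-1) ^ k), ← mul_pow,
      neg_one_mul, neg_neg, one_pow, mul_one, mul_smul, zsmul_eq_mul]
    push_cast
    rfl
  simp only [step, Finset.sum_const, Finset.card_univ, Fintype.card_fin, ← Finset.mul_sum]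
  unfold altProd
  rw [← Nat.cast_smul_eq_nsmul ℝ, smul_smul, mul_smul_comm]
  congr 1
  rw [Nat.factorial_succ]
  push_cast
  field_simp

/-- Contraction with a vector is an antiderivation of the wedge product. -/
theorem altProd_cons {N k l : ℕ} (h : k + 1 + (l + 1) = N + 1) (h₁ : k + (l + 1) = N)
    (h₂ : k + 1 + l = N) (f : V [⋀^Fin (k + 1)]→ₗ[ℝ] A) (g : V [⋀^Fin (l + 1)]→ₗ[ℝ] A) (x : V)
    (u : Fin N → V) :
    altProd h f g (Fin.cons x u) = altProd h₁ (fun w => f (Fin.cons x w)) g u +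
      (-1) ^ (k + 1) * altProd h₂ f (fun w => g (Fin.cons x w)) u := by
  rw [altProd_cons_expand, smul_add, expand_left_eq h h₁, expand_right_eq h h₂]

/-- Contraction of `f ∧ g` with a vector `x` whose contraction with `f` vanishes. Here `f` may have
degree `0`. -/
theorem altProd_cons_of_left {N k l : ℕ} (h : k + (l + 1) = N + 1) (h' : k + l = N)
    (f : (Fin k → V) → A) (g : V [⋀^Fin (l + 1)]→ₗ[ℝ] A) (x : V)
    (hf : ∀ (w : Fin k → V) (i : Fin k), w i = x → f w = 0) (u : Fin N → V) :
    altProd h f g (Fin.cons x u) = (-1) ^ k * altProd h' f (fun w => g (Fin.cons x w)) u := by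
  rw [altProd_cons_expand, smul_add, expand_right_eq h h', add_eq_right, Finset.sum_eq_zero,
    smul_zero]
  intro q _
  refine Finset.sum_eq_zero fun e _ => ?_
  rw [hf _ q (by simp), zero_mul, smul_zero]

/-- The product with a constant. -/
theorem altProd_degree_zero {k : ℕ} (f : V [⋀^Fin k]→ₗ[ℝ] A) (g : (Fin 0 → V) → A)
    (u : Fin k → V) : altProd (add_zero k) f g u = f u * g ![] := by
  unfold altProd
  have step : ∀ σ : Equiv.Perm (Fin k), (Equiv.Perm.sign σ : ℤ) •
      (f (fun i => u (σ (Fin.cast (add_zero k) (Fin.castAdd 0 i)))) *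
        g (fun j => u (σ (Fin.cast (add_zero k) (Fin.natAdd k j))))) = f u * g ![] := by
    intro σ
    have e1 : (fun i => u (σ (Fin.cast (add_zero k) (Fin.castAdd 0 i)))) = u ∘ σ := rfl
    have e2 : (fun j : Fin 0 => u (σ (Fin.cast (add_zero k) (Fin.natAdd k j)))) = ![] :=
      Subsingleton.elim _ _
    rw [e1, e2, AlternatingMap.map_perm, smul_mul_assoc]
    rcases Int.units_eq_one_or (Equiv.Perm.sign σ) with hs | hs <;> simp [hs]
  rw [Finset.sum_congr rfl fun σ _ => step σ, Finset.sum_const, Finset.card_univ,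
    Fintype.card_perm, Fintype.card_fin, ← Nat.cast_smul_eq_nsmul ℝ, smul_smul]
  have : (k.factorial : ℝ) ≠ 0 := by positivity
  simp [this]

end WedgeAlgebra

section WedgeAlgebra

variable {V W A : Type*} [NormedCommRing A] [NormedAlgebra ℝ A]

theorem altProd_add_left {N k l : ℕ} (h : k + l = N) (f f' : (Fin k → V) → A)
    (g : (Fin l → V) → A) (u : Fin N → V) :
    altProd h (fun w => f w + f' w) g u = altProd h f g u + altProd h f' g u := by
  simp only [altProd, add_mul, smul_add, Finset.sum_add_distrib]

theorem altProd_add_right {N k l : ℕ} (h : k + l = N) (f : (Fin k → V) → A)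
    (g g' : (Fin l → V) → A) (u : Fin N → V) :
    altProd h f (fun w => g w + g' w) u = altProd h f g u + altProd h f g' u := by
  simp only [altProd, mul_add, smul_add, Finset.sum_add_distrib]

theorem altProd_comp {N k l : ℕ} (h : k + l = N) (f : (Fin k → W) → A)
    (g : (Fin l → W) → A) (L : V → W) (u : Fin N → V) :
    altProd h (fun w => f fun i => L (w i)) (fun w => g fun i => L (w i)) u =
      altProd h f g (fun i => L (u i)) := rfl

/-- A vector in the kernel of both factors is in the kernel of the product. -/
theorem altProd_eq_zero_of_kernel {N k l : ℕ} (h : k + l = N) {f : (Fin k → V) → A}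
    {g : (Fin l → V) → A} {x : V} (hf : ∀ (w : Fin k → V) (i : Fin k), w i = x → f w = 0)
    (hg : ∀ (w : Fin l → V) (i : Fin l), w i = x → g w = 0) (u : Fin N → V) (i : Fin N)
    (hu : u i = x) : altProd h f g u = 0 := by
  subst h
  unfold altProd
  rw [Finset.sum_eq_zero, smul_zero]
  intro σ _
  obtain ⟨p, rfl⟩ := σ.surjective i
  induction p using Fin.addCases with
  | left q => rw [hf _ q hu, zero_mul, smul_zero]
  | right q => rw [hg _ q hu, mul_zero, smul_zero]

/-- Forms of degree `2` commute. -/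
theorem altProd_comm_two (f g : (Fin 2 → V) → A) (u : Fin 4 → V) :
    altProd (N := 4) rfl f g u = altProd rfl g f u := by
  unfold altProd
  congr 1
  -- `c` is even and swaps the first two arguments with the last two
  let c : Equiv.Perm (Fin 4) := finRotate 4 * finRotate 4
  rw [← Fintype.sum_equiv (Equiv.mulRight c) _ _ fun σ => rfl]
  refine Finset.sum_congr rfl fun σ _ => ?_
  have hc : Equiv.Perm.sign c = 1 := by decide
  rw [Equiv.coe_mulRight, Equiv.Perm.sign_mul, hc, mul_one, mul_comm]
  have e1 : ∀ i : Fin 2, (σ * c) (Fin.cast rfl (Fin.castAdd 2 i)) =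
      σ (Fin.cast rfl (Fin.natAdd 2 i)) := by
    intro i
    fin_cases i <;> rfl
  have e2 : ∀ i : Fin 2, (σ * c) (Fin.cast rfl (Fin.natAdd 2 i)) =
      σ (Fin.cast rfl (Fin.castAdd 2 i)) := by
    intro i
    fin_cases i <;> rfl
  simp only [e1, e2]

variable [AddCommGroup V] [Module ℝ V] [AddCommGroup W] [Module ℝ W]

theorem altProd_one_one (f g : V [⋀^Fin 1]→ₗ[ℝ] A) (x y : V) :
    altProd (N := 2) rfl f g ![x, y] = f ![x] * g ![y] - f ![y] * g ![x] := by
  have h := altProd_cons (N := 1) (k := 0) (l := 0) rfl rfl rfl f g x ![y]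
  have h1 := altProd_cons_of_left (N := 0) (k := 0) (l := 0) rfl rfl
    (fun w => f (Fin.cons x w)) g y (fun _ i => i.elim0) ![]
  have h2 := altProd_degree_zero (A := A) (AlternatingMap.constOfIsEmpty ℝ V (Fin 0) (f ![x]))
    (fun w => g (Fin.cons y w)) ![]
  have h3 := altProd_degree_zero f (fun w => g (Fin.cons x w)) ![y]
  have e : (fun w : Fin 0 → V => f (Fin.cons x w)) =
      AlternatingMap.constOfIsEmpty ℝ V (Fin 0) (f ![x]) := by
    funext w
    rw [Subsingleton.elim w ![]]
    rfl
  rw [e] at h h1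
  refine h.trans ?_
  refine (congrArg₂ (· + ·) (h1.trans (congrArg _ h2)) (congrArg _ h3)).trans ?_
  simp only [AlternatingMap.constOfIsEmpty_apply]
  change (-1) ^ 0 * (f ![x] * g ![y]) + (-1) ^ (0 + 1) * (f ![y] * g ![x]) = _
  ring

theorem altProd_two_one (f : V [⋀^Fin 2]→ₗ[ℝ] A) (g : V [⋀^Fin 1]→ₗ[ℝ] A) (x y z : V) :
    altProd (N := 3) rfl f g ![x, y, z] =
      f ![x, y] * g ![z] - f ![x, z] * g ![y] + f ![y, z] * g ![x] := by
  have h := altProd_cons (N := 2) (k := 1) (l := 0) rfl rfl rfl f g x ![y, z]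
  have h1 := altProd_one_one (f.curryLeft x) g y z
  have h2 := altProd_degree_zero f (fun w => g (Fin.cons x w)) ![y, z]
  refine h.trans ((congrArg₂ (· + ·) h1 (congrArg _ h2)).trans ?_)
  change (f ![x, y] * g ![z] - f ![x, z] * g ![y]) + (-1) ^ (1 + 1) * (f ![y, z] * g ![x]) = _
  ring

variable [TopologicalSpace V] [TopologicalSpace W]

theorem wedge_one_one (α β : V [⋀^Fin 1]→L[ℝ] A) (x y : V) :
    wedge α β ![x, y] = α ![x] * β ![y] - α ![y] * β ![x] :=
  (wedge_apply α β _).trans (altProd_one_one α.toAlternatingMap β.toAlternatingMap x y)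

theorem wedge_two_one (α : V [⋀^Fin 2]→L[ℝ] A) (β : V [⋀^Fin 1]→L[ℝ] A) (x y z : V) :
    wedge α β ![x, y, z] = α ![x, y] * β ![z] - α ![x, z] * β ![y] + α ![y, z] * β ![x] :=
  (wedge_apply α β _).trans (altProd_two_one α.toAlternatingMap β.toAlternatingMap x y z)

theorem wedge_comm_two (α β : V [⋀^Fin 2]→L[ℝ] A) : wedge α β = wedge β α := by
  ext u
  rw [wedge_apply, wedge_apply]
  exact altProd_comm_two α β u

theorem wedge_compContinuousLinearMap {k l : ℕ} (α : W [⋀^Fin k]→L[ℝ] A)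
    (β : W [⋀^Fin l]→L[ℝ] A) (L : V →L[ℝ] W) :
    wedge (α.compContinuousLinearMap L) (β.compContinuousLinearMap L) =
      (wedge α β).compContinuousLinearMap L := by
  ext u
  rw [wedge_apply]
  exact (wedge_apply α β fun i => L (u i)).symm

theorem wedgePow_compContinuousLinearMap {k : ℕ} (α : W [⋀^Fin k]→L[ℝ] A) (L : V →L[ℝ] W)
    (j : ℕ) :
    wedgePow (α.compContinuousLinearMap L) j = (wedgePow α j).compContinuousLinearMap L := by
  induction j with
  | zero => rfl
  | succ j ih => rw [wedgePow, ih, wedge_compContinuousLinearMap]; rfl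

theorem wedge_ofReal {k l : ℕ} (α : V [⋀^Fin k]→L[ℝ] ℝ) (β : V [⋀^Fin l]→L[ℝ] ℝ) :
    wedge (Complex.ofRealCLM.compContinuousAlternatingMap α)
      (Complex.ofRealCLM.compContinuousAlternatingMap β) =
      Complex.ofRealCLM.compContinuousAlternatingMap (wedge α β) := by
  ext u
  rw [wedge_apply]
  refine Eq.trans ?_ (congrArg Complex.ofRealCLM (wedge_apply α β u)).symm
  unfold altProd
  rw [map_smul, map_sum]
  congr 1
  refine Finset.sum_congr rfl fun σ _ => ?_
  rw [map_zsmul]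
  congr 1
  exact (Complex.ofReal_mul _ _).symm

theorem wedgePow_ofReal {k : ℕ} (α : V [⋀^Fin k]→L[ℝ] ℝ) (j : ℕ) :
    wedgePow (Complex.ofRealCLM.compContinuousAlternatingMap α) j =
      Complex.ofRealCLM.compContinuousAlternatingMap (wedgePow α j) := by
  induction j with
  | zero =>
    ext u
    exact Complex.ofReal_one.symm
  | succ j ih => rw [wedgePow, ih, wedge_ofReal]; rfl

theorem wedge_smul_left {k l : ℕ} (c : ℂ) (α : V [⋀^Fin k]→L[ℝ] ℂ) (β : V [⋀^Fin l]→L[ℝ] ℂ) :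
    wedge (c • α) β = c • wedge α β := by
  ext u
  rw [wedge_apply]
  exact (altProd_smul_left rfl c α β u).trans (congrArg (c * ·) (wedge_apply α β u).symm)

theorem wedge_smul_right {k l : ℕ} (c : ℂ) (α : V [⋀^Fin k]→L[ℝ] ℂ) (β : V [⋀^Fin l]→L[ℝ] ℂ) :
    wedge α (c • β) = c • wedge α β := by
  ext u
  rw [wedge_apply]
  exact (altProd_smul_right rfl c α β u).trans (congrArg (c * ·) (wedge_apply α β u).symm)

theorem wedge_add_left {k l : ℕ} (α α' : V [⋀^Fin k]→L[ℝ] A) (β : V [⋀^Fin l]→L[ℝ] A) :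
    wedge (α + α') β = wedge α β + wedge α' β := by
  ext u
  rw [wedge_apply]
  exact (altProd_add_left rfl α α' β u).trans
    (congrArg₂ (· + ·) (wedge_apply α β u) (wedge_apply α' β u)).symm

theorem wedge_add_right {k l : ℕ} (α : V [⋀^Fin k]→L[ℝ] A) (β β' : V [⋀^Fin l]→L[ℝ] A) :
    wedge α (β + β') = wedge α β + wedge α β' := by
  ext u
  rw [wedge_apply]
  exact (altProd_add_right rfl α β β' u).trans
    (congrArg₂ (· + ·) (wedge_apply α β u) (wedge_apply α β' u)).symm

end WedgeAlgebra

/-! ### Powers of a form which splits off a plane -/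

section TopForms

variable {V W : Type*} [AddCommGroup V] [Module ℝ V] [TopologicalSpace V]
  [AddCommGroup W] [Module ℝ W] [TopologicalSpace W]

/-- If the span of `v` and `w` is a hyperbolic plane for `τ` which is `τ`-orthogonal to `H`, then
contracting `τ^(j+1)` with `v` and `w` gives `(j+1) τ^j` on `H`. -/
theorem wedgePow_cons_cons (τ : V [⋀^Fin 2]→L[ℝ] ℝ) {v w : V} {H : Set V} (hvw : τ ![v, w] = 1)
    (hv : ∀ x ∈ H, τ ![v, x] = 0) (hw : ∀ x ∈ H, τ ![w, x] = 0) (j : ℕ) (u : Fin (2 * j) → V)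
    (hu : ∀ i, u i ∈ H) :
    wedgePow τ (j + 1) (Fin.cons v (Fin.cons w u) : Fin (2 * j + 1 + 1) → V) =
      (j + 1) * wedgePow τ j u := by
  induction j with
  | zero =>
    have h0 : wedgePow τ 0 u = 1 := rfl
    have h1 := altProd_cons_of_left (N := 1) (k := 0) (l := 1) rfl rfl (wedgePow τ 0)
      τ.toAlternatingMap v (fun _ i => i.elim0) (Fin.cons w u)
    have h2 := altProd_cons_of_left (N := 0) (k := 0) (l := 0) rfl rfl (wedgePow τ 0)
      (τ.toAlternatingMap.curryLeft v) w (fun _ i => i.elim0) u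
    have h3 := altProd_degree_zero (wedgePow τ 0).toAlternatingMap
      (fun x => τ.toAlternatingMap (Fin.cons v (Fin.cons w x))) u
    have h4 := (wedge_apply (wedgePow τ 0) τ (Fin.cons v (Fin.cons w u))).trans
      (h1.trans (congrArg _ (h2.trans (congrArg _ h3))))
    refine Eq.trans h4 ?_
    change (-1) ^ 0 * ((-1) ^ 0 * (wedgePow τ 0 u * τ ![v, w])) = _
    rw [h0, hvw]
    simp
  | succ j ih =>
    set f := (wedgePow τ (j + 1)).toAlternatingMap with hf
    -- the contraction of `τ^(j+1) ∧ τ` with `v`, then that of each of the two terms with `w`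
    have h1 := altProd_cons (N := 2 * j + 2 + 1) (k := 2 * j + 1) (l := 1) rfl (by omega) (by omega)
      f τ.toAlternatingMap v (Fin.cons w u)
    have h2 := altProd_cons (N := 2 * j + 2) (k := 2 * j) (l := 1) (by omega) (by omega) (by omega)
      (f.curryLeft v) τ.toAlternatingMap w u
    have h3 := altProd_cons (N := 2 * j + 2) (k := 2 * j + 1) (l := 0) (by omega) (by omega)
      (by omega) f (τ.toAlternatingMap.curryLeft v) w u
    -- the terms in which the last factor `τ` is contracted only once vanish by orthogonality
    have h4 : altProd (N := 2 * j + 2) (k := 2 * j + 1) (l := 1) rfl (f.curryLeft v)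
        (fun x : Fin 1 → V => τ.toAlternatingMap (Fin.cons w x)) u = 0 := by
      refine altProd_eq_zero_right _ hu fun x hx => ?_
      rw [show x = ![x 0] from funext fun i => by fin_cases i; rfl]
      exact hw _ (hx 0)
    have h5 : altProd (N := 2 * j + 2) (k := 2 * j + 1) (l := 1) rfl (fun x => f (Fin.cons w x))
        (τ.toAlternatingMap.curryLeft v) u = 0 := by
      refine altProd_eq_zero_right _ hu fun x hx => ?_
      rw [show x = ![x 0] from funext fun i => by fin_cases i; rfl]
      exact hv _ (hx 0)
    have h6 := altProd_degree_zero f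
      (fun x => τ.toAlternatingMap.curryLeft v (Fin.cons w x)) u
    -- contracting `τ^(j+1)` twice gives `j + 1` times `τ^j` by induction; the summand in which
    -- the last factor is contracted twice supplies the remaining `1`
    have h7 : altProd (N := 2 * j + 2) (k := 2 * j) (l := 2) rfl
        (fun x => f.curryLeft v (Fin.cons w x))
        τ.toAlternatingMap u = (j + 1) * wedgePow τ (j + 1) u := by
      refine (altProd_congr _ hu (g' := τ) (fun x hx => ih x hx) fun _ _ => rfl).trans ?_
      exact (altProd_smul_left _ _ _ _ _).trans
        (congrArg _ (wedge_apply (wedgePow τ j) τ u).symm)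
    have h8 : τ.toAlternatingMap.curryLeft v (Fin.cons w ![]) = 1 := hvw
    rw [h4] at h2
    rw [h5] at h3
    have h9 := (wedge_apply (wedgePow τ (j + 1)) τ (Fin.cons v (Fin.cons w u))).trans h1
    refine Eq.trans h9 ?_
    refine (congrArg₂ (· + ·) h2 (congrArg _ (h3.trans
      (congrArg _ (congrArg _ h6))))).trans ?_
    rw [h7, h8]
    have h10 : f u = wedgePow τ (j + 1) u := rfl
    rw [h10]
    have h11 : ((-1 : ℝ)) ^ (2 * j + 1 + 1) = 1 := by
      rw [show 2 * j + 1 + 1 = 2 * (j + 1) by ring, pow_mul]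
      norm_num
    rw [h11]
    push_cast
    ring

/-- A vector in the kernel of `τ` is in the kernel of its powers. -/
theorem wedgePow_eq_zero_of_kernel {τ : V [⋀^Fin 2]→L[ℝ] ℝ} {x : V}
    (hτ : ∀ (w : Fin 2 → V) (i : Fin 2), w i = x → τ w = 0) (j : ℕ) (w : Fin (2 * j) → V)
    (i : Fin (2 * j)) (hi : w i = x) : wedgePow τ j w = 0 := by
  induction j with
  | zero => exact i.elim0
  | succ j ih =>
    exact (wedge_apply (wedgePow τ j) τ w).trans
      (altProd_eq_zero_of_kernel _ (fun w i hi => ih w i hi) hτ w i hi)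

theorem wedgePow_congr_on {τ τ' : V [⋀^Fin 2]→L[ℝ] ℝ} {H : Set V}
    (hτ : ∀ w : Fin 2 → V, (∀ i, w i ∈ H) → τ w = τ' w) (j : ℕ) (u : Fin (2 * j) → V)
    (hu : ∀ i, u i ∈ H) : wedgePow τ j u = wedgePow τ' j u := by
  induction j with
  | zero => rfl
  | succ j ih =>
    exact (wedge_apply (wedgePow τ j) τ u).trans
      ((altProd_congr _ hu (fun w hw => ih w hw) hτ).trans
        (wedge_apply (wedgePow τ' j) τ' u).symm)

/-- A form which is annihilated by the contraction with `ξ` only depends on its arguments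
modulo `ξ`. -/
theorem apply_add_smul_of_kernel {k : ℕ} (K : W [⋀^Fin k]→L[ℝ] ℝ) {ξ : W}
    (hK : ∀ (w : Fin k → W) (i : Fin k), w i = ξ → K w = 0) (u : Fin k → W) (c : Fin k → ℝ) :
    K (fun i => u i + c i • ξ) = K u := by
  have h := K.toAlternatingMap.map_add_univ u (fun i => c i • ξ)
  refine Eq.trans h ?_
  rw [Finset.sum_eq_single Finset.univ]
  · simp
  · intro s _ hs
    obtain ⟨i, hi⟩ : ∃ i, i ∉ s := by
      by_contra hc
      push Not at hc
      exact hs (Finset.eq_univ_of_forall hc)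
    set y : Fin k → W := s.piecewise u (fun i => c i • ξ) with hy
    have h1 : y = Function.update y i (c i • ξ) := by
      rw [eq_comm, Function.update_eq_self_iff, hy, Finset.piecewise_eq_of_notMem _ _ _ hi]
    rw [h1, AlternatingMap.map_update_smul]
    have h2 := hK (Function.update y i ξ) i (by simp)
    exact (congrArg (c i • ·) h2).trans (smul_zero _)
  · simp

theorem apply_eq_zero_of_apply_left_eq_zero {τ : V [⋀^Fin 2]→L[ℝ] ℝ} {x : V}
    (h : ∀ y, τ ![x, y] = 0) (w : Fin 2 → V) (i : Fin 2) (hi : w i = x) : τ w = 0 := by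
  have h1 : w = ![w 0, w 1] := funext fun i => by fin_cases i <;> rfl
  have h2 : τ ![w 0, w 1] = -τ ![w 1, w 0] := by
    have := τ.toAlternatingMap.map_swap ![w 1, w 0] (i := 0) (j := 1) (by decide)
    refine Eq.trans (congrArg τ (funext fun i => ?_)) this
    fin_cases i <;> rfl
  rw [h1]
  fin_cases i
  · change w 0 = x at hi
    rw [hi]
    exact h _
  · change w 1 = x at hi
    rw [h2, hi, h, neg_zero]

/-- On `V ≃ W × ℝ`, where `dim W = 2j + 5` and `ξ ∈ W` is transverse to the kernel of `η`, consider
`τ = Φ + θ ∧ η`, `θ` being the second projection. If `ξ` is in the kernel of the `4`-form `G` and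
of `Φ`, then the top-degree form `G ∧ τ^(j+1)` vanishes if and only if `G ∧ Φ^j` does. -/
theorem wedge_wedgePow_eq_zero_iff [FiniteDimensional ℝ W] (j : ℕ)
    (hdim : Module.finrank ℝ W = 2 * j + 5) (e : V ≃L[ℝ] W × ℝ) (η : W →L[ℝ] ℝ) {ξ : W}
    (hξ : η ξ = 1) (G : W [⋀^Fin 4]→L[ℝ] ℝ)
    (hG : ∀ (w : Fin 4 → W) (i : Fin 4), w i = ξ → G w = 0) (Φ : W [⋀^Fin 2]→L[ℝ] ℝ)
    (hΦ : ∀ x, Φ ![ξ, x] = 0) (τ : V [⋀^Fin 2]→L[ℝ] ℝ)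
    (hτ : ∀ x y, τ ![x, y] =
      Φ ![(e x).1, (e y).1] + (e x).2 * η (e y).1 - (e y).2 * η (e x).1) :
    wedge (G.compContinuousLinearMap (ContinuousLinearMap.fst ℝ W ℝ ∘L e.toContinuousLinearMap))
      (wedgePow τ (j + 1)) = 0 ↔ wedge G (wedgePow Φ j) = 0 := by
  set q : V →L[ℝ] W := ContinuousLinearMap.fst ℝ W ℝ ∘L e.toContinuousLinearMap with hq
  have hqe : ∀ x, q x = (e x).1 := fun _ => rfl
  set s : W →ₗ[ℝ] V := e.symm.toLinearMap ∘ₗ LinearMap.inl ℝ W ℝ with hs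
  have hes : ∀ u, e (s u) = (u, 0) := fun u => e.apply_symm_apply _
  set v : V := e.symm (0, 1) with hv
  have hev : e v = (0, 1) := e.apply_symm_apply _
  set H : Set V := {x | (e x).2 = 0 ∧ η (e x).1 = 0} with hH
  have hsH : ∀ u, η u = 0 → s u ∈ H := fun u hu => by simp [hH, hes, hu]
  have hΦ' := apply_eq_zero_of_apply_left_eq_zero hΦ
  have hΦ0 : ∀ x, Φ ![0, x] = 0 := fun x => Φ.map_coord_zero (i := 0) rfl
  have hGv : ∀ (w : Fin 4 → V) (i : Fin 4), w i = v → G.compContinuousLinearMap q w = 0 := by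
    intro w i hi
    refine G.map_coord_zero (i := i) ?_
    change q (w i) = 0
    rw [hi, hqe, hev]
  have hGw : ∀ (w : Fin 4 → V) (i : Fin 4), w i = s ξ → G.compContinuousLinearMap q w = 0 := by
    intro w i hi
    refine hG _ i ?_
    change q (w i) = ξ
    rw [hi, hqe, hes]
  -- contracting twice removes one factor `τ`, and on `H` the remaining ones agree with `Φ`
  have key : ∀ u : Fin (4 + 2 * j) → W, (∀ i, η (u i) = 0) →
      wedge (G.compContinuousLinearMap q) (wedgePow τ (j + 1))
        (Fin.cons v (Fin.cons (s ξ) fun i => s (u i)) : Fin (4 + 2 * j + 1 + 1) → V) =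
      (j + 1) * wedge G (wedgePow Φ j) u := by
    intro u hu
    have huH : ∀ i, s (u i) ∈ H := fun i => hsH _ (hu i)
    have h1 := altProd_cons_of_left (N := 4 + 2 * j + 1) (k := 4) (l := 2 * j + 1) rfl rfl
      (G.compContinuousLinearMap q) (wedgePow τ (j + 1)).toAlternatingMap v hGv
      (Fin.cons (s ξ) fun i => s (u i))
    have h2 := altProd_cons_of_left (N := 4 + 2 * j) (k := 4) (l := 2 * j) rfl rfl
      (G.compContinuousLinearMap q) ((wedgePow τ (j + 1)).toAlternatingMap.curryLeft v) (s ξ) hGw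
      (fun i => s (u i))
    have h3 : altProd (N := 4 + 2 * j) rfl (G.compContinuousLinearMap q)
        (fun x => (wedgePow τ (j + 1)).toAlternatingMap.curryLeft v (Fin.cons (s ξ) x))
        (fun i => s (u i)) = (j + 1) * wedge G (wedgePow Φ j) u := by
      refine (altProd_congr _ huH (f' := G.compContinuousLinearMap q)
        (g' := fun x => (j + 1) * (wedgePow Φ j).compContinuousLinearMap q x)
        (fun _ _ => rfl) fun x hx => ?_).trans ?_
      · refine (wedgePow_cons_cons τ (H := H) ?_ ?_ ?_ j x hx).trans ?_
        · rw [hτ, hev, hes, hΦ0, hξ]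
          norm_num
        · intro y hy
          rw [hτ, hev, hΦ0, hy.2]
          simp
        · intro y hy
          rw [hτ, hes, hΦ, hy.1]
          simp
        · rw [← wedgePow_compContinuousLinearMap]
          congr 1
          refine wedgePow_congr_on (H := H) (fun w hw => ?_) j x hx
          rw [show w = ![w 0, w 1] from funext fun i => by fin_cases i <;> rfl, hτ, (hw 0).1,
            (hw 1).1, zero_mul, zero_mul, add_zero, sub_zero]
          refine congrArg Φ (funext fun i => ?_)
          fin_cases i <;> rfl
      · refine (altProd_smul_right _ _ _ _ _).trans (congrArg _ ?_)
        refine (wedge_apply (G.compContinuousLinearMap q)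
          ((wedgePow Φ j).compContinuousLinearMap q) _).symm.trans ?_
        rw [wedge_compContinuousLinearMap]
        refine congrArg (wedge G (wedgePow Φ j)) (funext fun i => ?_)
        change q (s (u i)) = u i
        rw [hqe, hes]
    refine (wedge_apply (G.compContinuousLinearMap q) (wedgePow τ (j + 1)) _).trans (h1.trans ?_)
    refine (congrArg _ (h2.trans (congrArg _ h3))).trans ?_
    norm_num
  constructor
  · intro h
    ext u
    -- both `G` and `Φ` are annihilated by `ξ`, so the arguments may be projected to `ker η`
    have h1 := apply_add_smul_of_kernel (wedge G (wedgePow Φ j)) (ξ := ξ) (fun w i hi =>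
      (wedge_apply G (wedgePow Φ j) w).trans (altProd_eq_zero_of_kernel _ hG
        (wedgePow_eq_zero_of_kernel hΦ' j) w i hi)) u (fun i => -η (u i))
    have h2 := key (fun i => u i + (-η (u i)) • ξ) fun i => by simp [hξ]
    rw [h] at h2
    have h3 : (j + 1 : ℝ) ≠ 0 := by positivity
    rw [← h1]
    exact (mul_eq_zero.1 h2.symm).resolve_left h3
  · intro h
    -- a basis adapted to the splitting `V = ℝ v ⊕ ℝ (s ξ) ⊕ s (ker η)`
    have hker : Module.finrank ℝ (LinearMap.ker η.toLinearMap) = 4 + 2 * j := by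
      have h1 := LinearMap.finrank_range_add_finrank_ker η.toLinearMap
      have h2 : LinearMap.range η.toLinearMap = ⊤ := by
        rw [LinearMap.range_eq_top]
        intro c
        exact ⟨c • ξ, by simp [hξ]⟩
      rw [h2, finrank_top, Module.finrank_self, hdim] at h1
      omega
    let b := Module.finBasisOfFinrankEq ℝ (LinearMap.ker η.toLinearMap) hker
    have hb : ∀ i, η (b i : W) = 0 := fun i => (b i).2
    have hinj : LinearMap.ker (s ∘ₗ (LinearMap.ker η.toLinearMap).subtype) = ⊥ := by
      rw [LinearMap.ker_eq_bot]
      intro x y hxy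
      have h1 : e (s x) = e (s y) := congrArg e hxy
      rw [hes, hes] at h1
      exact Subtype.ext (Prod.ext_iff.1 h1).1
    have hli1 : LinearIndependent ℝ fun i => s (b i : W) := b.linearIndependent.map' _ hinj
    have hli2 : LinearIndependent ℝ
        (Fin.cons (s ξ) fun i => s (b i : W) : Fin (4 + 2 * j + 1) → V) := by
      refine linearIndependent_finCons.2 ⟨hli1, fun hc => ?_⟩
      have h1 : Submodule.span ℝ (Set.range fun i => s (b i : W)) ≤
          LinearMap.ker (η.toLinearMap ∘ₗ q.toLinearMap) := by
        rw [Submodule.span_le]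
        rintro _ ⟨i, rfl⟩
        change η (q (s (b i : W))) = 0
        rw [hqe, hes]
        exact hb i
      have h2 : η (q (s ξ)) = 0 := h1 hc
      rw [hqe, hes, hξ] at h2
      exact one_ne_zero h2
    have hli3 : LinearIndependent ℝ
        (Fin.cons v (Fin.cons (s ξ) fun i => s (b i : W)) : Fin (4 + 2 * j + 1 + 1) → V) := by
      refine linearIndependent_finCons.2 ⟨hli2, fun hc => ?_⟩
      have h1 : Submodule.span ℝ (Set.range
          (Fin.cons (s ξ) fun i => s (b i : W) : Fin (4 + 2 * j + 1) → V)) ≤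
          LinearMap.ker (LinearMap.snd ℝ W ℝ ∘ₗ e.toLinearMap) := by
        rw [Submodule.span_le]
        rintro _ ⟨i, rfl⟩
        change (e ((Fin.cons (s ξ) fun i => s (b i : W) : Fin (4 + 2 * j + 1) → V) i)).2 = 0
        refine Fin.cases ?_ (fun i => ?_) i
        · rw [Fin.cons_zero, hes]
        · rw [Fin.cons_succ, hes]
      have h2 : (e v).2 = 0 := h1 hc
      rw [hev] at h2
      exact one_ne_zero h2
    have hV : Module.finrank ℝ V = 4 + 2 * j + 1 + 1 := by
      rw [e.toLinearEquiv.finrank_eq, Module.finrank_prod, Module.finrank_self, hdim]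
      omega
    let B := basisOfLinearIndependentOfCardEqFinrank hli3
      ((Fintype.card_fin _).trans hV.symm)
    have hB : (B : Fin (4 + 2 * j + 1 + 1) → V) =
        Fin.cons v (Fin.cons (s ξ) fun i => s (b i : W)) :=
      coe_basisOfLinearIndependentOfCardEqFinrank _ _
    have h0 : (wedge (G.compContinuousLinearMap q) (wedgePow τ (j + 1))).toAlternatingMap = 0 := by
      refine (AlternatingMap.map_basis_eq_zero_iff B _).1 ?_
      rw [hB]
      refine (key (fun i => (b i : W)) hb).trans ?_
      rw [h]
      exact mul_zero _
    ext u
    exact DFunLike.congr_fun h0 u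

end TopForms

/-! ### Naturality of the exterior derivative -/

section Naturality

theorem two_le_infty : (2 : WithTop ℕ∞) ≤ ∞ := by
  have h : ((2 : ℕ∞) : WithTop ℕ∞) ≤ ((⊤ : ℕ∞) : WithTop ℕ∞) := WithTop.coe_le_coe.2 le_top
  exact h

theorem differentiableAt_extDeriv {𝕜 E A : Type*} [NontriviallyNormedField 𝕜]
    [NormedAddCommGroup E] [NormedSpace 𝕜 E] [NormedAddCommGroup A] [NormedSpace 𝕜 A] {k : ℕ}
    {α : E → E [⋀^Fin k]→L[𝕜] A} {x : E} (hα : ContDiffAt 𝕜 2 α x) :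
    DifferentiableAt 𝕜 (extDeriv α) x := by
  have h1 : DifferentiableAt 𝕜 (fderiv 𝕜 α) x :=
    (hα.fderiv_right (m := 1) one_add_one_eq_two.le).differentiableAt one_ne_zero
  have h2 := (ContinuousAlternatingMap.alternatizeUncurryFinCLM (n := k) 𝕜 E A).differentiableAt
    (x := fderiv 𝕜 α x)
  exact h2.comp x h1

variable {m : ℕ} {M : Type*} [TopologicalSpace M] [ChartedSpace (EuclideanSpace ℝ (Fin m)) M]
  {m' : ℕ} {M' : Type*} [TopologicalSpace M'] [ChartedSpace (EuclideanSpace ℝ (Fin m')) M']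
  {A : Type*} [NormedAddCommGroup A] [NormedSpace ℝ A] {k : ℕ}

/-- The pullback of a form to a Euclidean space; `inChart` is the pullback under the inverse of a
chart. -/
def pullbackE (f : EuclideanSpace ℝ (Fin m') → M) (α : DForm m M A k) :
    EuclideanSpace ℝ (Fin m') → (EuclideanSpace ℝ (Fin m')) [⋀^Fin k]→L[ℝ] A := fun y =>
  (α (f y)).compContinuousLinearMap (mfderiv 𝓘(ℝ, EuclideanSpace ℝ (Fin m')) (𝓡 m) f y)

/-- Differentiability of a form at a point, in the chart at that point. -/
def FormDifferentiableAt (α : DForm m M A k) (x : M) : Prop :=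
  DifferentiableAt ℝ (inChart α x) (extChartAt (𝓡 m) x x)

theorem IsSmoothForm.contDiffAt {α : DForm m M A k} (h : IsSmoothForm α) (x : M) :
    ContDiffAt ℝ ∞ (inChart α x) (extChartAt (𝓡 m) x x) :=
  (h x).contDiffAt (extChartAt_target_mem_nhds x)

theorem IsSmoothForm.differentiableAt {α : DForm m M A k} (h : IsSmoothForm α) (x : M) :
    FormDifferentiableAt α x :=
  (h.contDiffAt x).differentiableAt (by simp)

/-- The chart expression at the image of a point `z`, with the form evaluated at `z` itself rather
than at its image under the chart and its inverse, which is only propositionally equal to `z`. -/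
theorem inChart_apply_chart (α : DForm m M A k) (x : M) {z : M}
    (hz : z ∈ (extChartAt (𝓡 m) x).source) :
    inChart α x (extChartAt (𝓡 m) x z) = (α z).compContinuousLinearMap
      (mfderiv 𝓘(ℝ, EuclideanSpace ℝ (Fin m)) (𝓡 m) (extChartAt (𝓡 m) x).symm
        (extChartAt (𝓡 m) x z) :
        EuclideanSpace ℝ (Fin m) →L[ℝ] EuclideanSpace ℝ (Fin m)) := by
  let a : M → (EuclideanSpace ℝ (Fin m)) [⋀^Fin k]→L[ℝ] A := α
  have h : ∀ z' : M, z' = z → ∀ D : EuclideanSpace ℝ (Fin m) →L[ℝ] EuclideanSpace ℝ (Fin m),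
      (a z').compContinuousLinearMap D = (a z).compContinuousLinearMap D := by
    rintro z' rfl D
    rfl
  exact h _ ((extChartAt (𝓡 m) x).left_inv hz) _

theorem contDiffAt_chart_comp {f : EuclideanSpace ℝ (Fin m') → M}
    {y₀ : EuclideanSpace ℝ (Fin m')}
    (hf : ContMDiffAt 𝓘(ℝ, EuclideanSpace ℝ (Fin m')) (𝓡 m) ∞ f y₀) :
    ContDiffAt ℝ ∞ (fun y => extChartAt (𝓡 m) (f y₀) (f y)) y₀ :=
  ((contMDiffAt_extChartAt (n := ∞)).comp y₀ hf).contDiffAt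

variable [IsManifold (𝓡 m) ∞ M]

theorem mfderiv_symm_comp_mfderiv_chart (x : M) {z : M} (hz : z ∈ (extChartAt (𝓡 m) x).source) :
    (mfderiv 𝓘(ℝ, EuclideanSpace ℝ (Fin m)) (𝓡 m) (extChartAt (𝓡 m) x).symm
        (extChartAt (𝓡 m) x z) : EuclideanSpace ℝ (Fin m) →L[ℝ] EuclideanSpace ℝ (Fin m)) ∘L
      (mfderiv (𝓡 m) 𝓘(ℝ, EuclideanSpace ℝ (Fin m)) (extChartAt (𝓡 m) x) z) =
      ContinuousLinearMap.id ℝ (EuclideanSpace ℝ (Fin m)) := by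
  have : IsManifold (𝓡 m) 1 M := IsManifold.of_le (n := ∞) (by simp)
  have h := mfderivWithin_extChartAt_symm_comp_mfderiv_extChartAt' (I := 𝓡 m) hz
  rw [ModelWithCorners.range_eq_univ, mfderivWithin_univ] at h
  exact h

theorem mfderiv_chart_comp_mfderiv_symm (x : M) {z : M} (hz : z ∈ (extChartAt (𝓡 m) x).source) :
    (mfderiv (𝓡 m) 𝓘(ℝ, EuclideanSpace ℝ (Fin m)) (extChartAt (𝓡 m) x) z :
        EuclideanSpace ℝ (Fin m) →L[ℝ] EuclideanSpace ℝ (Fin m)) ∘L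
      (mfderiv 𝓘(ℝ, EuclideanSpace ℝ (Fin m)) (𝓡 m) (extChartAt (𝓡 m) x).symm
        (extChartAt (𝓡 m) x z)) =
      ContinuousLinearMap.id ℝ (EuclideanSpace ℝ (Fin m)) := by
  have : IsManifold (𝓡 m) 1 M := IsManifold.of_le (n := ∞) (by simp)
  have h := mfderiv_extChartAt_comp_mfderivWithin_extChartAt_symm' (I := 𝓡 m) hz
  rw [ModelWithCorners.range_eq_univ, mfderivWithin_univ] at h
  exact h

/-- Near `y₀` the pullback along `f` is the pullback, along the expression of `f` in the chart at
`f y₀`, of the form on a Euclidean space which expresses `α` in that chart. -/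
theorem pullbackE_eventuallyEq {f : EuclideanSpace ℝ (Fin m') → M}
    {y₀ : EuclideanSpace ℝ (Fin m')}
    (hf : ContMDiffAt 𝓘(ℝ, EuclideanSpace ℝ (Fin m')) (𝓡 m) ∞ f y₀) (α : DForm m M A k) :
    pullbackE f α =ᶠ[nhds y₀] fun y =>
      (inChart α (f y₀) (extChartAt (𝓡 m) (f y₀) (f y))).compContinuousLinearMap
        (fderiv ℝ (fun y => extChartAt (𝓡 m) (f y₀) (f y)) y) := by
  have h1 : ∀ᶠ y in nhds y₀, ContMDiffAt 𝓘(ℝ, EuclideanSpace ℝ (Fin m')) (𝓡 m) 1 f y :=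
    (contMDiffAt_iff_contMDiffAt_nhds (by simp)).1 (hf.of_le (n := ∞) (m := 1) (by simp))
  have h2 : ∀ᶠ y in nhds y₀, f y ∈ (extChartAt (𝓡 m) (f y₀)).source :=
    hf.continuousAt.eventually (extChartAt_source_mem_nhds (f y₀))
  filter_upwards [h1, h2] with y hy hs
  have d1 : MDifferentiableAt 𝓘(ℝ, EuclideanSpace ℝ (Fin m')) (𝓡 m) f y :=
    hy.mdifferentiableAt (by simp)
  have d2 : MDifferentiableAt (𝓡 m) 𝓘(ℝ, EuclideanSpace ℝ (Fin m)) (extChartAt (𝓡 m) (f y₀))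
      (f y) := by
    refine (contMDiffAt_extChartAt' (n := ∞) ?_).mdifferentiableAt (by simp)
    rwa [extChartAt_source] at hs
  have e1 : fderiv ℝ (fun y => extChartAt (𝓡 m) (f y₀) (f y)) y =
      (mfderiv (𝓡 m) 𝓘(ℝ, EuclideanSpace ℝ (Fin m)) (extChartAt (𝓡 m) (f y₀)) (f y) :
        EuclideanSpace ℝ (Fin m) →L[ℝ] EuclideanSpace ℝ (Fin m)) ∘L
      (mfderiv 𝓘(ℝ, EuclideanSpace ℝ (Fin m')) (𝓡 m) f y) := by
    rw [← mfderiv_eq_fderiv]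
    exact mfderiv_comp y d2 d1
  rw [inChart_apply_chart α (f y₀) hs, e1]
  ext v
  refine congrArg (α (f y)) (funext fun i => ?_)
  exact (DFunLike.congr_fun (mfderiv_symm_comp_mfderiv_chart (f y₀) hs) _).symm

theorem differentiableAt_pullbackE {f : EuclideanSpace ℝ (Fin m') → M}
    {y₀ : EuclideanSpace ℝ (Fin m')}
    (hf : ContMDiffAt 𝓘(ℝ, EuclideanSpace ℝ (Fin m')) (𝓡 m) ∞ f y₀) {α : DForm m M A k}
    (hα : FormDifferentiableAt α (f y₀)) : DifferentiableAt ℝ (pullbackE f α) y₀ := by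
  refine DifferentiableAt.congr_of_eventuallyEq ?_ (pullbackE_eventuallyEq hf α)
  have h := contDiffAt_chart_comp hf
  refine DifferentiableAt.continuousAlternatingMapCompContinuousLinearMap ?_ ?_
  · exact DifferentiableAt.comp (g := inChart α (f y₀)) y₀ hα (h.differentiableAt (by simp))
  · exact (h.fderiv_right (m := 1) (one_add_one_eq_two.trans_le two_le_infty)).differentiableAt
      (by simp)

/-- The exterior derivative on a manifold commutes with pullbacks to Euclidean spaces. -/
theorem extDeriv_pullbackE {f : EuclideanSpace ℝ (Fin m') → M}
    {y₀ : EuclideanSpace ℝ (Fin m')}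
    (hf : ContMDiffAt 𝓘(ℝ, EuclideanSpace ℝ (Fin m')) (𝓡 m) ∞ f y₀) {α : DForm m M A k}
    (hα : FormDifferentiableAt α (f y₀)) :
    extDeriv (pullbackE f α) y₀ = pullbackE f (extD α) y₀ := by
  rw [(pullbackE_eventuallyEq hf α).extDeriv_eq]
  have h := contDiffAt_chart_comp hf
  have hα' : DifferentiableAt ℝ (inChart α (f y₀)) (extChartAt (𝓡 m) (f y₀) (f y₀)) := hα
  have h1 := extDeriv_pullback (f := fun y => extChartAt (𝓡 m) (f y₀) (f y)) (x := y₀) (r := 2)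
    hα' (h.of_le two_le_infty) minSmoothness_of_isRCLikeNormedField.le
  refine h1.trans ?_
  have d1 : MDifferentiableAt 𝓘(ℝ, EuclideanSpace ℝ (Fin m')) (𝓡 m) f y₀ :=
    hf.mdifferentiableAt (by simp)
  have d2 : MDifferentiableAt (𝓡 m) 𝓘(ℝ, EuclideanSpace ℝ (Fin m)) (extChartAt (𝓡 m) (f y₀))
      (f y₀) := (contMDiffAt_extChartAt (n := ∞)).mdifferentiableAt (by simp)
  have e1 : fderiv ℝ (fun y => extChartAt (𝓡 m) (f y₀) (f y)) y₀ =
      (mfderiv (𝓡 m) 𝓘(ℝ, EuclideanSpace ℝ (Fin m)) (extChartAt (𝓡 m) (f y₀)) (f y₀) :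
        EuclideanSpace ℝ (Fin m) →L[ℝ] EuclideanSpace ℝ (Fin m)) ∘L
      (mfderiv 𝓘(ℝ, EuclideanSpace ℝ (Fin m')) (𝓡 m) f y₀) := by
    rw [← mfderiv_eq_fderiv]
    exact mfderiv_comp y₀ d2 d1
  rw [e1]
  rfl

theorem contMDiffAt_chart_symm (x : M) {y : EuclideanSpace ℝ (Fin m)}
    (hy : y ∈ (extChartAt (𝓡 m) x).target) :
    ContMDiffAt 𝓘(ℝ, EuclideanSpace ℝ (Fin m)) (𝓡 m) ∞ (extChartAt (𝓡 m) x).symm y :=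
  (contMDiffOn_extChartAt_symm x).contMDiffAt ((isOpen_extChartAt_target x).mem_nhds hy)

/-- The exterior derivative can be computed in any chart. -/
theorem inChart_extD {α : DForm m M A k} (hα : ∀ x, FormDifferentiableAt α x) (x : M)
    {y : EuclideanSpace ℝ (Fin m)} (hy : y ∈ (extChartAt (𝓡 m) x).target) :
    inChart (extD α) x y = extDeriv (inChart α x) y :=
  (extDeriv_pullbackE (contMDiffAt_chart_symm x hy) (hα _)).symm

theorem inChart_extD_eventuallyEq {α : DForm m M A k} (hα : ∀ x, FormDifferentiableAt α x)
    (x : M) : inChart (extD α) x =ᶠ[nhds (extChartAt (𝓡 m) x x)] extDeriv (inChart α x) := by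
  filter_upwards [extChartAt_target_mem_nhds x] with y hy using inChart_extD hα x hy

theorem formDifferentiableAt_extD {α : DForm m M A k} (hα : IsSmoothForm α) (x : M) :
    FormDifferentiableAt (extD α) x :=
  (differentiableAt_extDeriv ((hα.contDiffAt x).of_le two_le_infty)).congr_of_eventuallyEq
    (inChart_extD_eventuallyEq hα.differentiableAt x)

theorem extD_extD {α : DForm m M A k} (hα : IsSmoothForm α) :
    extD (extD α) = 0 := by
  funext x
  have h1 := inChart_extD_eventuallyEq hα.differentiableAt x
  have h2 : extDeriv (inChart (extD α) x) (extChartAt (𝓡 m) x x) = 0 := by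
    rw [h1.extDeriv_eq]
    exact extDeriv_extDeriv_apply (r := 2) ((hα.contDiffAt x).of_le two_le_infty)
      minSmoothness_of_isRCLikeNormedField.le
  ext v
  exact DFunLike.congr_fun h2 _

variable [IsManifold (𝓡 m') ∞ M']

omit [IsManifold (𝓡 m) ∞ M] in
theorem inChart_pullback {f : M' → M} (hf : ContMDiff (𝓡 m') (𝓡 m) ∞ f) (α : DForm m M A k)
    (x : M') {y : EuclideanSpace ℝ (Fin m')} (hy : y ∈ (extChartAt (𝓡 m') x).target) :
    inChart (pullback (m := m') f α) x y = pullbackE (f ∘ (extChartAt (𝓡 m') x).symm) α y := by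
  have h : mfderiv 𝓘(ℝ, EuclideanSpace ℝ (Fin m')) (𝓡 m) (f ∘ (extChartAt (𝓡 m') x).symm) y =
      (mfderiv (𝓡 m') (𝓡 m) f ((extChartAt (𝓡 m') x).symm y)) ∘L
      (mfderiv 𝓘(ℝ, EuclideanSpace ℝ (Fin m')) (𝓡 m') (extChartAt (𝓡 m') x).symm y) :=
    mfderiv_comp y (hf.mdifferentiableAt (by simp))
      ((contMDiffAt_chart_symm x hy).mdifferentiableAt (by simp))
  unfold pullbackE
  rw [h]
  rfl

omit [IsManifold (𝓡 m) ∞ M] in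
theorem pullback_chart_eventuallyEq {f : M' → M} (hf : ContMDiff (𝓡 m') (𝓡 m) ∞ f)
    (α : DForm m M A k) (x : M') :
    inChart (pullback (m := m') f α) x =ᶠ[nhds (extChartAt (𝓡 m') x x)]
      pullbackE (f ∘ (extChartAt (𝓡 m') x).symm) α := by
  filter_upwards [extChartAt_target_mem_nhds x] with y hy using inChart_pullback hf α x hy

theorem formDifferentiableAt_pullback {f : M' → M} (hf : ContMDiff (𝓡 m') (𝓡 m) ∞ f)
    {α : DForm m M A k} (hα : ∀ x, FormDifferentiableAt α x) (x : M') :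
    FormDifferentiableAt (pullback (m := m') f α) x :=
  (differentiableAt_pullbackE
    (hf.contMDiffAt.comp _ (contMDiffAt_chart_symm x (mem_extChartAt_target x)))
    (hα _)).congr_of_eventuallyEq (pullback_chart_eventuallyEq hf α x)

/-- The exterior derivative commutes with pullbacks. -/
theorem extD_pullback {f : M' → M} (hf : ContMDiff (𝓡 m') (𝓡 m) ∞ f)
    {α : DForm m M A k} (hα : ∀ x, FormDifferentiableAt α x) :
    extD (pullback (m := m') f α) =
      pullback (m := m') f (extD α) := by
  funext x
  have h1 := (pullback_chart_eventuallyEq hf α x).extDeriv_eq.trans (extDeriv_pullbackE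
    (hf.contMDiffAt.comp _ (contMDiffAt_chart_symm x (mem_extChartAt_target x))) (hα _))
  rw [← inChart_pullback hf _ x (mem_extChartAt_target x),
    inChart_apply_chart _ x (mem_extChartAt_source x)] at h1
  ext v
  refine (DFunLike.congr_fun h1 _).trans ?_
  refine congrArg (pullback (m := m') f (extD α) x)
    (funext fun i => ?_)
  exact DFunLike.congr_fun (mfderiv_symm_comp_mfderiv_chart x (mem_extChartAt_source x)) _

end Naturality

/-! ### The Leibniz rule in low degrees -/

section Leibniz

section WedgeTwoTwo

variable {V A : Type*} [AddCommGroup V] [Module ℝ V] [NormedCommRing A] [NormedAlgebra ℝ A]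

theorem altProd_one_two (f : V [⋀^Fin 1]→ₗ[ℝ] A) (g : V [⋀^Fin 2]→ₗ[ℝ] A) (x y z : V) :
    altProd (N := 3) rfl f g ![x, y, z] =
      f ![x] * g ![y, z] - f ![y] * g ![x, z] + f ![z] * g ![x, y] := by
  have h := altProd_cons (N := 2) (k := 0) (l := 1) rfl rfl rfl f g x ![y, z]
  have h1 := altProd_cons_of_left (N := 1) (k := 0) (l := 1) rfl rfl
    (fun w => f (Fin.cons x w)) g y (fun _ i => i.elim0) ![z]
  have h2 := altProd_cons_of_left (N := 0) (k := 0) (l := 0) rfl rfl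
    (fun w => f (Fin.cons x w)) (g.curryLeft y) z (fun _ i => i.elim0) ![]
  have h3 := altProd_degree_zero (A := A) (AlternatingMap.constOfIsEmpty ℝ V (Fin 0) (f ![x]))
    (fun w => g.curryLeft y (Fin.cons z w)) ![]
  have h4 := altProd_one_one f (g.curryLeft x) y z
  have e : (fun w : Fin 0 → V => f (Fin.cons x w)) =
      AlternatingMap.constOfIsEmpty ℝ V (Fin 0) (f ![x]) := by
    funext w
    rw [Subsingleton.elim w ![]]
    rfl
  rw [e] at h h1 h2
  refine h.trans ((congrArg₂ (· + ·) (h1.trans (congrArg _ (h2.trans (congrArg _ h3))))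
    (congrArg _ h4)).trans ?_)
  change (-1) ^ 0 * ((-1) ^ 0 * (f ![x] * g ![y, z])) +
    (-1) ^ (0 + 1) * (f ![y] * g ![x, z] - f ![z] * g ![x, y]) = _
  ring

theorem altProd_two_two (f g : V [⋀^Fin 2]→ₗ[ℝ] A) (x y z t : V) :
    altProd (N := 4) rfl f g ![x, y, z, t] =
      f ![x, y] * g ![z, t] - f ![x, z] * g ![y, t] + f ![x, t] * g ![y, z] +
        f ![y, z] * g ![x, t] - f ![y, t] * g ![x, z] + f ![z, t] * g ![x, y] := by
  have h := altProd_cons (N := 3) (k := 1) (l := 1) rfl rfl rfl f g x ![y, z, t]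
  have h1 := altProd_one_two (f.curryLeft x) g y z t
  have h2 := altProd_two_one f (g.curryLeft x) y z t
  refine h.trans ((congrArg₂ (· + ·) h1 (congrArg _ h2)).trans ?_)
  change (f ![x, y] * g ![z, t] - f ![x, z] * g ![y, t] + f ![x, t] * g ![y, z]) +
    (-1) ^ (1 + 1) * (f ![y, z] * g ![x, t] - f ![y, t] * g ![x, z] + f ![z, t] * g ![x, y]) = _
  ring

theorem wedge_two_two [TopologicalSpace V] (α β : V [⋀^Fin 2]→L[ℝ] A) (x y z t : V) :
    wedge α β ![x, y, z, t] =
      α ![x, y] * β ![z, t] - α ![x, z] * β ![y, t] + α ![x, t] * β ![y, z] +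
        α ![y, z] * β ![x, t] - α ![y, t] * β ![x, z] + α ![z, t] * β ![x, y] :=
  (wedge_apply α β _).trans (altProd_two_two α.toAlternatingMap β.toAlternatingMap x y z t)

end WedgeTwoTwo

variable {E A : Type*} [NormedAddCommGroup E] [NormedSpace ℝ E] [FiniteDimensional ℝ E]
  [NormedCommRing A] [NormedAlgebra ℝ A] [FiniteDimensional ℝ A]
  {D : Type*} [NormedAddCommGroup D] [NormedSpace ℝ D]

/-- A family of forms is differentiable if its values on fixed vectors are: the forms embed linearly
into the finite-dimensional space of their values on the vectors of a basis. -/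
theorem differentiableAt_of_apply {k : ℕ} {f : D → E [⋀^Fin k]→L[ℝ] A} {x : D}
    (h : ∀ v, DifferentiableAt ℝ (fun y => f y v) x) : DifferentiableAt ℝ f x := by
  let b := Module.finBasis ℝ E
  let ev : (E [⋀^Fin k]→L[ℝ] A) →ₗ[ℝ] ((Fin k → Fin (Module.finrank ℝ E)) → A) :=
    { toFun := fun f r => f fun i => b (r i)
      map_add' := fun _ _ => rfl
      map_smul' := fun _ _ => rfl }
  have hinj : LinearMap.ker ev = ⊥ := by
    rw [LinearMap.ker_eq_bot]
    intro f g hfg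
    have h1 : f.toAlternatingMap = g.toAlternatingMap :=
      Module.Basis.ext_alternating b fun r _ => congrFun hfg r
    ext v
    exact DFunLike.congr_fun h1 v
  obtain ⟨s, hs⟩ := ev.exists_leftInverse_of_injective hinj
  have h1 : DifferentiableAt ℝ (fun y => ev (f y)) x := differentiableAt_pi.2 fun r => h _
  have h2 : f = fun y => LinearMap.toContinuousLinearMap s (ev (f y)) := by
    funext y
    exact (DFunLike.congr_fun hs (f y)).symm
  rw [h2]
  exact (LinearMap.toContinuousLinearMap s).differentiableAt.comp x h1

omit [FiniteDimensional ℝ E] [FiniteDimensional ℝ A] in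
/-- The product rule for the values of a wedge product on fixed vectors. It is stated for the values
because it does not presuppose that the wedge product is differentiable as a family of forms. -/
theorem hasFDerivAt_wedge_apply {k l : ℕ} {a : D → E [⋀^Fin k]→L[ℝ] A}
    {b : D → E [⋀^Fin l]→L[ℝ] A} {x : D} (ha : DifferentiableAt ℝ a x)
    (hb : DifferentiableAt ℝ b x) (v : Fin (k + l) → E) :
    ∃ L : D →L[ℝ] A, HasFDerivAt (fun y => wedge (a y) (b y) v) L x ∧
      ∀ w, L w = wedge (fderiv ℝ a x w) (b x) v + wedge (a x) (fderiv ℝ b x w) v := by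
  have h1 : ∀ {j : ℕ} {c : D → E [⋀^Fin j]→L[ℝ] A}, DifferentiableAt ℝ c x → ∀ u : Fin j → E,
      HasFDerivAt (fun y => c y u)
        ((ContinuousAlternatingMap.apply ℝ E A u).comp (fderiv ℝ c x)) x := fun hc u =>
    (ContinuousAlternatingMap.apply ℝ E A u).hasFDerivAt.comp x hc.hasFDerivAt
  have h2 := (HasFDerivAt.fun_sum (u := Finset.univ) fun (σ : Equiv.Perm (Fin (k + l))) _ =>
    ((h1 ha fun i => v (σ (Fin.castAdd l i))).mul
      (h1 hb fun j => v (σ (Fin.natAdd k j)))).const_smul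
        ((Equiv.Perm.sign σ : ℤ) : ℝ)).const_smul ((k.factorial * l.factorial : ℝ))⁻¹
  refine ⟨_, h2.congr_of_eventuallyEq (Filter.Eventually.of_forall fun y => ?_), fun w => ?_⟩
  · refine (wedge_apply (a y) (b y) v).trans ?_
    simp only [altProd, ← Int.cast_smul_eq_zsmul ℝ]
    rfl
  · rw [wedge_apply, wedge_apply]
    simp only [altProd, ← Int.cast_smul_eq_zsmul ℝ]
    rw [← smul_add, ← Finset.sum_add_distrib, smul_apply, sum_apply]
    congr 1
    refine Finset.sum_congr rfl fun σ _ => ?_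
    rw [← smul_add, smul_apply]
    congr 1
    rw [add_comm]
    simp only [add_apply, smul_apply, smul_eq_mul]
    congr 1
    exact mul_comm _ _

theorem differentiableAt_wedge {k l : ℕ} {a : D → E [⋀^Fin k]→L[ℝ] A}
    {b : D → E [⋀^Fin l]→L[ℝ] A} {x : D} (ha : DifferentiableAt ℝ a x)
    (hb : DifferentiableAt ℝ b x) : DifferentiableAt ℝ (fun y => wedge (a y) (b y)) x :=
  differentiableAt_of_apply fun v => by
    obtain ⟨L, hL, -⟩ := hasFDerivAt_wedge_apply ha hb v
    exact hL.differentiableAt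

theorem fderiv_wedge_apply {k l : ℕ} {a : D → E [⋀^Fin k]→L[ℝ] A}
    {b : D → E [⋀^Fin l]→L[ℝ] A} {x : D} (ha : DifferentiableAt ℝ a x)
    (hb : DifferentiableAt ℝ b x) (w : D) (v : Fin (k + l) → E) :
    fderiv ℝ (fun y => wedge (a y) (b y)) x w v =
      wedge (fderiv ℝ a x w) (b x) v + wedge (a x) (fderiv ℝ b x w) v := by
  obtain ⟨L, hL, hw⟩ := hasFDerivAt_wedge_apply ha hb v
  rw [← hw w, ← hL.fderiv]
  have h := (differentiableAt_wedge ha hb).hasFDerivAt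
  have h1 : HasFDerivAt (fun y => wedge (a y) (b y) v)
      ((ContinuousAlternatingMap.apply ℝ E A v).comp
        (fderiv ℝ (fun y => wedge (a y) (b y)) x)) x :=
    (ContinuousAlternatingMap.apply ℝ E A v).hasFDerivAt.comp x h
  rw [h1.fderiv]
  rfl

omit [FiniteDimensional ℝ E] [FiniteDimensional ℝ A] in
theorem extDeriv_one_apply (a : E → E [⋀^Fin 1]→L[ℝ] A) (x p q : E) :
    extDeriv a x ![p, q] = fderiv ℝ a x p ![q] - fderiv ℝ a x q ![p] := by
  rw [extDeriv, ContinuousAlternatingMap.alternatizeUncurryFin_apply, Fin.sum_univ_two]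
  have e0 : Fin.removeNth (0 : Fin 2) ![p, q] = ![q] := funext fun i => by fin_cases i; rfl
  have e1 : Fin.removeNth (1 : Fin 2) ![p, q] = ![p] := funext fun i => by fin_cases i; rfl
  rw [e0, e1]
  simp [sub_eq_add_neg]

omit [FiniteDimensional ℝ E] [FiniteDimensional ℝ A] in
theorem extDeriv_two_apply (a : E → E [⋀^Fin 2]→L[ℝ] A) (x p q r : E) :
    extDeriv a x ![p, q, r] =
      fderiv ℝ a x p ![q, r] - fderiv ℝ a x q ![p, r] + fderiv ℝ a x r ![p, q] := by
  rw [extDeriv, ContinuousAlternatingMap.alternatizeUncurryFin_apply, Fin.sum_univ_three]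
  have e0 : Fin.removeNth (0 : Fin 3) ![p, q, r] = ![q, r] :=
    funext fun i => by fin_cases i <;> rfl
  have e1 : Fin.removeNth (1 : Fin 3) ![p, q, r] = ![p, r] :=
    funext fun i => by fin_cases i <;> rfl
  have e2 : Fin.removeNth (2 : Fin 3) ![p, q, r] = ![p, q] :=
    funext fun i => by fin_cases i <;> rfl
  rw [e0, e1, e2]
  simp [sub_eq_add_neg]

omit [FiniteDimensional ℝ E] [FiniteDimensional ℝ A] in
theorem extDeriv_three_apply (a : E → E [⋀^Fin 3]→L[ℝ] A) (x p q r s : E) :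
    extDeriv a x ![p, q, r, s] =
      fderiv ℝ a x p ![q, r, s] - fderiv ℝ a x q ![p, r, s] + fderiv ℝ a x r ![p, q, s] -
        fderiv ℝ a x s ![p, q, r] := by
  rw [extDeriv, ContinuousAlternatingMap.alternatizeUncurryFin_apply, Fin.sum_univ_four]
  have e0 : Fin.removeNth (0 : Fin 4) ![p, q, r, s] = ![q, r, s] :=
    funext fun i => by fin_cases i <;> rfl
  have e1 : Fin.removeNth (1 : Fin 4) ![p, q, r, s] = ![p, r, s] :=
    funext fun i => by fin_cases i <;> rfl
  have e2 : Fin.removeNth (2 : Fin 4) ![p, q, r, s] = ![p, q, s] :=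
    funext fun i => by fin_cases i <;> rfl
  have e3 : Fin.removeNth (3 : Fin 4) ![p, q, r, s] = ![p, q, r] :=
    funext fun i => by fin_cases i <;> rfl
  rw [e0, e1, e2, e3]
  simp [sub_eq_add_neg, pow_succ]

theorem extDeriv_wedge_one_one {a b : E → E [⋀^Fin 1]→L[ℝ] A} {x : E}
    (ha : DifferentiableAt ℝ a x) (hb : DifferentiableAt ℝ b x) :
    extDeriv (fun y => wedge (a y) (b y)) x =
      wedge (extDeriv a x) (b x) - wedge (extDeriv b x) (a x) := by
  ext v
  obtain ⟨p, q, r, rfl⟩ : ∃ p q r, v = ![p, q, r] :=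
    ⟨v 0, v 1, v 2, funext fun i => by fin_cases i <;> rfl⟩
  rw [extDeriv_two_apply]
  simp only [fderiv_wedge_apply ha hb, wedge_one_one]
  refine Eq.trans ?_ (congrArg₂ (fun s t : A => s - t) (wedge_two_one (extDeriv a x) (b x) p q r)
    (wedge_two_one (extDeriv b x) (a x) p q r)).symm
  simp only [extDeriv_one_apply]
  ring

/-- `d(a ∧ b) = a ∧ db` for a `2`-form `a` which is closed at the point `x`. -/
theorem extDeriv_wedge_two_one {a : E → E [⋀^Fin 2]→L[ℝ] A} {b : E → E [⋀^Fin 1]→L[ℝ] A} {x : E}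
    (ha : DifferentiableAt ℝ a x) (hb : DifferentiableAt ℝ b x) (hda : extDeriv a x = 0) :
    extDeriv (fun y => wedge (a y) (b y)) x = wedge (a x) (extDeriv b x) := by
  have hda' : ∀ p q r, fderiv ℝ a x p ![q, r] - fderiv ℝ a x q ![p, r] +
      fderiv ℝ a x r ![p, q] = 0 := fun p q r => by
    rw [← extDeriv_two_apply, hda]
    rfl
  ext v
  obtain ⟨p, q, r, s, rfl⟩ : ∃ p q r s, v = ![p, q, r, s] :=
    ⟨v 0, v 1, v 2, v 3, funext fun i => by fin_cases i <;> rfl⟩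
  rw [extDeriv_three_apply]
  simp only [fderiv_wedge_apply ha hb, wedge_two_one]
  refine Eq.trans ?_ (wedge_two_two _ _ p q r s).symm
  simp only [extDeriv_one_apply]
  -- the coefficient of each value of `b x` is a value of the exterior derivative of `a`
  linear_combination (b x ![s]) * hda' p q r - (b x ![r]) * hda' p q s +
    (b x ![q]) * hda' p r s - (b x ![p]) * hda' q r s

end Leibniz

/-! ### Exterior derivatives of sums, products and complexifications -/

section ExtDAlgebra

variable {m : ℕ} {M : Type*} [TopologicalSpace M] [ChartedSpace (EuclideanSpace ℝ (Fin m)) M]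

section Linear

variable {A B : Type*} [NormedAddCommGroup A] [NormedSpace ℝ A] [NormedAddCommGroup B]
  [NormedSpace ℝ B] {k : ℕ}

/-- The form obtained by applying a linear map to the values of a form. -/
def mapForm (L : A →L[ℝ] B) (α : DForm m M A k) : DForm m M B k :=
  fun x => L.compContinuousAlternatingMap (α x)

theorem FormDifferentiableAt.mapForm (L : A →L[ℝ] B) {α : DForm m M A k} {x : M}
    (h : FormDifferentiableAt α x) : FormDifferentiableAt (mapForm L α) x :=
  (ContinuousLinearMap.compContinuousAlternatingMapCLM ℝ (EuclideanSpace ℝ (Fin m)) A B (Fin k)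
    L).differentiableAt.comp (extChartAt (𝓡 m) x x) h

theorem extD_mapForm (L : A →L[ℝ] B) {α : DForm m M A k} {x : M}
    (h : FormDifferentiableAt α x) :
    extD (mapForm L α) x = L.compContinuousAlternatingMap (extD α x) := by
  have h1 : HasFDerivAt (inChart (mapForm L α) x)
      ((ContinuousLinearMap.compContinuousAlternatingMapCLM ℝ (EuclideanSpace ℝ (Fin m)) A B
        (Fin k) L).comp (fderiv ℝ (inChart α x) (extChartAt (𝓡 m) x x))) (extChartAt (𝓡 m) x x) :=
    (ContinuousLinearMap.compContinuousAlternatingMapCLM ℝ (EuclideanSpace ℝ (Fin m)) A B (Fin k)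
      L).hasFDerivAt.comp (extChartAt (𝓡 m) x x) h.hasFDerivAt
  have h2 : extDeriv (inChart (mapForm L α) x) (extChartAt (𝓡 m) x x) =
      L.compContinuousAlternatingMap (extDeriv (inChart α x) (extChartAt (𝓡 m) x x)) := by
    ext v
    rw [extDeriv, h1.fderiv, ContinuousAlternatingMap.alternatizeUncurryFin_apply]
    refine Eq.trans ?_ (congrArg L
      (ContinuousAlternatingMap.alternatizeUncurryFin_apply _ v)).symm
    rw [map_sum]
    refine Finset.sum_congr rfl fun i _ => ?_
    rw [map_zsmul]
    rfl
  ext v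
  exact DFunLike.congr_fun h2 _

theorem FormDifferentiableAt.add {α β : DForm m M A k} {x : M}
    (hα : FormDifferentiableAt α x) (hβ : FormDifferentiableAt β x) :
    FormDifferentiableAt (α + β) x :=
  DifferentiableAt.add (f := inChart α x) (g := inChart β x) hα hβ

theorem extD_add {α β : DForm m M A k} {x : M} (hα : FormDifferentiableAt α x)
    (hβ : FormDifferentiableAt β x) : extD (α + β) x = extD α x + extD β x := by
  have h1 : inChart (α + β) x = inChart α x + inChart β x := rfl
  have h2 : extDeriv (inChart (α + β) x) (extChartAt (𝓡 m) x x) =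
      extDeriv (inChart α x) (extChartAt (𝓡 m) x x) +
        extDeriv (inChart β x) (extChartAt (𝓡 m) x x) := by
    rw [h1]
    exact extDeriv_add hα hβ
  ext v
  exact DFunLike.congr_fun h2 _

theorem extD_zero : extD (0 : DForm m M A k) = 0 := by
  funext x
  have h1 : inChart (0 : DForm m M A k) x = fun _ => 0 := rfl
  have h2 : extDeriv (inChart (0 : DForm m M A k) x) (extChartAt (𝓡 m) x x) = 0 := by
    ext v
    rw [h1, extDeriv, ContinuousAlternatingMap.alternatizeUncurryFin_apply]
    simp
  ext v
  exact DFunLike.congr_fun h2 _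

end Linear

variable {A : Type*} [NormedCommRing A] [NormedAlgebra ℝ A] [FiniteDimensional ℝ A]

omit [FiniteDimensional ℝ A] in
theorem inChart_wedgeForm {k l : ℕ} (α : DForm m M A k) (β : DForm m M A l) (x : M) :
    inChart (wedgeForm α β) x = fun y => wedge (inChart α x y) (inChart β x y) := by
  funext y
  exact (wedge_compContinuousLinearMap _ _ _).symm

theorem FormDifferentiableAt.wedgeForm {k l : ℕ} {α : DForm m M A k} {β : DForm m M A l} {x : M}
    (hα : FormDifferentiableAt α x) (hβ : FormDifferentiableAt β x) :
    FormDifferentiableAt (wedgeForm α β) x := by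
  have h := differentiableAt_wedge (E := EuclideanSpace ℝ (Fin m)) hα hβ
  rwa [← inChart_wedgeForm] at h

variable [IsManifold (𝓡 m) ∞ M]

omit [FiniteDimensional ℝ A] in
/-- The expression of a form in a chart, pulled back by the chart, is the form. -/
theorem inChart_compContinuousLinearMap {k : ℕ} (α : DForm m M A k) (x : M) :
    (inChart α x (extChartAt (𝓡 m) x x)).compContinuousLinearMap
      (mfderiv (𝓡 m) 𝓘(ℝ, EuclideanSpace ℝ (Fin m)) (extChartAt (𝓡 m) x) x :
        EuclideanSpace ℝ (Fin m) →L[ℝ] EuclideanSpace ℝ (Fin m)) = α x := by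
  rw [inChart_apply_chart _ x (mem_extChartAt_source x)]
  ext v
  refine congrArg (α x) (funext fun i => ?_)
  exact DFunLike.congr_fun (mfderiv_symm_comp_mfderiv_chart x (mem_extChartAt_source x)) _

theorem extD_wedge_one_one {α β : DForm m M A 1} {x : M} (hα : FormDifferentiableAt α x)
    (hβ : FormDifferentiableAt β x) :
    extD (wedgeForm α β) x = wedge (extD α x) (β x) - wedge (extD β x) (α x) := by
  have h := extDeriv_wedge_one_one (E := EuclideanSpace ℝ (Fin m)) hα hβ
  rw [← inChart_wedgeForm] at h
  have h1 := wedge_compContinuousLinearMap (extDeriv (inChart α x) (extChartAt (𝓡 m) x x))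
    (inChart β x (extChartAt (𝓡 m) x x))
    (mfderiv (𝓡 m) 𝓘(ℝ, EuclideanSpace ℝ (Fin m)) (extChartAt (𝓡 m) x) x)
  have h2 := wedge_compContinuousLinearMap (extDeriv (inChart β x) (extChartAt (𝓡 m) x x))
    (inChart α x (extChartAt (𝓡 m) x x))
    (mfderiv (𝓡 m) 𝓘(ℝ, EuclideanSpace ℝ (Fin m)) (extChartAt (𝓡 m) x) x)
  rw [inChart_compContinuousLinearMap] at h1 h2
  ext v
  refine (DFunLike.congr_fun h _).trans ?_
  exact (congrArg₂ (fun s t : A => s - t) (DFunLike.congr_fun h1 v)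
    (DFunLike.congr_fun h2 v)).symm

/-- The Leibniz rule for the product of a closed `2`-form and a `1`-form. -/
theorem extD_wedge_two_one {α : DForm m M A 2} {β : DForm m M A 1} {x : M}
    (hα : FormDifferentiableAt α x) (hβ : FormDifferentiableAt β x) (hdα : extD α x = 0) :
    extD (wedgeForm α β) x = wedge (α x) (extD β x) := by
  -- `extD α x` is the pullback of this form by the derivative of the chart, which is invertible
  have hd : extDeriv (inChart α x) (extChartAt (𝓡 m) x x) = 0 := by
    have hinj : ∀ w : EuclideanSpace ℝ (Fin m),
        mfderiv (𝓡 m) 𝓘(ℝ, EuclideanSpace ℝ (Fin m)) (extChartAt (𝓡 m) x) x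
          (mfderiv 𝓘(ℝ, EuclideanSpace ℝ (Fin m)) (𝓡 m) (extChartAt (𝓡 m) x).symm
            (extChartAt (𝓡 m) x x) w : EuclideanSpace ℝ (Fin m)) = w := fun w =>
      DFunLike.congr_fun (mfderiv_chart_comp_mfderiv_symm x (mem_extChartAt_source x)) w
    ext v
    have h1 := DFunLike.congr_fun hdα fun i =>
      (mfderiv 𝓘(ℝ, EuclideanSpace ℝ (Fin m)) (𝓡 m) (extChartAt (𝓡 m) x).symm
            (extChartAt (𝓡 m) x x) (v i) : EuclideanSpace ℝ (Fin m))
    refine Eq.trans (congrArg (extDeriv (inChart α x) (extChartAt (𝓡 m) x x))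
      (funext fun i => (hinj (v i)).symm)) h1
  have h := extDeriv_wedge_two_one (E := EuclideanSpace ℝ (Fin m)) hα hβ hd
  rw [← inChart_wedgeForm] at h
  have h1 := wedge_compContinuousLinearMap (inChart α x (extChartAt (𝓡 m) x x))
    (extDeriv (inChart β x) (extChartAt (𝓡 m) x x))
    (mfderiv (𝓡 m) 𝓘(ℝ, EuclideanSpace ℝ (Fin m)) (extChartAt (𝓡 m) x) x)
  rw [inChart_compContinuousLinearMap] at h1
  ext v
  exact (DFunLike.congr_fun h _).trans (DFunLike.congr_fun h1 v).symm

end ExtDAlgebra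

/-! ### Forms of type `(p, q)` -/

section Types

variable {V : Type*} [AddCommGroup V] [Module ℝ V] [TopologicalSpace V]
  {J : V →L[ℝ] V}

theorem IsOfType.wedge {p q p' q' k l : ℕ} {α : V [⋀^Fin k]→L[ℝ] ℂ} {β : V [⋀^Fin l]→L[ℝ] ℂ}
    (hα : IsOfType J p q α) (hβ : IsOfType J p' q' β) :
    IsOfType J (p + p') (q + q') (wedge α β) := by
  intro a b v
  rw [wedge_apply, wedge_apply,
    ← altProd_comp rfl α β (fun x => a • x + b • J x) v]
  simp only [hα a b, hβ a b]
  refine (altProd_smul_left _ _ _ _ _).trans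
    ((congrArg _ (altProd_smul_right _ _ _ _ _)).trans ?_)
  ring

theorem IsOfType.smul {p q k : ℕ} {α : V [⋀^Fin k]→L[ℝ] ℂ} (hα : IsOfType J p q α) (c : ℂ) :
    IsOfType J p q (c • α) := by
  intro a b v
  change c * α _ = _ * (c * α v)
  rw [hα a b v]
  ring

theorem IsOfType.add {p q k : ℕ} {α β : V [⋀^Fin k]→L[ℝ] ℂ} (hα : IsOfType J p q α)
    (hβ : IsOfType J p q β) : IsOfType J p q (α + β) := by
  intro a b v
  change α _ + β _ = _ * (α v + β v)
  rw [hα a b v, hβ a b v]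
  ring

theorem apply_one_smul_add_smul (α : V [⋀^Fin 1]→L[ℝ] ℂ) (a b : ℝ) (x y : V) :
    α ![a • x + b • y] = a * α ![x] + b * α ![y] := by
  have h : ∀ z : V, (![z] : Fin 1 → V) = Function.update ![0] 0 z := fun z =>
    funext fun i => by fin_cases i; rfl
  rw [h, h x, h y, α.map_update_add, α.map_update_smul, α.map_update_smul, Complex.real_smul,
    Complex.real_smul]

theorem isOfType_one_zero {α : V [⋀^Fin 1]→L[ℝ] ℂ}
    (h : ∀ x, α ![J x] = Complex.I * α ![x]) : IsOfType J 1 0 α := by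
  intro a b v
  have e : ∀ w : Fin 1 → V, w = ![w 0] := fun w => funext fun i => by fin_cases i; rfl
  rw [e fun i => a • v i + b • J (v i), e v, apply_one_smul_add_smul]
  simp only [Matrix.cons_val_zero, h]
  ring

theorem isOfType_zero_one {α : V [⋀^Fin 1]→L[ℝ] ℂ}
    (h : ∀ x, α ![J x] = -Complex.I * α ![x]) : IsOfType J 0 1 α := by
  intro a b v
  have e : ∀ w : Fin 1 → V, w = ![w 0] := fun w => funext fun i => by fin_cases i; rfl
  rw [e fun i => a • v i + b • J (v i), e v, apply_one_smul_add_smul]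
  simp only [Matrix.cons_val_zero, h]
  ring

/-- A `2`-form which is invariant under a complex structure is of type `(1, 1)`. -/
theorem isOfType_one_one {α : V [⋀^Fin 2]→L[ℝ] ℂ} (hJ : ∀ x, J (J x) = -x)
    (h : ∀ x y, α ![J x, J y] = α ![x, y]) : IsOfType J 1 1 α := by
  intro a b v
  have e : ∀ w : Fin 2 → V, w = ![w 0, w 1] := fun w => funext fun i => by fin_cases i <;> rfl
  have hl : ∀ (a b : ℝ) (x y z : V), α ![a • x + b • y, z] = a * α ![x, z] + b * α ![y, z] := by
    intro a b x y z
    have h : ∀ t : V, (![t, z] : Fin 2 → V) = Function.update ![0, z] 0 t := fun t =>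
      funext fun i => by fin_cases i <;> rfl
    rw [h, h x, h y, α.map_update_add, α.map_update_smul, α.map_update_smul, Complex.real_smul,
      Complex.real_smul]
  have hr : ∀ (a b : ℝ) (x y z : V), α ![z, a • x + b • y] = a * α ![z, x] + b * α ![z, y] := by
    intro a b x y z
    have h : ∀ t : V, (![z, t] : Fin 2 → V) = Function.update ![z, 0] 1 t := fun t =>
      funext fun i => by fin_cases i <;> rfl
    rw [h, h x, h y, α.map_update_add, α.map_update_smul, α.map_update_smul, Complex.real_smul,
      Complex.real_smul]
  have hneg : ∀ x y : V, α ![x, -y] = -α ![x, y] := by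
    intro x y
    have h1 := hr (-1) 0 y 0 x
    simpa using h1
  have hmix : α ![v 0, J (v 1)] = -α ![J (v 0), v 1] := by
    rw [← h (v 0) (J (v 1)), hJ, hneg]
  rw [e fun i => a • v i + b • J (v i), e v]
  simp only [Matrix.cons_val_zero, Matrix.cons_val_one, hl, hr, h, hmix]
  have hI := Complex.I_sq
  linear_combination ((b : ℂ) ^ 2 * α ![v 0, v 1]) * hI

variable [IsTopologicalAddGroup V] [ContinuousSMul ℝ V]

theorem typePart_add (p : ℕ) {k : ℕ} (ψ φ : V [⋀^Fin k]→L[ℝ] ℂ) :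
    typePart J p (ψ + φ) = typePart J p ψ + typePart J p φ := by
  unfold typePart
  refine Eq.trans ?_ (smul_add _ _ _)
  refine congrArg _ (Eq.trans ?_ Finset.sum_add_distrib)
  refine Finset.sum_congr rfl fun j _ => ?_
  refine Eq.trans ?_ (smul_add _ _ _)
  rfl

theorem typePart_zero (p : ℕ) {k : ℕ} : typePart J p (0 : V [⋀^Fin k]→L[ℝ] ℂ) = 0 := by
  have h := typePart_add (J := J) p (0 : V [⋀^Fin k]→L[ℝ] ℂ) 0
  rwa [add_zero, left_eq_add] at h

end Types

section Dolbeault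

variable {m : ℕ} {M : Type*} [TopologicalSpace M] [ChartedSpace (EuclideanSpace ℝ (Fin m)) M]
  {J : (x : M) → TangentSpace (𝓡 m) x →L[ℝ] TangentSpace (𝓡 m) x} {k r : ℕ} {α : DForm m M ℂ k}

/-- The components of a form of pure type, as fields of forms, are the form itself and zero, so that
only one summand in the definitions of `del` and `delBar` remains. -/
theorem extD_typePart_of_type (hr : r ≤ k) (hα : ∀ x, IsOfType (J x) r (k - r) (α x)) {p : ℕ}
    (hp : p ≤ k) :
    extD (fun y => typePart (J y) p (α y)) = if p = r then extD α else 0 := by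
  split_ifs with h
  · subst h
    congr 1
    funext y
    exact (hα y).typePart_self hr
  · rw [← extD_zero]
    congr 1
    funext y
    exact (hα y).typePart_of_ne hr hp h

/-- `∂` of a form of type `(r, k - r)`. -/
theorem del_of_type (hr : r ≤ k) (hα : ∀ x, IsOfType (J x) r (k - r) (α x)) (x : M) :
    del J α x = typePart (J x) (r + 1) (extD α x) := by
  unfold del
  rw [Finset.sum_eq_single r]
  · rw [extD_typePart_of_type hr hα hr, if_pos rfl]
  · intro p hp hpr
    rw [extD_typePart_of_type hr hα (by simpa [Nat.lt_succ_iff] using hp), if_neg hpr]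
    exact typePart_zero _
  · intro h
    exact absurd (Finset.mem_range.2 (Nat.lt_succ_of_le hr)) h

/-- `∂̄` of a form of type `(r, k - r)`. -/
theorem delBar_of_type (hr : r ≤ k) (hα : ∀ x, IsOfType (J x) r (k - r) (α x)) (x : M) :
    delBar J α x = typePart (J x) r (extD α x) := by
  unfold delBar
  rw [Finset.sum_eq_single r]
  · rw [extD_typePart_of_type hr hα hr, if_pos rfl]
  · intro p hp hpr
    rw [extD_typePart_of_type hr hα (by simpa [Nat.lt_succ_iff] using hp), if_neg hpr]
    exact typePart_zero _
  · intro h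
    exact absurd (Finset.mem_range.2 (Nat.lt_succ_of_le hr)) h

end Dolbeault

/-! ### Cartan's formula and normality -/

section Cartan

/-- Cartan's formula for the exterior derivative of a `1`-form. -/
theorem extDeriv_apply_pair {E : Type*} [NormedAddCommGroup E] [NormedSpace ℝ E]
    {α : E → E [⋀^Fin 1]→L[ℝ] ℝ} {U V : E → E} {z : E} (hα : DifferentiableAt ℝ α z)
    (hU : DifferentiableAt ℝ U z) (hV : DifferentiableAt ℝ V z) :
    extDeriv α z ![U z, V z] = fderiv ℝ (fun y => α y ![V y]) z (U z) -
      fderiv ℝ (fun y => α y ![U y]) z (V z) - α z ![VectorField.lieBracket ℝ U V z] := by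
  have key := extDeriv_apply_vectorField (V := ![U, V]) hα
    (fun i => by fin_cases i <;> [exact hU; exact hV])
  have s : (fun i => (![U, V] : Fin 2 → E → E) i z) = ![U z, V z] := by
    funext i; fin_cases i <;> rfl
  have s0 : ∀ y, (Fin.removeNth 0 fun i => (![U, V] : Fin 2 → E → E) i y) = ![V y] := by
    intro y; funext i; fin_cases i; rfl
  have s1 : ∀ y, (Fin.removeNth 1 fun i => (![U, V] : Fin 2 → E → E) i y) = ![U y] := by
    intro y; funext i; fin_cases i; rfl
  have t0 : (fun y => α y (Fin.removeNth 0 fun i => (![U, V] : Fin 2 → E → E) i y)) =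
      fun y => α y ![V y] := funext fun y => congrArg (α y) (s0 y)
  have t1 : (fun y => α y (Fin.removeNth 1 fun i => (![U, V] : Fin 2 → E → E) i y)) =
      fun y => α y ![U y] := funext fun y => congrArg (α y) (s1 y)
  have s2 : Finset.Ici (0 : Fin 1) = {0} := rfl
  have s3 : ∀ (w : E) (f : Fin 0 → E), (Matrix.vecCons w f : Fin 1 → E) = ![w] := by
    intro w f; funext i; fin_cases i; rfl
  rw [s, Fin.sum_univ_two, t0, t1, Fin.sum_univ_one, s2, Finset.sum_singleton, s3] at key
  rw [key]
  simp [sub_eq_add_neg]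

variable {m : ℕ} {M : Type*} [TopologicalSpace M] [ChartedSpace (EuclideanSpace ℝ (Fin m)) M]
  [IsManifold (𝓡 m) ∞ M]

/-- The expression of a vector field in the chart at `x`. -/
def fieldInChart (U : (x : M) → TangentSpace (𝓡 m) x) (x : M) :
    EuclideanSpace ℝ (Fin m) → EuclideanSpace ℝ (Fin m) :=
  VectorField.mpullbackWithin 𝓘(ℝ, EuclideanSpace ℝ (Fin m)) (𝓡 m) (extChartAt (𝓡 m) x).symm U
    (Set.range (𝓡 m))

/-- The value of a `1`-form on a vector field can be computed in a chart, at every point of the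
chart. -/
theorem inChart_fieldInChart (α : DForm m M ℝ 1) (U : (x : M) → TangentSpace (𝓡 m) x) (x : M)
    {y : EuclideanSpace ℝ (Fin m)} (hy : y ∈ (extChartAt (𝓡 m) x).target) :
    inChart α x y ![fieldInChart U x y] =
      α ((extChartAt (𝓡 m) x).symm y) ![U ((extChartAt (𝓡 m) x).symm y)] := by
  have : IsManifold (𝓡 m) 1 M := IsManifold.of_le (n := ∞) (by simp)
  have hinv := isInvertible_mfderivWithin_extChartAt_symm (I := 𝓡 m) hy
  have h1 : mfderivWithin 𝓘(ℝ, EuclideanSpace ℝ (Fin m)) (𝓡 m) (extChartAt (𝓡 m) x).symm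
      (Set.range (𝓡 m)) y (fieldInChart U x y) = U ((extChartAt (𝓡 m) x).symm y) :=
    hinv.self_apply_inverse _
  rw [ModelWithCorners.range_eq_univ, mfderivWithin_univ] at h1
  change α ((extChartAt (𝓡 m) x).symm y) (fun i => mfderiv 𝓘(ℝ, EuclideanSpace ℝ (Fin m)) (𝓡 m)
    (extChartAt (𝓡 m) x).symm y ((![fieldInChart U x y] : Fin 1 → EuclideanSpace ℝ (Fin m)) i)) = _
  congr 1
  funext i
  fin_cases i
  exact h1

/-- At the centre of the chart, the expression of a vector field is its image under the derivative
of the chart. -/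
theorem mfderiv_chart_apply_field (U : (x : M) → TangentSpace (𝓡 m) x) (x : M) :
    mfderiv (𝓡 m) 𝓘(ℝ, EuclideanSpace ℝ (Fin m)) (extChartAt (𝓡 m) x) x (U x) =
      fieldInChart U x (extChartAt (𝓡 m) x x) := by
  have : IsManifold (𝓡 m) 1 M := IsManifold.of_le (n := ∞) (by simp)
  have h := (VectorField.eventuallyEq_mpullback_mpullbackWithin_extChartAt (I := 𝓡 m)
    (s := Set.univ) (x := x) U)
  rw [nhdsWithin_univ] at h
  refine (congrArg _ h.self_of_nhds).trans ?_
  exact (isInvertible_mfderiv_extChartAt (mem_extChartAt_source x)).self_apply_inverse _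

theorem inChart_lieBracket (α : DForm m M ℝ 1) (U V : (x : M) → TangentSpace (𝓡 m) x) (x : M) :
    inChart α x (extChartAt (𝓡 m) x x)
      ![VectorField.lieBracket ℝ (fieldInChart U x) (fieldInChart V x) (extChartAt (𝓡 m) x x)] =
      α x ![VectorField.mlieBracket (𝓡 m) U V x] := by
  have : IsManifold (𝓡 m) 1 M := IsManifold.of_le (n := ∞) (by simp)
  set w := VectorField.lieBracket ℝ (fieldInChart U x) (fieldInChart V x)
    (extChartAt (𝓡 m) x x) with hw
  have h1 : mfderiv (𝓡 m) 𝓘(ℝ, EuclideanSpace ℝ (Fin m)) (extChartAt (𝓡 m) x) x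
      (VectorField.mlieBracket (𝓡 m) U V x) = w := by
    have h2 : VectorField.mlieBracket (𝓡 m) U V x =
        (mfderiv (𝓡 m) 𝓘(ℝ, EuclideanSpace ℝ (Fin m)) (extChartAt (𝓡 m) x) x).inverse w := by
      have h3 : VectorField.lieBracketWithin ℝ (fieldInChart U x) (fieldInChart V x)
          ((extChartAt (𝓡 m) x).symm ⁻¹' Set.univ ∩ Set.range (𝓡 m)) (extChartAt (𝓡 m) x x) =
          w := by
        rw [ModelWithCorners.range_eq_univ, Set.preimage_univ, Set.univ_inter,
          VectorField.lieBracketWithin_univ]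
      rw [← VectorField.mlieBracketWithin_univ, VectorField.mlieBracketWithin_apply]
      exact congrArg _ h3
    rw [h2]
    exact (isInvertible_mfderiv_extChartAt (mem_extChartAt_source x)).self_apply_inverse _
  rw [inChart_apply_chart α x (mem_extChartAt_source x), ← h1]
  refine congrArg (α x) (funext fun i => ?_)
  fin_cases i
  exact DFunLike.congr_fun (mfderiv_symm_comp_mfderiv_chart x (mem_extChartAt_source x))
    (VectorField.mlieBracket (𝓡 m) U V x)

/-- Cartan's formula for vector fields in the kernel of a `1`-form. -/
theorem extD_apply_of_kernel {α : DForm m M ℝ 1} {x : M} (hα : FormDifferentiableAt α x)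
    {U V : (x : M) → TangentSpace (𝓡 m) x} (hU : IsSmoothField U) (hV : IsSmoothField V)
    (hαU : ∀ y, α y ![U y] = 0) (hαV : ∀ y, α y ![V y] = 0) :
    extD α x ![U x, V x] = -α x ![VectorField.mlieBracket (𝓡 m) U V x] := by
  have : IsManifold (𝓡 m) 2 M := IsManifold.of_le (n := ∞) two_le_infty
  have hd : ∀ {W : (x : M) → TangentSpace (𝓡 m) x}, IsSmoothField W →
      DifferentiableAt ℝ (fieldInChart W x) (extChartAt (𝓡 m) x x) := by
    intro W hW
    have h : DifferentiableWithinAt ℝ (fieldInChart W x)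
        ((extChartAt (𝓡 m) x).symm ⁻¹' Set.univ ∩ Set.range (𝓡 m)) (extChartAt (𝓡 m) x x) :=
      MDifferentiableWithinAt.differentiableWithinAt_mpullbackWithin_vectorField
        (hW.mdifferentiableAt (x := x) (by simp)).mdifferentiableWithinAt
    rwa [Set.preimage_univ, Set.univ_inter, ModelWithCorners.range_eq_univ,
      differentiableWithinAt_univ] at h
  have hz : ∀ {W : (x : M) → TangentSpace (𝓡 m) x}, (∀ y, α y ![W y] = 0) →
      fderiv ℝ (fun y => inChart α x y ![fieldInChart W x y]) (extChartAt (𝓡 m) x x) = 0 := by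
    intro W hW
    have h : (fun y => inChart α x y ![fieldInChart W x y]) =ᶠ[nhds (extChartAt (𝓡 m) x x)]
        fun _ => 0 := by
      filter_upwards [extChartAt_target_mem_nhds x] with y hy
      rw [inChart_fieldInChart α W x hy, hW]
    rw [h.fderiv_eq, fderiv_const_apply]
  have e1 : extD α x ![U x, V x] = extDeriv (inChart α x) (extChartAt (𝓡 m) x x)
      ![fieldInChart U x (extChartAt (𝓡 m) x x), fieldInChart V x (extChartAt (𝓡 m) x x)] := by
    refine congrArg (extDeriv (inChart α x) (extChartAt (𝓡 m) x x)) (funext fun i => ?_)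
    fin_cases i
    · exact mfderiv_chart_apply_field U x
    · exact mfderiv_chart_apply_field V x
  rw [e1, extDeriv_apply_pair hα (hd hU) (hd hV), hz hαU, hz hαV, ← inChart_lieBracket]
  simp

/-- Every tangent vector extends to a smooth vector field. -/
theorem exists_isSmoothField_apply_eq [T2Space M] [SecondCountableTopology M] (x : M)
    (v : TangentSpace (𝓡 m) x) :
    ∃ U : (x : M) → TangentSpace (𝓡 m) x, IsSmoothField U ∧ U x = v := by
  have := ChartedSpace.locallyCompactSpace (EuclideanSpace ℝ (Fin m)) M
  -- the only condition on a section is its value at `x`, a convex one; locally it is met by the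
  -- extension of `v` near `x` and by the zero section on the complement of `x`, and a partition of
  -- unity glues these
  let t : ∀ y : M, Set (TangentSpace (𝓡 m) y) := fun y =>
    {s | y = x → s = FiberBundle.extend (EuclideanSpace ℝ (Fin m)) v y}
  obtain ⟨s, hs⟩ := exists_contMDiffSection_forall_mem_convex_of_local (n := ⊤) (𝓡 m)
    (F_fiber := EuclideanSpace ℝ (Fin m)) (fun y : M => TangentSpace (𝓡 m) y) t
    (by
      intro y a ha b hb r r' _ _ hrr h
      rw [ha h, hb h, ← add_smul, hrr, one_smul])
    (by
      intro x₀
      by_cases hx : x₀ = x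
      · subst hx
        obtain ⟨u, hu, hs⟩ := FiberBundle.exists_contMDiffOn_extend (k := ∞) (𝓡 m)
          (EuclideanSpace ℝ (Fin m)) (V := fun y : M => TangentSpace (𝓡 m) y) v
        exact ⟨u, hu, _, hs, fun y _ _ => rfl⟩
      · refine ⟨{x}ᶜ, isOpen_compl_singleton.mem_nhds hx, fun _ => 0, ?_, fun y hy h => absurd h hy⟩
        exact (Bundle.contMDiff_zeroSection ℝ (fun y : M => TangentSpace (𝓡 m) y)).contMDiffOn)
  refine ⟨s, s.contMDiff, (hs x rfl).trans ?_⟩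
  exact FiberBundle.extend_apply_self (EuclideanSpace ℝ (Fin m)) v

end Cartan

section Normal

variable {m : ℕ} {N : Type*} [TopologicalSpace N] [ChartedSpace (EuclideanSpace ℝ (Fin m)) N]
  [IsManifold (𝓡 m) ∞ N]

theorem IsSmoothEnd.apply_field {T : (x : N) → TangentSpace (𝓡 m) x →L[ℝ] TangentSpace (𝓡 m) x}
    (hT : IsSmoothEnd T) {U : (x : N) → TangentSpace (𝓡 m) x} (hU : IsSmoothField U) :
    IsSmoothField fun x => T x (U x) := fun x =>
  ContMDiffAt.clm_bundle_apply (F₁ := EuclideanSpace ℝ (Fin m)) (F₂ := EuclideanSpace ℝ (Fin m))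
    (E₁ := fun x : N => TangentSpace (𝓡 m) x) (E₂ := fun x : N => TangentSpace (𝓡 m) x)
    (b := fun x => x) (hT x) (hU x)

variable [T2Space N] [SecondCountableTopology N]

/-- On a normal almost contact metric manifold `dη` is `φ`-invariant: apply `η`, which vanishes on
the image of `φ`, to the normality condition, and Cartan's formula to the fields `φX` and `φY`. -/
theorem AlmostContactMetric.IsNormal.extD_η_φ_φ {S : AlmostContactMetric m N} (hS : S.IsNormal)
    (x : N) (X Y : TangentSpace (𝓡 m) x) :
    extD S.η x ![S.φ x X, S.φ x Y] = extD S.η x ![X, Y] := by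
  obtain ⟨U, hU, rfl⟩ := exists_isSmoothField_apply_eq x X
  obtain ⟨V, hV, rfl⟩ := exists_isSmoothField_apply_eq x Y
  have h1 := extD_apply_of_kernel (S.smooth_η.differentiableAt x) (S.smooth_φ.apply_field hU)
    (S.smooth_φ.apply_field hV) (fun y => S.η_φ y _) (fun y => S.η_φ y _)
  have h2 := congrArg (toCLM S.η x) (hS U V hU hV x)
  simp only [map_add, map_sub, map_smul, map_zero] at h2
  simp only [toCLM_apply, S.η_φ, S.η_ξ, smul_eq_mul, mul_one, add_zero, sub_zero] at h2
  linarith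

/-- On a normal almost contact metric manifold the Reeb field `ξ` annihilates `dη`: by
`φ`-invariance, since `φξ = 0`. -/
theorem AlmostContactMetric.IsNormal.extD_η_ξ {S : AlmostContactMetric m N} (hS : S.IsNormal)
    (x : N) (Y : TangentSpace (𝓡 m) x) : extD S.η x ![S.ξ x, Y] = 0 := by
  rw [← hS.extD_η_φ_φ, S.φ_ξ]
  exact (extD S.η x).map_coord_zero 0 rfl

end Normal

/-! ### Differentiability of the fundamental form -/

section FundamentalForm

variable {m : ℕ} {M : Type*} [TopologicalSpace M] [ChartedSpace (EuclideanSpace ℝ (Fin m)) M]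
  [IsManifold (𝓡 m) ∞ M]

/-- The coordinate vector fields of a chart are smooth. -/
theorem contMDiffAt_mfderiv_chart_symm (x : M) (a : EuclideanSpace ℝ (Fin m)) :
    ContMDiffAt 𝓘(ℝ, EuclideanSpace ℝ (Fin m)) (𝓡 m).tangent ∞
      (fun y => (⟨(extChartAt (𝓡 m) x).symm y,
        mfderiv 𝓘(ℝ, EuclideanSpace ℝ (Fin m)) (𝓡 m) (extChartAt (𝓡 m) x).symm y a⟩ :
          TangentBundle (𝓡 m) M)) (extChartAt (𝓡 m) x x) := by
  have hO : IsOpen (extChartAt (𝓡 m) x).target := isOpen_extChartAt_target x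
  have h1 := (contMDiffOn_extChartAt_symm (I := 𝓡 m) (n := ∞) x).contMDiffOn_tangentMapWithin
    (m := ∞) (by simp) hO.uniqueMDiffOn
  have h2 : ContMDiff 𝓘(ℝ, EuclideanSpace ℝ (Fin m)) 𝓘(ℝ, EuclideanSpace ℝ (Fin m)).tangent ∞
      (fun y => (⟨y, a⟩ : TangentBundle 𝓘(ℝ, EuclideanSpace ℝ (Fin m))
        (EuclideanSpace ℝ (Fin m)))) :=
    contMDiff_vectorSpace_iff_contDiff.2 contDiff_const
  have h3 := (h1.comp h2.contMDiffOn (s := (extChartAt (𝓡 m) x).target)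
    fun y hy => hy).contMDiffAt (hO.mem_nhds (mem_extChartAt_target x))
  refine h3.congr_of_eventuallyEq ?_
  filter_upwards [extChartAt_target_mem_nhds x] with y hy
  change _ = (⟨_, mfderivWithin _ _ _ _ y a⟩ : TangentBundle (𝓡 m) M)
  rw [mfderivWithin_of_isOpen hO hy]

variable (S : AlmostContactMetric m M)

/-- The components of `Φ` in a chart are the smooth functions `g(φ ∂ᵢ, ∂ⱼ)`. -/
theorem AlmostContactMetric.formDifferentiableAt_Φ (x : M) : FormDifferentiableAt S.Φ x := by
  refine differentiableAt_of_apply fun v => ?_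
  set c := extChartAt (𝓡 m) x with hc
  have hb : ContMDiffAt 𝓘(ℝ, EuclideanSpace ℝ (Fin m)) (𝓡 m) ∞ c.symm (c x) :=
    contMDiffAt_chart_symm x (mem_extChartAt_target x)
  have h0 := contMDiffAt_mfderiv_chart_symm x (v 0)
  have h1 := contMDiffAt_mfderiv_chart_symm x (v 1)
  have hφ := ContMDiffAt.clm_bundle_apply (F₁ := EuclideanSpace ℝ (Fin m))
    (F₂ := EuclideanSpace ℝ (Fin m))
    (E₁ := fun x : M => TangentSpace (𝓡 m) x) (E₂ := fun x : M => TangentSpace (𝓡 m) x)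
    (b := c.symm) (ϕ := fun y => S.φ (c.symm y)) (S.smooth_φ.contMDiffAt.comp (c x) hb) h0
  have hg := ContMDiffAt.clm_bundle_apply₂ (F₁ := EuclideanSpace ℝ (Fin m))
    (F₂ := EuclideanSpace ℝ (Fin m)) (F₃ := ℝ)
    (E₁ := fun x : M => TangentSpace (𝓡 m) x) (E₂ := fun x : M => TangentSpace (𝓡 m) x)
    (E₃ := Bundle.Trivial M ℝ)
    (b := c.symm) (ψ := fun y => S.g.inner (c.symm y)) (S.g.contMDiff.contMDiffAt.comp (c x) hb)
    hφ h1
  rw [Bundle.contMDiffAt_totalSpace] at hg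
  refine (hg.2.mdifferentiableAt (by simp)).differentiableAt.congr_of_eventuallyEq ?_
  refine Filter.Eventually.of_forall fun y => ?_
  have e : (fun i => mfderiv 𝓘(ℝ, EuclideanSpace ℝ (Fin m)) (𝓡 m) c.symm y (v i)) =
      ![mfderiv 𝓘(ℝ, EuclideanSpace ℝ (Fin m)) (𝓡 m) c.symm y (v 0),
        mfderiv 𝓘(ℝ, EuclideanSpace ℝ (Fin m)) (𝓡 m) c.symm y (v 1)] := by
    funext i; fin_cases i <;> rfl
  exact (congrArg (S.Φ (c.symm y)) e).trans (S.Φ_apply _ _ _)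

end FundamentalForm

/-! ### The `∂∂̄` of a form with differential `dT ∧ H - dH ∧ T` -/

section DelDelBar

section Algebra

variable {V : Type*} [AddCommGroup V] [Module ℝ V] [TopologicalSpace V]

/-- The decomposition of `a ∧ h - b ∧ t` into its parts of type `(1, 2)` and `(2, 1)`, where
`a + ib` is of type `(1, 1)` and `t + ih` is of type `(1, 0)`. -/
theorem wedge_sub_wedge_eq (a b : V [⋀^Fin 2]→L[ℝ] ℂ) (t h : V [⋀^Fin 1]→L[ℝ] ℂ) :
    wedge a h - wedge b t =
      (Complex.I / 2) • wedge (a + Complex.I • b) (t + (-Complex.I) • h) +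
      (-(Complex.I / 2)) • wedge (a + (-Complex.I) • b) (t + Complex.I • h) := by
  simp only [wedge_add_left, wedge_add_right, wedge_smul_left, wedge_smul_right]
  generalize wedge a h = x, wedge b t = y, wedge a t = z, wedge b h = w
  ext v
  change x v - y v = Complex.I / 2 * (z v + Complex.I * y v +
    (-Complex.I * x v + -Complex.I * (Complex.I * w v))) + -(Complex.I / 2) *
    (z v + -Complex.I * y v + (Complex.I * x v + Complex.I * (-Complex.I * w v)))
  linear_combination (x v - y v) * Complex.I_sq

/-- The mixed terms of `(a + ib) ∧ (a - ib)` cancel because `2`-forms commute. -/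
theorem wedge_add_sub (a b : V [⋀^Fin 2]→L[ℝ] ℂ) :
    wedge (a + Complex.I • b) (a + (-Complex.I) • b) = wedge a a + wedge b b := by
  simp only [wedge_add_left, wedge_add_right, wedge_smul_left, wedge_smul_right,
    wedge_comm_two b a]
  generalize wedge a a = x, wedge a b = y, wedge b b = z
  ext v
  change x v + Complex.I * y v + (-Complex.I * y v + -Complex.I * (Complex.I * z v)) = x v + z v
  linear_combination (-z v) * Complex.I_sq

end Algebra

variable {m : ℕ} {M : Type*} [TopologicalSpace M] [ChartedSpace (EuclideanSpace ℝ (Fin m)) M]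

theorem FormDifferentiableAt.smul (c : ℂ) {k : ℕ} {α : DForm m M ℂ k} {x : M}
    (h : FormDifferentiableAt α x) : FormDifferentiableAt (fun y => c • α y) x :=
  h.mapForm (ContinuousLinearMap.mul ℝ ℂ c)

theorem extD_smul (c : ℂ) {k : ℕ} {α : DForm m M ℂ k} {x : M} (h : FormDifferentiableAt α x) :
    extD (fun y => c • α y) x = c • extD α x :=
  extD_mapForm (ContinuousLinearMap.mul ℝ ℂ c) h

variable [IsManifold (𝓡 m) ∞ M] {J : (x : M) → TangentSpace (𝓡 m) x →L[ℝ] TangentSpace (𝓡 m) x}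
  {Ω : DForm m M ℂ 2} {T H : DForm m M ℂ 1}

/-- If `T + iH` is of type `(1, 0)`, the forms `dT` and `dH` are of type `(1, 1)`, and the
differential of the `(1, 1)`-form `Ω` is `dT ∧ H - dH ∧ T`, then
`2 ∂∂̄Ω = i (dT ∧ dT + dH ∧ dH)`. -/
theorem del_delBar_of_extD_eq (hJ : ∀ x X, J x (J x X) = -X)
    (hT : ∀ x, FormDifferentiableAt T x) (hH : ∀ x, FormDifferentiableAt H x)
    (hdT : ∀ x, FormDifferentiableAt (extD T) x) (hdH : ∀ x, FormDifferentiableAt (extD H) x)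
    (hddT : extD (extD T) = 0) (hddH : extD (extD H) = 0)
    (hTJ : ∀ x X, T x ![J x X] = -H x ![X]) (hHJ : ∀ x X, H x ![J x X] = T x ![X])
    (hdTJ : ∀ x X Y, extD T x ![J x X, J x Y] = extD T x ![X, Y])
    (hdHJ : ∀ x X Y, extD H x ![J x X, J x Y] = extD H x ![X, Y])
    (hΩ : ∀ x, IsOfType (J x) 1 1 (Ω x))
    (hdΩ : ∀ x, extD Ω x = wedge (extD T x) (H x) - wedge (extD H x) (T x)) (x : M) :
    del J (delBar J Ω) x =
      (Complex.I / 2) • (wedge (extD T x) (extD T x) + wedge (extD H x) (extD H x)) := by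
  have t11 : ∀ (c : ℂ) (x : M), IsOfType (J x) 1 1 (extD T x + c • extD H x) := fun c x =>
    (isOfType_one_one (hJ x) (hdTJ x)).add ((isOfType_one_one (hJ x) (hdHJ x)).smul c)
  have t10 : ∀ x, IsOfType (J x) 1 0 (T x + Complex.I • H x) := fun x => by
    refine isOfType_one_zero fun X => ?_
    change T x ![J x X] + Complex.I * H x ![J x X] = Complex.I * (T x ![X] + Complex.I * H x ![X])
    rw [hTJ, hHJ]
    linear_combination (-H x ![X]) * Complex.I_sq
  have t01 : ∀ x, IsOfType (J x) 0 1 (T x + (-Complex.I) • H x) := fun x => by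
    refine isOfType_zero_one fun X => ?_
    change T x ![J x X] + -Complex.I * H x ![J x X] =
      -Complex.I * (T x ![X] + -Complex.I * H x ![X])
    rw [hTJ, hHJ]
    linear_combination (-H x ![X]) * Complex.I_sq
  -- `β` is the `(1, 2)`-part of `dΩ`
  set β : DForm m M ℂ 3 := fun x => (Complex.I / 2) •
    wedgeForm (extD T + fun y => Complex.I • extD H y) (T + fun y => (-Complex.I) • H y) x with hβ
  have hβt : ∀ x, IsOfType (J x) 1 2 (β x) := fun x => ((t11 _ x).wedge (t01 x)).smul _
  have hbar : delBar J Ω = β := by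
    funext x
    have h2 : IsOfType (J x) 2 1
        ((-(Complex.I / 2)) • wedge (extD T x + (-Complex.I) • extD H x) (T x + Complex.I • H x)) :=
      ((t11 _ x).wedge (t10 x)).smul _
    rw [delBar_of_type (r := 1) (by norm_num) hΩ, hdΩ, wedge_sub_wedge_eq, typePart_add,
      h2.typePart_of_ne (r := 2) (by norm_num) (by norm_num) (by norm_num), add_zero]
    exact (hβt x).typePart_self (r := 1) (by norm_num)
  have hdβ : extD β x =
      (Complex.I / 2) •
        wedge (extD T x + Complex.I • extD H x) (extD T x + (-Complex.I) • extD H x) := by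
    have d1 := (hdT x).add ((hdH x).smul Complex.I)
    have d2 := (hT x).add ((hH x).smul (-Complex.I))
    have d3 : extD (extD T + fun y => Complex.I • extD H y) x = 0 := by
      rw [extD_add (hdT x) ((hdH x).smul _), extD_smul _ (hdH x), hddT, hddH]
      exact (zero_add _).trans (smul_zero _)
    rw [hβ, extD_smul _ (d1.wedgeForm d2), extD_wedge_two_one d1 d2 d3,
      extD_add (hT x) ((hH x).smul _), extD_smul _ (hH x)]
    rfl
  rw [hbar, del_of_type (r := 1) (by norm_num) hβt, hdβ]
  -- `dβ` is of type `(2, 2)`, so that it coincides with `∂β`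
  have t22 : IsOfType (J x) 2 2 ((Complex.I / 2) • wedge (extD T x + Complex.I • extD H x)
      (extD T x + (-Complex.I) • extD H x)) := ((t11 _ x).wedge (t11 _ x)).smul _
  rw [t22.typePart_self (r := 2) (by norm_num), wedge_add_sub]

end DelDelBar

/-! ### The almost Hermitian structure on a principal circle bundle -/

section Ogawa

variable {m m' : ℕ} {P N : Type*}
  [TopologicalSpace P] [ChartedSpace (EuclideanSpace ℝ (Fin m)) P] [IsManifold (𝓡 m) ∞ P]
  [TopologicalSpace N] [ChartedSpace (EuclideanSpace ℝ (Fin m')) N] [IsManifold (𝓡 m') ∞ N]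
  [MulAction Circle P]

omit [IsManifold (𝓡 m) ∞ P] [IsManifold (𝓡 m') ∞ N] [MulAction Circle P] in
theorem pullback_apply_one {f : P → N} (α : DForm m' N ℝ 1) (p : P) (X : TangentSpace (𝓡 m) p) :
    pullback (m := m) f α p ![X] = α (f p) ![mfderiv (𝓡 m) (𝓡 m') f p X] := by
  refine congrArg (α (f p)) (funext fun i => ?_)
  fin_cases i
  rfl

omit [IsManifold (𝓡 m) ∞ P] [IsManifold (𝓡 m') ∞ N] [MulAction Circle P] in
theorem pullback_apply_two {f : P → N} (α : DForm m' N ℝ 2) (p : P)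
    (X Y : TangentSpace (𝓡 m) p) :
    pullback (m := m) f α p ![X, Y] =
      α (f p) ![mfderiv (𝓡 m) (𝓡 m') f p X, mfderiv (𝓡 m) (𝓡 m') f p Y] := by
  refine congrArg (α (f p)) (funext fun i => ?_)
  fin_cases i <;> rfl

variable (S : AlmostContactMetric m' N) {proj : P → N}
  (hP : IsPrincipalCircleBundle (m := m) (m' := m') proj) {θ : DForm m P ℝ 1}
  (hθ : IsConnectionForm θ)

include hP hθ

/-- The fundamental form of `(J, h)` is `Ω = π*Φ + θ ∧ π*η`. -/
theorem fundamentalForm_ogawa_eq :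
    fundamentalForm (ogawaJ S proj θ) (ogawaMetric S proj θ) =
      pullback (m := m) proj S.Φ + wedgeForm θ (pullback (m := m) proj S.η) := by
  funext p
  ext v
  have e : v = ![v 0, v 1] := funext fun i => by fin_cases i <;> rfl
  rw [e, fundamentalForm_ogawa S hP hθ, ogawaMetric_apply, (ogawaJ_spec S hP hθ p _).1,
    (ogawaJ_spec S hP hθ p _).2]
  refine Eq.trans ?_ (congrArg₂ (· + ·) (pullback_apply_two S.Φ p (v 0) (v 1)).symm
    (wedge_one_one (θ p) (pullback (m := m) proj S.η p) (v 0) (v 1)).symm)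
  rw [pullback_apply_one, pullback_apply_one, S.Φ_apply, map_add, map_smul, add_apply, smul_apply,
    S.g.symm _ (S.ξ _), S.g_ξ, smul_eq_mul]
  ring

/-- As `Φ` is closed, `dΩ = dθ ∧ π*η - π*dη ∧ θ`. -/
theorem extD_fundamentalForm_ogawa (hS : extD S.Φ = 0) (p : P) :
    extD (fundamentalForm (ogawaJ S proj θ) (ogawaMetric S proj θ)) p =
      wedge (extD θ p) (pullback (m := m) proj S.η p) -
        wedge (extD (pullback (m := m) proj S.η) p) (θ p) := by
  have hη := formDifferentiableAt_pullback hP.smooth_proj S.smooth_η.differentiableAt p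
  have h0 : extD (pullback (m := m) proj S.Φ) p = 0 := by
    rw [extD_pullback hP.smooth_proj S.formDifferentiableAt_Φ, hS]
    rfl
  rw [fundamentalForm_ogawa_eq S hP hθ,
    extD_add (formDifferentiableAt_pullback hP.smooth_proj S.formDifferentiableAt_Φ p)
      ((hθ.smooth.differentiableAt p).wedgeForm hη), h0,
    extD_wedge_one_one (hθ.smooth.differentiableAt p) hη, zero_add]

/-- The fundamental form of `(J, h)` is of type `(1, 1)`. -/
theorem isOfType_fundamentalForm_ogawa (p : P) :
    IsOfType (ogawaJ S proj θ p) 1 1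
      (complexify (fundamentalForm (ogawaJ S proj θ) (ogawaMetric S proj θ)) p) := by
  refine isOfType_one_one (ogawaJ_ogawaJ S hP hθ p) fun X Y => congrArg Complex.ofReal ?_
  refine (fundamentalForm_ogawa S hP hθ p _ _).trans ?_
  rw [ogawaMetric_compatible S hP hθ]
  exact (fundamentalForm_ogawa S hP hθ p X Y).symm

/-- The form `π*dη` is `J`-invariant: `J` covers `φ` up to multiples of `ξ`, and `dη` is invariant
under `φ` and annihilated by `ξ`. -/
theorem extD_pullback_η_ogawaJ [T2Space N] [SecondCountableTopology N] (hS : S.IsNormal) (p : P)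
    (X Y : TangentSpace (𝓡 m) p) :
    extD (pullback (m := m) proj S.η) p ![ogawaJ S proj θ p X, ogawaJ S proj θ p Y] =
      extD (pullback (m := m) proj S.η) p ![X, Y] := by
  rw [extD_pullback hP.smooth_proj S.smooth_η.differentiableAt, pullback_apply_two,
    pullback_apply_two, (ogawaJ_spec S hP hθ p X).2, (ogawaJ_spec S hP hθ p Y).2,
    ← hS.extD_η_φ_φ (proj p) (mfderiv (𝓡 m) (𝓡 m') proj p X)]
  refine Eq.trans (congrArg (extD S.η (proj p)) (funext fun i => ?_))
    (apply_add_smul_of_kernel (extD S.η (proj p))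
      (apply_eq_zero_of_apply_left_eq_zero (hS.extD_η_ξ (proj p))) _ ![θ p ![X], θ p ![Y]])
  fin_cases i <;> rfl

/-- The curvature of a connection whose curvature is `J`-invariant is annihilated by `ξ`: the lift
of `ξ` is `J` applied to a vertical vector. -/
theorem curvature_apply_ξ {F : DForm m' N ℝ 2} (hcurv : extD θ = pullback (m := m) proj F)
    (hJ : ∀ (p : P) (X Y : TangentSpace (𝓡 m) p),
      extD θ p ![ogawaJ S proj θ p X, ogawaJ S proj θ p Y] = extD θ p ![X, Y]) (p : P)
    (y : TangentSpace (𝓡 m') (proj p)) : F (proj p) ![S.ξ (proj p), y] = 0 := by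
  obtain ⟨e, he⟩ := isInvertible_splitting hP hθ p
  have hs : ∀ w, splitting (m' := m') proj θ p (e.symm w) = w := fun w =>
    (DFunLike.congr_fun he (e.symm w)).symm.trans (e.apply_symm_apply w)
  have h1 : ∀ w, mfderiv (𝓡 m) (𝓡 m') proj p (e.symm w) = w.1 := fun w =>
    congrArg Prod.fst (hs w)
  have h2 : ∀ w, θ p ![e.symm w] = w.2 := fun w =>
    (toCLM_apply θ p _).symm.trans (congrArg Prod.snd (hs w))
  -- with `v` the vertical vector such that `θ v = 1` and `y'` the horizontal lift of `y`,
  -- invariance gives `dθ(Jv, y') = dθ(v, -Jy') = 0`, and `Jv` projects to `ξ`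
  have h := hJ p (e.symm (0, 1)) (-ogawaJ S proj θ p (e.symm (y, 0)))
  rw [map_neg, ogawaJ_ogawaJ S hP hθ, neg_neg, hcurv, pullback_apply_two, pullback_apply_two,
    (ogawaJ_spec S hP hθ p _).2, h1, h1, h2, map_zero, zero_add, one_smul] at h
  rw [h]
  exact (F (proj p)).map_coord_zero 0 rfl

end Ogawa

/-! ### `∂∂̄Ω` on the circle bundle -/

/-- A vector in the kernel of `τ` is in the kernel of `τ ∧ τ`. -/
theorem wedge_self_eq_zero_of_kernel {V : Type*} [AddCommGroup V] [Module ℝ V] [TopologicalSpace V]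
    {τ : V [⋀^Fin 2]→L[ℝ] ℝ} {x : V} (h : ∀ y, τ ![x, y] = 0) (w : Fin 4 → V) (i : Fin 4)
    (hi : w i = x) : wedge τ τ w = 0 := by
  have h1 := apply_eq_zero_of_apply_left_eq_zero h
  exact (wedge_apply τ τ w).trans
    (altProd_eq_zero_of_kernel (k := 2) (l := 2) rfl (f := τ) (g := τ) h1 h1 w i hi)

section DelDelBarOgawa

variable {m m' : ℕ} {P N : Type*}
  [TopologicalSpace P] [ChartedSpace (EuclideanSpace ℝ (Fin m)) P] [IsManifold (𝓡 m) ∞ P]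
  [TopologicalSpace N] [ChartedSpace (EuclideanSpace ℝ (Fin m')) N] [IsManifold (𝓡 m') ∞ N]
  [MulAction Circle P]

omit [MulAction Circle P] [TopologicalSpace N] [ChartedSpace (EuclideanSpace ℝ (Fin m')) N]
  [IsManifold (𝓡 m') ∞ N] [IsManifold (𝓡 m) ∞ P] in
theorem extD_complexify {k : ℕ} {α : DForm m P ℝ k} (h : ∀ x, FormDifferentiableAt α x) :
    extD (complexify α) = complexify (extD α) :=
  funext fun x => extD_mapForm Complex.ofRealCLM (h x)

variable [T2Space N] [SecondCountableTopology N] (S : AlmostContactMetric m' N) {proj : P → N}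
  (hP : IsPrincipalCircleBundle (m := m) (m' := m') proj) {θ : DForm m P ℝ 1}
  (hθ : IsConnectionForm θ)

include hP hθ

/-- The form `∂∂̄Ω` of `(J, h)` is `i/2` times the pullback of `dη ∧ dη + F ∧ F`. -/
theorem del_delBar_fundamentalForm_ogawa (hS : S.IsQuasiSasakian) {F : DForm m' N ℝ 2}
    (hcurv : extD θ = pullback (m := m) proj F)
    (hJ : ∀ (p : P) (X Y : TangentSpace (𝓡 m) p),
      extD θ p ![ogawaJ S proj θ p X, ogawaJ S proj θ p Y] = extD θ p ![X, Y]) (p : P) :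
    del (ogawaJ S proj θ) (delBar (ogawaJ S proj θ)
      (complexify (fundamentalForm (ogawaJ S proj θ) (ogawaMetric S proj θ)))) p =
      (Complex.I / 2) • complexify (pullback (m := m) proj
        (wedgeForm (extD S.η) (extD S.η) + wedgeForm F F)) p := by
  set H : DForm m P ℝ 1 := pullback (m := m) proj S.η with hHdef
  have hη : ∀ p, FormDifferentiableAt H p :=
    formDifferentiableAt_pullback hP.smooth_proj S.smooth_η.differentiableAt
  have hT : ∀ p, FormDifferentiableAt θ p := hθ.smooth.differentiableAt
  have hdT : ∀ p, FormDifferentiableAt (extD θ) p := formDifferentiableAt_extD hθ.smooth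
  have hdη : extD H = pullback (m := m) proj (extD S.η) :=
    extD_pullback hP.smooth_proj S.smooth_η.differentiableAt
  have hdH : ∀ p, FormDifferentiableAt (extD H) p := by
    rw [hdη]
    exact formDifferentiableAt_pullback hP.smooth_proj (formDifferentiableAt_extD S.smooth_η)
  have hddH : extD (extD H) = 0 := by
    rw [hdη, extD_pullback hP.smooth_proj (formDifferentiableAt_extD S.smooth_η),
      extD_extD S.smooth_η]
    rfl
  have hΩd : ∀ p, FormDifferentiableAt
      (fundamentalForm (ogawaJ S proj θ) (ogawaMetric S proj θ)) p := by
    rw [fundamentalForm_ogawa_eq S hP hθ]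
    exact fun p => (formDifferentiableAt_pullback hP.smooth_proj S.formDifferentiableAt_Φ p).add
      ((hT p).wedgeForm (hη p))
  have key := del_delBar_of_extD_eq (J := ogawaJ S proj θ)
    (Ω := complexify (fundamentalForm (ogawaJ S proj θ) (ogawaMetric S proj θ)))
    (T := complexify θ) (H := complexify H) (ogawaJ_ogawaJ S hP hθ)
    (fun p => (hT p).mapForm _) (fun p => (hη p).mapForm _)
    (by rw [extD_complexify hT]; exact fun p => (hdT p).mapForm _)
    (by rw [extD_complexify hη]; exact fun p => (hdH p).mapForm _)
    (by
      rw [extD_complexify hT, extD_complexify hdT, extD_extD hθ.smooth]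
      exact funext fun p => ContinuousAlternatingMap.ext fun v => Complex.ofReal_zero)
    (by
      rw [extD_complexify hη, extD_complexify hdH, hddH]
      exact funext fun p => ContinuousAlternatingMap.ext fun v => Complex.ofReal_zero)
    (by
      intro p X
      change ((θ p ![ogawaJ S proj θ p X] : ℝ) : ℂ) = -((H p ![X] : ℝ) : ℂ)
      rw [hHdef, pullback_apply_one, (ogawaJ_spec S hP hθ p X).1, Complex.ofReal_neg])
    (by
      intro p X
      change ((H p ![ogawaJ S proj θ p X] : ℝ) : ℂ) = ((θ p ![X] : ℝ) : ℂ)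
      rw [hHdef, pullback_apply_one, (ogawaJ_spec S hP hθ p X).2, ← toCLM_apply, map_add, map_smul,
        toCLM_apply, toCLM_apply, S.η_φ, S.η_ξ, smul_eq_mul, mul_one, zero_add])
    (by
      rw [extD_complexify hT]
      exact fun p X Y => congrArg Complex.ofReal (hJ p X Y))
    (by
      rw [extD_complexify hη]
      exact fun p X Y => congrArg Complex.ofReal
        (extD_pullback_η_ogawaJ S hP hθ hS.normal p X Y))
    (isOfType_fundamentalForm_ogawa S hP hθ)
    (by
      intro p
      rw [extD_complexify hΩd, extD_complexify hT, extD_complexify hη]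
      have h1 : wedge (complexify (extD θ) p) (complexify H p) =
        Complex.ofRealCLM.compContinuousAlternatingMap (wedge (extD θ p) (H p)) := wedge_ofReal _ _
      have h2 : wedge (complexify (extD H) p) (complexify θ p) =
        Complex.ofRealCLM.compContinuousAlternatingMap (wedge (extD H p) (θ p)) := wedge_ofReal _ _
      rw [h1, h2]
      ext v
      exact (congrArg Complex.ofReal (DFunLike.congr_fun
        (extD_fundamentalForm_ogawa S hP hθ hS.closed p) v)).trans (Complex.ofReal_sub _ _))
    p
  rw [key, extD_complexify hT, extD_complexify hη, hdη, hcurv]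
  have h1 : wedge (complexify (pullback (m := m) proj F) p)
      (complexify (pullback (m := m) proj F) p) =
      complexify (pullback (m := m) proj (wedgeForm F F)) p :=
    (wedge_ofReal _ _).trans
      (congrArg Complex.ofRealCLM.compContinuousAlternatingMap
        (wedge_compContinuousLinearMap _ _ _))
  have h2 : wedge (complexify (pullback (m := m) proj (extD S.η)) p)
      (complexify (pullback (m := m) proj (extD S.η)) p) =
      complexify (pullback (m := m) proj (wedgeForm (extD S.η) (extD S.η))) p :=
    (wedge_ofReal _ _).trans
      (congrArg Complex.ofRealCLM.compContinuousAlternatingMap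
        (wedge_compContinuousLinearMap _ _ _))
  rw [h1, h2]
  refine congrArg _ (ContinuousAlternatingMap.ext fun v => ?_)
  exact (add_comm _ _).trans (Complex.ofReal_add _ _).symm

omit [T2Space N] [SecondCountableTopology N] in
/-- A `4`-form on the base annihilated by `ξ` is wedged to zero with `Φ^j` if and only if its
pullback is wedged to zero with `Ω^(j+1)`. -/
theorem wedge_pullback_wedgePow_eq_zero_iff {j : ℕ} (hm : m' = 2 * j + 5) (G : DForm m' N ℝ 4)
    (p : P) (hG : ∀ (w : Fin 4 → TangentSpace (𝓡 m') (proj p)) (i : Fin 4),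
      w i = S.ξ (proj p) → G (proj p) w = 0) :
    wedge (pullback (m := m) proj G p)
        (wedgePow (fundamentalForm (ogawaJ S proj θ) (ogawaMetric S proj θ) p) (j + 1)) = 0 ↔
      wedge (G (proj p)) (wedgePow (S.Φ (proj p)) j) = 0 := by
  obtain ⟨e, he⟩ := isInvertible_splitting hP hθ p
  have he' : ∀ X, e X = (mfderiv (𝓡 m) (𝓡 m') proj p X, θ p ![X]) :=
    fun X => (DFunLike.congr_fun he X).trans (Prod.ext rfl (toCLM_apply θ p X))
  have hq : ContinuousLinearMap.fst ℝ (TangentSpace (𝓡 m') (proj p)) ℝ ∘L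
      e.toContinuousLinearMap = mfderiv (𝓡 m) (𝓡 m') proj p :=
    ContinuousLinearMap.ext fun X => congrArg Prod.fst (he' X)
  have hdim : Module.finrank ℝ (TangentSpace (𝓡 m') (proj p)) = 2 * j + 5 :=
    (finrank_euclideanSpace_fin (𝕜 := ℝ) (n := m')).trans hm
  have : FiniteDimensional ℝ (TangentSpace (𝓡 m') (proj p)) :=
    inferInstanceAs (FiniteDimensional ℝ (EuclideanSpace ℝ (Fin m')))
  have hΩ : ∀ X Y, fundamentalForm (ogawaJ S proj θ) (ogawaMetric S proj θ) p ![X, Y] =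
      S.Φ (proj p) ![(e X).1, (e Y).1] + (e X).2 * toCLM S.η (proj p) (e Y).1 -
        (e Y).2 * toCLM S.η (proj p) (e X).1 := by
    intro X Y
    rw [he', he', toCLM_apply, toCLM_apply, fundamentalForm_ogawa_eq S hP hθ]
    refine (congrArg₂ (· + ·) (pullback_apply_two S.Φ p X Y)
      (wedge_one_one (θ p) (pullback (m := m) proj S.η p) X Y)).trans ?_
    rw [pullback_apply_one, pullback_apply_one]
    ring
  have h := wedge_wedgePow_eq_zero_iff j hdim e (toCLM S.η (proj p)) (ξ := S.ξ (proj p))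
    ((toCLM_apply _ _ _).trans (S.η_ξ _)) (G (proj p)) hG (S.Φ (proj p))
    (fun y => by rw [S.Φ_apply, S.φ_ξ, map_zero, zero_apply]) _ hΩ
  rwa [hq] at h

/-- The equivalence at a point of the bundle: `∂∂̄Ω ∧ Ω^(j+1)` is `i/2` times the complexification
of the real form `π*(dη ∧ dη + F ∧ F) ∧ Ω^(j+1)`, and `ξ` annihilates `dη ∧ dη + F ∧ F`. -/
theorem del_delBar_wedge_wedgePow_eq_zero_iff (hS : S.IsQuasiSasakian) {F : DForm m' N ℝ 2}
    (hcurv : extD θ = pullback (m := m) proj F)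
    (hJ : ∀ (p : P) (X Y : TangentSpace (𝓡 m) p),
      extD θ p ![ogawaJ S proj θ p X, ogawaJ S proj θ p Y] = extD θ p ![X, Y]) {j : ℕ}
    (hm : m' = 2 * j + 5) (p : P) :
    wedge (del (ogawaJ S proj θ) (delBar (ogawaJ S proj θ)
        (complexify (fundamentalForm (ogawaJ S proj θ) (ogawaMetric S proj θ)))) p)
      (wedgePow (complexify (fundamentalForm (ogawaJ S proj θ) (ogawaMetric S proj θ)) p)
        (j + 1)) = 0 ↔
      wedge ((wedgeForm (extD S.η) (extD S.η) + wedgeForm F F) (proj p))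
        (wedgePow (S.Φ (proj p)) j) = 0 := by
  set G : DForm m' N ℝ 4 := wedgeForm (extD S.η) (extD S.η) + wedgeForm F F with hG
  set Ω := fundamentalForm (ogawaJ S proj θ) (ogawaMetric S proj θ) with hΩ
  have hGξ : ∀ (w : Fin 4 → TangentSpace (𝓡 m') (proj p)) (i : Fin 4),
      w i = S.ξ (proj p) → G (proj p) w = 0 := by
    intro w i hi
    change wedge (extD S.η (proj p)) (extD S.η (proj p)) w + wedge (F (proj p)) (F (proj p)) w = 0
    rw [wedge_self_eq_zero_of_kernel (hS.normal.extD_η_ξ (proj p)) w i hi,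
      wedge_self_eq_zero_of_kernel (curvature_apply_ξ S hP hθ hcurv hJ p) w i hi, add_zero]
  have hreal : wedge (del (ogawaJ S proj θ) (delBar (ogawaJ S proj θ) (complexify Ω)) p)
      (wedgePow (complexify Ω p) (j + 1)) = (Complex.I / 2) •
        Complex.ofRealCLM.compContinuousAlternatingMap
          (wedge (pullback (m := m) proj G p) (wedgePow (Ω p) (j + 1))) := by
    rw [hΩ, del_delBar_fundamentalForm_ogawa S hP hθ hS hcurv hJ, wedge_smul_left]
    have h1 : wedgePow (complexify Ω p) (j + 1) =
        Complex.ofRealCLM.compContinuousAlternatingMap (wedgePow (Ω p) (j + 1)) :=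
      wedgePow_ofReal _ _
    have h2 : wedge (complexify (pullback (m := m) proj G) p)
        (Complex.ofRealCLM.compContinuousAlternatingMap (wedgePow (Ω p) (j + 1))) =
        Complex.ofRealCLM.compContinuousAlternatingMap
          (wedge (pullback (m := m) proj G p) (wedgePow (Ω p) (j + 1))) := wedge_ofReal _ _
    rw [h1, h2]
  rw [← wedge_pullback_wedgePow_eq_zero_iff S hP hθ hm G p hGξ, hreal]
  constructor
  · intro h
    ext v
    have h1 : Complex.I / 2 * ((wedge (pullback (m := m) proj G p)
      (wedgePow (Ω p) (j + 1)) v : ℝ) : ℂ) = 0 := DFunLike.congr_fun h v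
    simpa using h1
  · intro h
    ext v
    change Complex.I / 2 * ((wedge (pullback (m := m) proj G p)
      (wedgePow (Ω p) (j + 1)) v : ℝ) : ℂ) = 0
    rw [h]
    simp

end DelDelBarOgawa

end CircleBundleGauduchon

theorem mainTheorem10 (n : ℕ) (hn : 2 < n)
    {N : Type*} [TopologicalSpace N] [T2Space N] [SecondCountableTopology N]
    [ChartedSpace (EuclideanSpace ℝ (Fin (2 * n - 1))) N] [IsManifold (𝓡 (2 * n - 1)) ∞ N]
    (S : AlmostContactMetric (2 * n - 1) N) (hS : S.IsQuasiSasakian)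
    (F : DForm (2 * n - 1) N ℝ 2) (hF : IsSmoothForm F) (hFclosed : extD F = 0)
    (hFint : IsIntegralClass F)
    {P : Type*} [TopologicalSpace P] [T2Space P] [SecondCountableTopology P]
    [ChartedSpace (EuclideanSpace ℝ (Fin (2 * n))) P] [IsManifold (𝓡 (2 * n)) ∞ P]
    [MulAction Circle P] (proj : P → N)
    (hP : IsPrincipalCircleBundle (m := 2 * n) (m' := 2 * n - 1) proj)
    (θ : DForm (2 * n) P ℝ 1) (hθ : IsConnectionForm θ)
    (hcurv : extD θ = pullback proj F)
    (hJ : ∀ (p : P) (X Y : TangentSpace (𝓡 (2 * n)) p),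
      extD θ p ![ogawaJ S proj θ p X, ogawaJ S proj θ p Y] = extD θ p ![X, Y]) :
    IsFirstGauduchon n (ogawaJ S proj θ) (ogawaMetric S proj θ) ↔
      wedgeForm (wedgeForm (extD S.η) (extD S.η) + wedgeForm F F) (powForm S.Φ (n - 3)) = 0 := by
  -- then `n - 3 = j`, `n - 2 = j + 1` and the base has dimension `2 * j + 5`
  obtain ⟨j, rfl⟩ : ∃ j, n = j + 3 := ⟨n - 3, by omega⟩
  have key := fun p =>
    del_delBar_wedge_wedgePow_eq_zero_iff S hP hθ hS hcurv hJ (j := j) (by omega) p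
  constructor
  · intro h
    funext x
    -- local trivializations show that `proj` is surjective
    obtain ⟨e, hx, -⟩ := hP.exists_trivialization x
    obtain ⟨p, rfl⟩ : ∃ p, proj p = x := ⟨_, e.proj_symm_apply' (x := (1 : Circle)) hx⟩
    exact (key p).1 (congrFun h p)
  · intro h
    funext p
    exact (key p).2 (congrFun h (proj p))
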